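/- Let $(R,\mathfrak m)\to(S,\mathfrak n)$ be a flat local homomorphism of Noetherian local rings such that $R$ is a domain and $\dim R=\dim S=:d$. For a finitely generated module $M$ over a Noetherian local ring $(A,\mathfrak a)$, let $\nu(M)$ be its minimal number of generators, let $e(\mathfrak a,M)=\lim_{k\to\infty}(\dim A)!\,\operatorname{length}(M/\mathfrak a^kM)/k^{\dim A}$ be its Hilbert–Samuel multiplicity, and put $e(A)=e(\mathfrak a,A)$. Suppose that $R$ admits a weakly lim Ulrich sequence, that is, a sequence $(U_n)_{n\in\mathbb N}$ of finitely generated $R$-modules of dimension $d$ such that 1. $(U_n)$ is weakly lim Cohen–Macaulay: for some system of parameters $\underline x=x_1,\dots,x_d$ of $R$, the first higher Euler characteristics $\chi_1(\underline x,U_n)=\sum_{i=1}^{d}(-1)^{i-1}\operatorname{length}H_i(\underline x,U_n)$ of Koszul homology satisfy $\chi_1(\underline x,U_n)=o(\nu(U_n))$ as $n\to\infty$; and 2. $\lim_{n\to\infty} e(\mathfrak m,U_n)/\nu(U_n)=1$. Then $e(R)\le e(S)$. -/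

import Mathlib

namespace LimUlrich

noncomputable section

/-- The Krull dimension of `R` as a natural number. A Noetherian local ring is nonzero and has
finite Krull dimension, so no information is lost for such rings. -/
def dim (R : Type*) [CommRing R] : ℕ :=
  ((ringKrullDim R).unbotD 0).toNat

/-- The length of an `R`-module as a natural number (only used for modules of finite length). -/
def len (R : Type*) [CommRing R] (M : Type*) [AddCommGroup M] [Module R M] : ℕ :=
  (Module.length R M).toNat

/-- `ν(M)`: the minimal number of generators of a finitely generated module. -/
def nu (R : Type*) [CommRing R] (M : Type*) [AddCommGroup M] [Module R M] : ℕ :=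
  (⊤ : Submodule R M).spanFinrank

/-- A system of parameters of a local ring `R` of dimension `d`: elements `x₁, …, x_d` that
generate an ideal primary to the maximal ideal. -/
def IsSystemOfParameters {R : Type*} [CommRing R] [IsLocalRing R] (x : Fin (dim R) → R) : Prop :=
  (Ideal.span (Set.range x)).radical = IsLocalRing.maximalIdeal R

/-- The Hilbert–Samuel multiplicity
`e(I, M) = lim_{n → ∞} d! · length(M / Iⁿ M) / n ^ d`, where `d = dim R`.
The limit exists for `R` Noetherian local, `M` finitely generated and `I` primary to the maximal
ideal, the only case in which it is used. -/
def hsMultiplicity {R : Type*} [CommRing R] (I : Ideal R)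
    (M : Type*) [AddCommGroup M] [Module R M] : ℝ :=
  Filter.limUnder Filter.atTop fun n : ℕ =>
    ((dim R).factorial : ℝ) * (len R (M ⧸ (I ^ n • ⊤ : Submodule R M)) : ℝ) / (n : ℝ) ^ dim R

/-- `e(R) = e(𝔪, R)`. -/
def ringMultiplicity (R : Type*) [CommRing R] [IsLocalRing R] : ℝ :=
  hsMultiplicity (IsLocalRing.maximalIdeal R) R

/-- Koszul chains of degree `i` on `d` elements with coefficients in `M`: the module
`⋀ⁱ(Rᵈ) ⊗ M`, written through the basis `e_s`, `s ⊆ {1, …, d}`, `#s = i`. -/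
abbrev KoszulChain (d : ℕ) (M : Type*) (i : ℕ) : Type _ :=
  {s : Finset (Fin d) // s.card = i} → M

/-- The subset `t ∪ {j}`, for `j ∉ t`. -/
def insertIndex {d i : ℕ} (t : {s : Finset (Fin d) // s.card = i}) (j : {j : Fin d // j ∉ t.1}) :
    {s : Finset (Fin d) // s.card = i + 1} :=
  ⟨insert j.1 t.1, by rw [Finset.card_insert_of_notMem j.2, t.2]⟩

/-- The Koszul differential `∂ : K_{i+1}(x; M) → K_i(x; M)`, that is
`∂(e_s ⊗ m) = ∑_{j ∈ s} (-1) ^ #{k ∈ s | k < j} e_{s ∖ {j}} ⊗ x_j m`, read off on the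
coefficient of each `e_t`. -/
def koszulD {R : Type*} [CommRing R] {d : ℕ} (x : Fin d → R)
    (M : Type*) [AddCommGroup M] [Module R M] (i : ℕ) :
    KoszulChain d M (i + 1) →ₗ[R] KoszulChain d M i where
  toFun f t := ∑ j : {j : Fin d // j ∉ t.1},
    ((-1 : R) ^ (t.1.filter (· < j.1)).card * x j.1) • f (insertIndex t j)
  map_add' f g := by
    funext t
    simp [smul_add, Finset.sum_add_distrib]
  map_smul' r f := by
    funext t
    simp only [Pi.smul_apply, RingHom.id_apply, Finset.smul_sum]
    exact Finset.sum_congr rfl fun j _ => smul_comm _ _ _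

/-- The Koszul differentials form a complex. -/
theorem koszulD_comp {R : Type*} [CommRing R] {d : ℕ} (x : Fin d → R)
    (M : Type*) [AddCommGroup M] [Module R M] (i : ℕ) (f : KoszulChain d M (i + 2)) :
    koszulD x M i (koszulD x M (i + 1) f) = 0 := by
  funext t
  simp only [koszulD, LinearMap.coe_mk, AddHom.coe_mk, Finset.smul_sum, smul_smul, Pi.zero_apply]
  rw [Finset.sum_sigma']
  have key : ∀ j k : Fin d, j ∉ t.1 → k ∉ t.1 → j < k →
      (-1 : R) ^ (t.1.filter (· < j)).card * x j *
        ((-1 : R) ^ ((insert j t.1).filter (· < k)).card * x k) +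
      (-1 : R) ^ (t.1.filter (· < k)).card * x k *
        ((-1 : R) ^ ((insert k t.1).filter (· < j)).card * x j) = 0 := by
    intro j k hj hk h
    rw [Finset.filter_insert, Finset.filter_insert, if_pos h, if_neg (not_lt.mpr h.le),
      Finset.card_insert_of_notMem (by simp [hj])]
    ring
  refine Finset.sum_involution
    (fun p _ => ⟨⟨p.2.1, fun h => p.2.2 (Finset.mem_insert_of_mem h)⟩,
      ⟨p.1.1, fun h => (Finset.mem_insert.mp h).elim
        (fun e => p.2.2 (Finset.mem_insert.mpr (Or.inl e.symm))) p.1.2⟩⟩)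
    ?_ ?_ (fun _ _ => Finset.mem_univ _) (fun _ _ => rfl)
  · rintro ⟨⟨j, hj⟩, ⟨k, hk⟩⟩ -
    have hk' : k ≠ j ∧ k ∉ t.1 := by simpa [insertIndex] using hk
    have e : ∀ h1 h2 h3 h4, insertIndex (insertIndex t ⟨j, h1⟩) ⟨k, h2⟩ =
        insertIndex (insertIndex t ⟨k, h3⟩) ⟨j, h4⟩ := fun _ _ _ _ =>
      Subtype.ext (Finset.insert_comm k j t.1)
    dsimp only
    rw [e hj hk hk'.2 (by simp [insertIndex, hj, hk'.1.symm]), ← add_smul]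
    rcases lt_or_gt_of_ne hk'.1 with h | h
    · rw [add_comm]
      exact (congrArg (· • _) (key k j hk'.2 hj h)).trans (zero_smul R _)
    · exact (congrArg (· • _) (key j k hj hk'.2 h)).trans (zero_smul R _)
  · rintro ⟨⟨j, hj⟩, ⟨k, hk⟩⟩ - - heq
    have hk' : k ≠ j ∧ k ∉ t.1 := by simpa [insertIndex] using hk
    exact hk'.1 (congrArg (fun p => p.1.1) heq)

/-- The cycles of the Koszul complex in degree `i` (everything in degree `0`). -/
def koszulCycles {R : Type*} [CommRing R] {d : ℕ} (x : Fin d → R)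
    (M : Type*) [AddCommGroup M] [Module R M] :
    (i : ℕ) → Submodule R (KoszulChain d M i)
  | 0 => ⊤
  | i + 1 => LinearMap.ker (koszulD x M i)

/-- The Koszul homology module `H_i(x, M)`: cycles modulo boundaries. -/
abbrev KoszulHomology {R : Type*} [CommRing R] {d : ℕ} (x : Fin d → R)
    (M : Type*) [AddCommGroup M] [Module R M] (i : ℕ) : Type _ :=
  koszulCycles x M i ⧸ (LinearMap.range (koszulD x M i)).submoduleOf (koszulCycles x M i)

/-- The first higher Euler characteristic
`χ₁(x, M) = ∑_{i=1}^{d} (-1)^{i-1} length H_i(x, M)`. -/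
def chiOne {R : Type*} [CommRing R] {d : ℕ} (x : Fin d → R)
    (M : Type*) [AddCommGroup M] [Module R M] : ℤ :=
  ∑ i ∈ Finset.Icc 1 d, (-1 : ℤ) ^ (i - 1) * (len R (KoszulHomology x M i) : ℤ)

/-- A sequence of finitely generated `R`-modules of dimension `dim R` is weakly lim
Cohen–Macaulay if `χ₁(x, M_n) = o(ν(M_n))` for some system of parameters `x` of `R`. -/
structure IsWeaklyLimCohenMacaulay (R : Type*) [CommRing R] [IsLocalRing R]
    (M : ℕ → Type*) [∀ n, AddCommGroup (M n)] [∀ n, Module R (M n)] : Prop where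
  finite : ∀ n, Module.Finite R (M n)
  supportDim_eq : ∀ n, Module.supportDim R (M n) = ringKrullDim R
  exists_chiOne_isLittleO : ∃ x : Fin (dim R) → R, IsSystemOfParameters x ∧
    (fun n => (chiOne x (M n) : ℝ)) =o[Filter.atTop] (fun n => (nu R (M n) : ℝ))

/-- A weakly lim Cohen–Macaulay sequence is weakly lim Ulrich if moreover
`e(𝔪, U_n) / ν(U_n) → 1`. -/
structure IsWeaklyLimUlrich (R : Type*) [CommRing R] [IsLocalRing R]
    (U : ℕ → Type*) [∀ n, AddCommGroup (U n)] [∀ n, Module R (U n)] : Prop extends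
    IsWeaklyLimCohenMacaulay R U where
  tendsto_multiplicity_div_nu : Filter.Tendsto
    (fun n => hsMultiplicity (IsLocalRing.maximalIdeal R) (U n) / (nu R (U n) : ℝ))
    Filter.atTop (nhds 1)

end

end LimUlrich

/-!
# Multiplicities under flat local homomorphisms

The comparison `e(R) ≤ e(S)` is read off from a single inequality for a finitely generated
`R`-module `U` of rank `r`: there are constants `e = e(S)` and `c`, independent of `U`, with

  `ν(U) ≤ r · e(S) + c · χ₁(x, U)`.

Since `e(𝔪, U) = r · e(R)`, multiplying by `e(R)`, dividing by `ν(U)` and letting `U` run through a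
weakly lim Ulrich sequence gives `e(R) ≤ e(S)`.

To obtain the inequality, the residue field of `S` is first enlarged, replacing `S` by the
localization of `S[X]` at `𝔫S[X]`, which changes no Hilbert–Samuel function
(`hsFunction_eq_of_map_maximalIdeal`). Over the infinite residue field one chooses a superficial
system of parameters `y` of `S`. With `M = S ⊗ U`,

  `ν(U) ≤ length(M / yM) = e(y; M) + (length(M / yM) - e(y; M))`,

where `e(y; M)` is the multiplicity symbol of Northcott and Wright (`symb`). It is defined
recursively by `e(y, l; M) = e(l; M/yM) - e(l; 0 :_M y)`, so that its additivity in `M`, its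
symmetry and nonnegativity and the rule `e(ab, l; M) = e(a, l; M) + e(b, l; M)` are elementary, and
no Hilbert polynomials are needed.

* The first summand is `r · e(y; S)`, because the symbol is additive and vanishes on modules killed
  by a nonzerodivisor (`symb_eq_zero_of_smul_eq_zero`). For superficial `y` the number `e(y; S)` is
  the leading coefficient `e(S)` of the Hilbert–Samuel function (`hsFunction_sub_isLittleO`).
* The second summand, the defect of `y` on `M`, is bounded by a constant times the defect on `M` of
  the image of `x`: two systems of parameters are linked by exchanging one element at a time, and
  each exchange costs a factor independent of the module (`exists_defect_append_le`,
  `exists_isSuperficialSeq_defect_le`). The image of `x` is a system of parameters of `S` because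
  the closed fibre has dimension zero (`maximalIdeal_le_radical_map`).
* The defect of the image of `x` on `S ⊗ U` is `length(S/𝔪S)` times that of `x` on `U`
  (`defect_baseChange`), and the defect of `x` on `U` is the first higher Euler characteristic
  `χ₁(x, U)` of Koszul homology (`chiOne_eq_defect`).

The identity `e(𝔪, U) = r · e(R)` holds because a nonzerodivisor `f` lowers the growth of the
Hilbert–Samuel function of `R/f`, by the Artin–Rees lemma (`tendsto_hsFunction_quotSMulTop`).
-/

namespace LimUlrich

open IsLocalRing Function
open scoped Pointwise

universe u v w

/-! ### Lengths -/

section Length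

variable {R : Type*} [CommRing R]

theorem len_congr {M : Type*} {N : Type*} [AddCommGroup M] [Module R M] [AddCommGroup N]
    [Module R N] (e : M ≃ₗ[R] N) : len R M = len R N := by
  rw [len, len, e.length_eq]

theorem len_eq_add_of_exact {A B C : Type*} [AddCommGroup A] [Module R A] [AddCommGroup B]
    [Module R B] [AddCommGroup C] [Module R C] (f : A →ₗ[R] B) (g : B →ₗ[R] C)
    (hf : Injective f) (hg : Surjective g) (H : Exact f g) (hB : Module.length R B ≠ ⊤) :
    len R B = len R A + len R C := by
  have h := Module.length_eq_add_of_exact f g hf hg H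
  rw [len, len, len, h, ENat.toNat_add]
  · rintro h'; exact hB (by rw [h, h', top_add])
  · rintro h'; exact hB (by rw [h, h', add_top])

theorem len_le_of_surjective {B C : Type*} [AddCommGroup B]
    [Module R B] [AddCommGroup C] [Module R C] (g : B →ₗ[R] C)
    (hg : Surjective g) (hB : Module.length R B ≠ ⊤) : len R C ≤ len R B :=
  ENat.toNat_le_toNat (Module.length_le_of_surjective g hg) hB

theorem len_le_of_injective {A B : Type*} [AddCommGroup A]
    [Module R A] [AddCommGroup B] [Module R B] (f : A →ₗ[R] B)
    (hf : Injective f) (hB : Module.length R B ≠ ⊤) : len R A ≤ len R B :=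
  ENat.toNat_le_toNat (Module.length_le_of_injective f hf) hB

theorem length_ne_top_of_maximalIdeal_le_radical [IsLocalRing R] [IsNoetherianRing R]
    (M : Type*) [AddCommGroup M] [Module R M] [Module.Finite R M]
    (h : maximalIdeal R ≤ (Module.annihilator R M).radical) : Module.length R M ≠ ⊤ := by
  obtain ⟨k, hk⟩ := Ideal.exists_pow_le_of_le_radical_of_fg h
    (maximalIdeal R).fg_of_isNoetherianRing
  have hk' : maximalIdeal R ^ (k + 1) ≤ Module.annihilator R M :=
    (Ideal.pow_le_pow_right (Nat.le_succ k)).trans hk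
  set I := maximalIdeal R ^ (k + 1) with hI
  have hIm : I ≤ maximalIdeal R := Ideal.pow_le_self (Nat.succ_ne_zero k)
  have : Nontrivial (R ⧸ I) := Ideal.Quotient.nontrivial_iff.mpr
    (fun h => (maximalIdeal.isMaximal R).ne_top (top_le_iff.mp (h ▸ hIm)))
  have : IsLocalRing (R ⧸ I) := .of_surjective' (Ideal.Quotient.mk I) Ideal.Quotient.mk_surjective
  have : IsArtinianRing (R ⧸ I) := by
    rw [isArtinianRing_iff_isNilpotent_maximalIdeal]
    refine ⟨k + 1, ?_⟩
    have : maximalIdeal (R ⧸ I) = (maximalIdeal R).map (Ideal.Quotient.mk I) := by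
      apply (eq_maximalIdeal _).symm
      apply Ideal.map_eq_top_or_isMaximal_of_surjective _ Ideal.Quotient.mk_surjective
        inferInstance |>.resolve_left
      intro h
      have h1 := congrArg (Ideal.comap (Ideal.Quotient.mk I)) h
      rw [Ideal.comap_map_of_surjective _ Ideal.Quotient.mk_surjective, Ideal.comap_top,
        ← RingHom.ker_eq_comap_bot, Ideal.mk_ker, sup_eq_left.mpr hIm] at h1
      exact (maximalIdeal.isMaximal R).ne_top h1
    rw [this, ← Ideal.map_pow, ← hI, Ideal.map_quotient_self]; rfl
  let _ : Module (R ⧸ I) M := Module.IsTorsionBySet.module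
    (fun x a => Module.mem_annihilator.mp (hk' a.2) x)
  have : IsScalarTower R (R ⧸ I) M := Module.IsTorsionBySet.isScalarTower _
  have : Module.Finite (R ⧸ I) M := Module.Finite.of_restrictScalars_finite R _ _
  rw [Module.length_eq_of_surjective (S := R) (R := R ⧸ I) (M := M)
    (Ideal.Quotient.mk_surjective)]
  exact Module.length_ne_top

end Length

/-! ### The multiplicity symbol -/

section Symbol

variable {R : Type*} [CommRing R]

/-- The multiplicity symbol `e(l; M)` of Northcott and Wright, defined by recursion on the list `l`:
`e(∅; M)` is the length of `M`, and `e(x, l; M) = e(l; M/xM) - e(l; 0 :_M x)`. It is meaningful when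
`M` is finitely generated and `M/(l)M` has finite length. -/
noncomputable def symb : List R → (M : Type u) → [AddCommGroup M] → [Module R M] → ℤ
  | [], M, _, _ => len R M
  | x :: l, M, _, _ => symb l (QuotSMulTop x M) - symb l (Submodule.torsionBy R M x)

/-- `M/(l)M` has finite length, in the form (for finitely generated `M`) that is inherited by
submodules and quotients of `M`. -/
def IsParam [IsLocalRing R] (l : List R) (M : Type*) [AddCommGroup M] [Module R M] : Prop :=
  maximalIdeal R ≤ (Ideal.ofList l ⊔ Module.annihilator R M).radical

theorem symb_nil (M : Type u) [AddCommGroup M] [Module R M] :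
    symb ([] : List R) M = len R M := rfl

theorem symb_cons (x : R) (l : List R) (M : Type u) [AddCommGroup M] [Module R M] :
    symb (x :: l) M = symb l (QuotSMulTop x M) - symb l (Submodule.torsionBy R M x) := rfl

/-- The equivalence induced by a linear equivalence on the submodules killed by `x`. -/
def torsionByCongr {M : Type*} {N : Type*} [AddCommGroup M] [Module R M] [AddCommGroup N]
    [Module R N] (e : M ≃ₗ[R] N) (x : R) :
    Submodule.torsionBy R M x ≃ₗ[R] Submodule.torsionBy R N x :=
  e.ofSubmodules _ _ (by
    ext n
    rw [Submodule.mem_map_equiv, Submodule.mem_torsionBy_iff, Submodule.mem_torsionBy_iff,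
      ← map_smul, LinearEquiv.map_eq_zero_iff])

/-- The two modules may live in different universes, which is what allows the symbol to be compared
along equivalences with quotients and tensor products. -/
theorem symb_congr (l : List R) : ∀ {M : Type u} {N : Type v} [AddCommGroup M] [Module R M]
    [AddCommGroup N] [Module R N] (_ : M ≃ₗ[R] N), symb l M = symb l N := by
  induction l with
  | nil => intro M N _ _ _ _ e; rw [symb_nil, symb_nil, len_congr e]
  | cons x l ih =>
    intro M N _ _ _ _ e
    rw [symb_cons, symb_cons, ih (QuotSMulTop.congr x e), ih (torsionByCongr e x)]

theorem mem_annihilator_torsionBy (x : R) (M : Type*) [AddCommGroup M] [Module R M] :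
    x ∈ Module.annihilator R (Submodule.torsionBy R M x) :=
  Module.mem_annihilator.mpr fun m => Subtype.ext ((Submodule.mem_torsionBy_iff _ _).mp m.2)

variable [IsLocalRing R]

theorem IsParam.of_annihilator_le {l : List R} {M : Type*} {N : Type*} [AddCommGroup M]
    [Module R M] [AddCommGroup N] [Module R N] (h : IsParam l M)
    (hMN : Module.annihilator R M ≤ Module.annihilator R N) : IsParam l N :=
  le_trans h (Ideal.radical_mono (sup_le_sup_left hMN _))

theorem IsParam.of_injective {l : List R} {M : Type*} {N : Type*} [AddCommGroup M]
    [Module R M] [AddCommGroup N] [Module R N] (h : IsParam l M) (f : N →ₗ[R] M)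
    (hf : Injective f) : IsParam l N :=
  h.of_annihilator_le (f.annihilator_le_of_injective hf)

theorem IsParam.of_surjective {l : List R} {M : Type*} {N : Type*} [AddCommGroup M]
    [Module R M] [AddCommGroup N] [Module R N] (h : IsParam l M) (f : M →ₗ[R] N)
    (hf : Surjective f) : IsParam l N :=
  h.of_annihilator_le (f.annihilator_le_of_surjective hf)

theorem IsParam.submodule {l : List R} {M : Type*} [AddCommGroup M]
    [Module R M] (h : IsParam l M) (N : Submodule R M) : IsParam l N :=
  h.of_injective N.subtype N.subtype_injective

theorem IsParam.quotient {l : List R} {M : Type*} [AddCommGroup M]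
    [Module R M] (h : IsParam l M) (N : Submodule R M) : IsParam l (M ⧸ N) :=
  h.of_surjective N.mkQ N.mkQ_surjective

theorem IsParam.of_le {l l' : List R} {M : Type*} [AddCommGroup M]
    [Module R M] (h : IsParam l M) (hl : Ideal.ofList l ≤ Ideal.ofList l') : IsParam l' M :=
  le_trans h (Ideal.radical_mono (sup_le_sup_right hl _))

theorem IsParam.tail {x : R} {l : List R} {M : Type*} {N : Type*} [AddCommGroup M]
    [Module R M] [AddCommGroup N] [Module R N] (h : IsParam (x :: l) M)
    (hMN : Module.annihilator R M ≤ Module.annihilator R N) (hx : x ∈ Module.annihilator R N) :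
    IsParam l N := by
  refine le_trans h (Ideal.radical_mono ?_)
  rw [Ideal.ofList_cons]
  refine sup_le (sup_le ?_ le_sup_left) (hMN.trans le_sup_right)
  rw [Ideal.span_singleton_le_iff_mem]
  exact Ideal.mem_sup_right hx

theorem IsParam.quotSMulTop {x : R} {l : List R} {M : Type*} [AddCommGroup M]
    [Module R M] (h : IsParam (x :: l) M) : IsParam l (QuotSMulTop x M) :=
  h.tail ((Submodule.mkQ _).annihilator_le_of_surjective (Submodule.mkQ_surjective _))
    (QuotSMulTop.mem_annihilator M x)

theorem IsParam.torsionBy {x : R} {l : List R} {M : Type*} [AddCommGroup M]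
    [Module R M] (h : IsParam (x :: l) M) : IsParam l (Submodule.torsionBy R M x) :=
  h.tail ((Submodule.subtype _).annihilator_le_of_injective (Submodule.subtype_injective _))
    (mem_annihilator_torsionBy x M)

variable [IsNoetherianRing R]

theorem IsParam.length_ne_top {M : Type*} [AddCommGroup M] [Module R M] [Module.Finite R M]
    (h : IsParam ([] : List R) M) : Module.length R M ≠ ⊤ := by
  refine length_ne_top_of_maximalIdeal_le_radical M ?_
  simpa [IsParam] using h

/-- Additivity on short exact sequences in one universe, by applying the induction hypothesis along
the six term exact sequence of the snake lemma for multiplication by `x`. -/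
theorem symb_eq_add_of_exact_aux (l : List R) : ∀ {A B C : Type u} [AddCommGroup A] [Module R A]
    [AddCommGroup B] [Module R B] [AddCommGroup C] [Module R C] [Module.Finite R B]
    (f : A →ₗ[R] B) (g : B →ₗ[R] C) (_ : Injective f) (_ : Surjective g) (_ : Exact f g)
    (_ : IsParam l B), symb l B = symb l A + symb l C := by
  induction l with
  | nil =>
    intro A B C _ _ _ _ _ _ _ f g hf hg H hB
    rw [symb_nil, symb_nil, symb_nil, len_eq_add_of_exact f g hf hg H hB.length_ne_top]
    push_cast; rfl
  | cons x l ih =>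
    intro A B C _ _ _ _ _ _ _ f g hf hg H hB
    have key : ∀ {X Y : Type u} [AddCommGroup X] [Module R X] [AddCommGroup Y] [Module R Y]
        [Module.Finite R X] (h : X →ₗ[R] Y), IsParam l X →
        symb l X = symb l (LinearMap.ker h) + symb l (LinearMap.range h) := by
      intro X Y _ _ _ _ _ h hX
      refine ih (LinearMap.ker h).subtype h.rangeRestrict (Submodule.subtype_injective _)
        h.surjective_rangeRestrict ?_ hX
      rw [LinearMap.exact_iff, LinearMap.ker_rangeRestrict, Submodule.range_subtype]
    have hA := hB.of_injective f hf
    have hC := hB.of_surjective g hg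
    have : Module.Finite R A := Module.Finite.of_injective f hf
    have : Module.Finite R C := Module.Finite.of_surjective g hg
    let iA := DistribSMul.toLinearMap R A x
    let iB := DistribSMul.toLinearMap R B x
    let iC := DistribSMul.toLinearMap R C x
    have tor : ∀ {X : Type u} [AddCommGroup X] [Module R X],
        Exact (Submodule.torsionBy R X x).subtype (DistribSMul.toLinearMap R X x) := by
      intro X _ _
      rw [LinearMap.exact_iff, Submodule.range_subtype]; rfl
    have quo : ∀ {X : Type u} [AddCommGroup X] [Module R X],
        Exact (DistribSMul.toLinearMap R X x) (Submodule.mkQ (x • (⊤ : Submodule R X))) := by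
      intro X _ _
      rw [LinearMap.exact_iff, Submodule.ker_mkQ]
      exact (LinearMap.range_eq_map _).symm
    have hs : f.comp iA = iB.comp f := by ext; simp [iA, iB]
    have hs' : g.comp iB = iC.comp g := by ext; simp [iC, iB]
    let f1 : Submodule.torsionBy R A x →ₗ[R] Submodule.torsionBy R B x :=
      f.restrict (fun a ha => by
        rw [Submodule.mem_torsionBy_iff] at ha ⊢; rw [← map_smul, ha, map_zero])
    let f2 : Submodule.torsionBy R B x →ₗ[R] Submodule.torsionBy R C x :=
      g.restrict (fun a ha => by
        rw [Submodule.mem_torsionBy_iff] at ha ⊢; rw [← map_smul, ha, map_zero])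
    let δ := SnakeLemma.δ' iA iB iC f g H f g H hs hs' (Submodule.torsionBy R C x).subtype tor
      (Submodule.mkQ (x • (⊤ : Submodule R A))) quo hg hf
    let f4 : QuotSMulTop x A →ₗ[R] QuotSMulTop x B := QuotSMulTop.map x f
    let f5 : QuotSMulTop x B →ₗ[R] QuotSMulTop x C := QuotSMulTop.map x g
    have h1 : Injective f1 := fun a b h => Subtype.ext (hf (congrArg Subtype.val h))
    have e2 : LinearMap.ker f2 = LinearMap.range f1 := by
      ext b
      constructor
      · intro hb
        have hb' : g b.1 = 0 := congrArg Subtype.val (LinearMap.mem_ker.mp hb)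
        obtain ⟨a, ha⟩ := (H _).mp hb'
        refine ⟨⟨a, ?_⟩, Subtype.ext ha⟩
        rw [Submodule.mem_torsionBy_iff]
        apply hf
        rw [map_smul, ha, map_zero]
        exact (Submodule.mem_torsionBy_iff _ _).mp b.2
      · rintro ⟨a, rfl⟩
        exact LinearMap.mem_ker.mpr (Subtype.ext (H.apply_apply_eq_zero a.1))
    have e3 : LinearMap.ker δ = LinearMap.range f2 := LinearMap.exact_iff.mp <|
      SnakeLemma.exact_δ'_right iA iB iC f g H f g H hs hs' (Submodule.torsionBy R B x).subtype tor
        (Submodule.torsionBy R C x).subtype tor _ quo hg hf f2 rfl (Submodule.subtype_injective _)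
    have e4 : LinearMap.ker f4 = LinearMap.range δ := LinearMap.exact_iff.mp <|
      SnakeLemma.exact_δ'_left iA iB iC f g H f g H hs hs'
        (Submodule.torsionBy R C x).subtype tor _ quo _ quo hg hf f4
        (QuotSMulTop.map_comp_mkQ x f) (Submodule.mkQ_surjective _)
    have e5 : LinearMap.ker f5 = LinearMap.range f4 :=
      LinearMap.exact_iff.mp (QuotSMulTop.map_exact x H hg)
    have e6 : LinearMap.range f5 = ⊤ := LinearMap.range_eq_top.mpr (QuotSMulTop.map_surjective x hg)
    have k2 := key f2 hB.torsionBy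
    have k3 := key δ hC.torsionBy
    have k4 := key f4 hA.quotSMulTop
    have k5 := key f5 hB.quotSMulTop
    rw [e2, ← symb_congr l (LinearEquiv.ofInjective f1 h1)] at k2
    rw [e3] at k3
    rw [e4] at k4
    rw [e5, e6, symb_congr l Submodule.topEquiv] at k5
    rw [symb_cons, symb_cons, symb_cons]
    linarith

theorem symb_eq_add_quotient (l : List R) {B : Type u} [AddCommGroup B] [Module R B]
    [Module.Finite R B] (hB : IsParam l B) (N : Submodule R B) :
    symb l B = symb l N + symb l (B ⧸ N) :=
  symb_eq_add_of_exact_aux l N.subtype N.mkQ N.subtype_injective N.mkQ_surjective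
    (LinearMap.exact_subtype_mkQ N) hB

/-- The multiplicity symbol is additive on short exact sequences. -/
theorem symb_eq_add_of_exact (l : List R) {A : Type u} {B : Type v} {C : Type w} [AddCommGroup A]
    [Module R A] [AddCommGroup B] [Module R B] [AddCommGroup C] [Module R C] [Module.Finite R B]
    (f : A →ₗ[R] B) (g : B →ₗ[R] C) (hf : Injective f) (hg : Surjective g) (H : Exact f g)
    (hB : IsParam l B) : symb l B = symb l A + symb l C := by
  rw [symb_eq_add_quotient l hB (LinearMap.range f), ← symb_congr l (LinearEquiv.ofInjective f hf),
    symb_congr l ((Submodule.quotEquivOfEq _ _ (LinearMap.exact_iff.mp H).symm).trans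
      (g.quotKerEquivOfSurjective hg))]

theorem symb_eq_ker_add_range (l : List R) {X : Type u} {Y : Type v} [AddCommGroup X]
    [Module R X] [AddCommGroup Y] [Module R Y] [Module.Finite R X] (h : X →ₗ[R] Y)
    (hX : IsParam l X) : symb l X = symb l (LinearMap.ker h) + symb l (LinearMap.range h) := by
  rw [symb_eq_add_quotient l hX (LinearMap.ker h), symb_congr l h.quotKerEquivRange]

end Symbol

section Symbol

variable {R : Type*} [CommRing R]

theorem symb_of_subsingleton (l : List R) : ∀ (M : Type u) [AddCommGroup M] [Module R M]
    [Subsingleton M], symb l M = 0 := by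
  induction l with
  | nil => intro M _ _ _; rw [symb_nil, len, Module.length_eq_zero]; rfl
  | cons x l ih =>
    intro M _ _ _
    have : Subsingleton (QuotSMulTop x M) := (Submodule.mkQ_surjective _).subsingleton
    rw [symb_cons, ih, ih, sub_zero]

variable [IsLocalRing R]

theorem IsParam.perm {l l' : List R} {M : Type*} [AddCommGroup M] [Module R M]
    (h : IsParam l M) (hl : l.Perm l') : IsParam l' M :=
  h.of_le (Ideal.span_mono fun _ hx => hl.subset hx)

theorem isParam_of_le_radical {l : List R} (h : maximalIdeal R ≤ (Ideal.ofList l).radical)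
    (M : Type*) [AddCommGroup M] [Module R M] : IsParam l M :=
  h.trans (Ideal.radical_mono le_sup_left)

variable [IsNoetherianRing R]

/-- If a power of `x` kills `M`, then `l` alone is a system of parameters of `M`, and the symbols of
kernel and cokernel of multiplication by `x` cancel. -/
theorem symb_cons_eq_zero {x : R} {l : List R} {M : Type u} [AddCommGroup M] [Module R M]
    [Module.Finite R M] (h : IsParam (x :: l) M) (hx : x ∈ (Module.annihilator R M).radical) :
    symb (x :: l) M = 0 := by
  have h' : IsParam l M := by
    refine le_trans h ?_
    rw [Ideal.radical_le_radical_iff, Ideal.ofList_cons]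
    refine sup_le (sup_le ?_ (le_sup_left.trans Ideal.le_radical))
      (le_sup_right.trans Ideal.le_radical)
    rw [Ideal.span_singleton_le_iff_mem]
    exact Ideal.radical_mono le_sup_right hx
  have h1 := symb_eq_ker_add_range l (DistribSMul.toLinearMap R M x) h'
  have h2 := symb_eq_add_quotient l h' (x • (⊤ : Submodule R M))
  have h3 : LinearMap.range (DistribSMul.toLinearMap R M x) = x • (⊤ : Submodule R M) :=
    LinearMap.range_eq_map _
  rw [h3] at h1
  have h4 : symb l (LinearMap.ker (DistribSMul.toLinearMap R M x)) =
    symb l (Submodule.torsionBy R M x) := rfl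
  rw [symb_cons]
  linarith

/-- Killing the `x`-power torsion of `M` does not change the symbol, and makes `x` a nonzerodivisor;
hence nonnegativity by induction. -/
theorem symb_nonneg (l : List R) : ∀ {M : Type u} [AddCommGroup M] [Module R M]
    [Module.Finite R M] (_ : IsParam l M), 0 ≤ symb l M := by
  induction l with
  | nil => intro M _ _ _ _; rw [symb_nil]; positivity
  | cons x l ih =>
    intro M _ _ _ h
    -- Fitting: for large `k` the kernel of `xᵏ` meets its range trivially.
    obtain ⟨k, hk, hk1⟩ := ((Module.End.eventually_disjoint_ker_pow_range_pow
      (f := (DistribSMul.toLinearMap R M x : Module.End R M))).and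
      (Filter.eventually_ge_atTop 1)).exists
    set f : Module.End R M := DistribSMul.toLinearMap R M x with hf
    have hfp : ∀ j m, (f ^ j) m = x ^ j • m := by
      intro j
      induction j with
      | zero => intro m; simp
      | succ j ihj =>
        intro m
        rw [pow_succ', Module.End.mul_apply, ihj, hf, pow_succ', mul_smul]
        rfl
    rw [symb_eq_ker_add_range _ (f ^ k) h, symb_cons_eq_zero (h.submodule _), zero_add, symb_cons]
    · have : Subsingleton (Submodule.torsionBy R (LinearMap.range (f ^ k)) x) := by
        refine ⟨fun a b => ?_⟩
        have key : ∀ a : Submodule.torsionBy R (LinearMap.range (f ^ k)) x, a = 0 := by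
          intro a
          apply Subtype.ext
          apply Subtype.ext
          have ha : x • (a.1.1) = 0 :=
            congrArg Subtype.val ((Submodule.mem_torsionBy_iff _ _).mp a.2)
          refine Submodule.disjoint_def.mp hk _ ?_ a.1.2
          rw [LinearMap.mem_ker, hfp]
          have hpow : x ^ k = x ^ (k - 1) * x := by rw [← pow_succ, Nat.sub_add_cancel hk1]
          rw [hpow, mul_smul, ha, smul_zero]
        rw [key a, key b]
      rw [symb_of_subsingleton l (Submodule.torsionBy R (LinearMap.range (f ^ k)) x), sub_zero]
      exact ih (h.submodule _).quotSMulTop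
    · refine ⟨k, Module.mem_annihilator.mpr fun m => Subtype.ext ?_⟩
      have := m.2
      rwa [LinearMap.mem_ker, hfp] at this

/-- If `H` is an extension of the `a`-torsion of `H₀` by `H₁/aH₁`, then the symbols add up. -/
theorem symb_eq_of_extension (l : List R) (a : R) {H₁ : Type u} {H : Type v} {H₀ : Type w}
    [AddCommGroup H₁] [Module R H₁] [AddCommGroup H] [Module R H] [AddCommGroup H₀] [Module R H₀]
    [Module.Finite R H] (hH : IsParam l H) (i : H₁ →ₗ[R] H) (p : H →ₗ[R] H₀)
    (hip : LinearMap.ker p = LinearMap.range i) (hi : LinearMap.ker i = a • ⊤)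
    (hp : LinearMap.range p = Submodule.torsionBy R H₀ a) :
    symb l H = symb l (QuotSMulTop a H₁) + symb l (Submodule.torsionBy R H₀ a) := by
  rw [symb_eq_ker_add_range l p hH, hp, hip, ← symb_congr l i.quotKerEquivRange,
    symb_congr l (Submodule.quotEquivOfEq _ _ hi)]

section Swap

variable (a b : R) (M : Type u) [AddCommGroup M] [Module R M]

/-- The first Koszul homology of the pair `a, b`, on which `symb_swap` rests because it is symmetric
in `a` and `b`: pairs with `a m + b n = 0` modulo the trivial ones `(b t, -a t)`. -/
abbrev PairSyzygies : Submodule R (M × M) :=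
  LinearMap.ker ((DistribSMul.toLinearMap R M a).coprod (DistribSMul.toLinearMap R M b))

/-- The trivial syzygies `(b t, -a t)` of a pair. -/
abbrev pairTrivial : Submodule R (PairSyzygies a b M) :=
  (LinearMap.range ((DistribSMul.toLinearMap R M b).prod (-DistribSMul.toLinearMap R M a))).comap
    (PairSyzygies a b M).subtype

omit [IsLocalRing R] [IsNoetherianRing R] in
variable {a b M} in
theorem mem_pairSyzygies {z : M × M} : z ∈ PairSyzygies a b M ↔ a • z.1 + b • z.2 = 0 := Iff.rfl

omit [IsLocalRing R] [IsNoetherianRing R] in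
variable {a b M} in
theorem mem_pairTrivial {z : PairSyzygies a b M} :
    z ∈ pairTrivial a b M ↔ ∃ t : M, b • t = z.1.1 ∧ -(a • t) = z.1.2 := by
  constructor
  · rintro ⟨t, ht⟩
    exact ⟨t, congrArg Prod.fst ht, congrArg Prod.snd ht⟩
  · rintro ⟨t, h1, h2⟩
    exact ⟨t, Prod.ext h1 h2⟩

omit [IsLocalRing R] [IsNoetherianRing R] in
theorem mem_annihilator_pair :
    a ∈ Module.annihilator R (PairSyzygies a b M ⧸ pairTrivial a b M) ∧
    b ∈ Module.annihilator R (PairSyzygies a b M ⧸ pairTrivial a b M) := by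
  simp only [Module.mem_annihilator]
  constructor
  · intro q
    obtain ⟨z, rfl⟩ := Submodule.mkQ_surjective _ q
    rw [← map_smul, Submodule.mkQ_apply, Submodule.Quotient.mk_eq_zero, mem_pairTrivial]
    have hz := mem_pairSyzygies.mp z.2
    refine ⟨-z.1.2, ?_, ?_⟩
    · rw [smul_neg, ← eq_neg_of_add_eq_zero_left hz]; rfl
    · rw [smul_neg, neg_neg]; rfl
  · intro q
    obtain ⟨z, rfl⟩ := Submodule.mkQ_surjective _ q
    rw [← map_smul, Submodule.mkQ_apply, Submodule.Quotient.mk_eq_zero, mem_pairTrivial]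
    have hz := mem_pairSyzygies.mp z.2
    refine ⟨z.1.1, rfl, ?_⟩
    rw [neg_eq_of_add_eq_zero_right hz]; rfl

variable {a b M} in
/-- The homology of the pair `a, b` is an extension of `0 :_{M/aM} b` by `(0 :_M a)/b(0 :_M a)`. -/
theorem symb_pair (l : List R) [Module.Finite R M] (h : IsParam (a :: b :: l) M) :
    symb l (PairSyzygies a b M ⧸ pairTrivial a b M) =
      symb l (QuotSMulTop b (Submodule.torsionBy R M a)) +
        symb l (Submodule.torsionBy R (QuotSMulTop a M) b) := by
  have hann := mem_annihilator_pair a b M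
  have hle : Module.annihilator R M ≤
      Module.annihilator R (PairSyzygies a b M ⧸ pairTrivial a b M) := by
    intro r hr
    rw [Module.mem_annihilator] at hr ⊢
    intro q
    obtain ⟨z, rfl⟩ := Submodule.mkQ_surjective _ q
    have : r • z = 0 := Subtype.ext (Prod.ext (hr _) (hr _))
    rw [← map_smul, this, map_zero]
  have hP : IsParam l (PairSyzygies a b M ⧸ pairTrivial a b M) := by
    refine le_trans h (Ideal.radical_mono ?_)
    rw [Ideal.ofList_cons, Ideal.ofList_cons]
    refine sup_le (sup_le ?_ (sup_le ?_ le_sup_left)) (hle.trans le_sup_right)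
    · rw [Ideal.span_singleton_le_iff_mem]
      exact Ideal.mem_sup_right hann.1
    · rw [Ideal.span_singleton_le_iff_mem]
      exact Ideal.mem_sup_right hann.2
  let i : Submodule.torsionBy R M a →ₗ[R] PairSyzygies a b M ⧸ pairTrivial a b M :=
    (pairTrivial a b M).mkQ.comp (LinearMap.codRestrict (PairSyzygies a b M)
      ((LinearMap.inl R M M).comp (Submodule.subtype _)) (fun m => by
        rw [mem_pairSyzygies]
        have := (Submodule.mem_torsionBy_iff _ _).mp m.2
        simp [this]))
  let p : (PairSyzygies a b M ⧸ pairTrivial a b M) →ₗ[R] QuotSMulTop a M :=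
    (pairTrivial a b M).liftQ (((Submodule.mkQ (a • (⊤ : Submodule R M))).comp
      (LinearMap.snd R M M)).comp (Submodule.subtype _)) (by
        intro z hz
        obtain ⟨t, h1, h2⟩ := mem_pairTrivial.mp hz
        rw [LinearMap.mem_ker]
        simp only [LinearMap.comp_apply, Submodule.subtype_apply, LinearMap.snd_apply,
          Submodule.mkQ_apply, Submodule.Quotient.mk_eq_zero]
        rw [← h2, ← smul_neg]
        exact Submodule.smul_mem_pointwise_smul _ _ _ trivial)
  have hi : ∀ m, i m = 0 ↔ ∃ t : M, b • t = m.1 ∧ a • t = 0 := by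
    intro m
    simp only [i, LinearMap.comp_apply, Submodule.mkQ_apply, Submodule.Quotient.mk_eq_zero]
    rw [mem_pairTrivial]
    simp
  have hp : ∀ z : PairSyzygies a b M, p (Submodule.Quotient.mk z) = Submodule.Quotient.mk z.1.2 :=
    fun z => rfl
  refine symb_eq_of_extension l b hP i p ?_ ?_ ?_
  · ext q
    obtain ⟨z, rfl⟩ := Submodule.Quotient.mk_surjective _ q
    rw [LinearMap.mem_ker, hp, Submodule.Quotient.mk_eq_zero]
    have hz := mem_pairSyzygies.mp z.2
    constructor
    · intro h
      obtain ⟨t, -, ht⟩ := (Submodule.mem_smul_pointwise_iff_exists _ _ _).mp h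
      refine ⟨⟨z.1.1 + b • t, ?_⟩, ?_⟩
      · rw [Submodule.mem_torsionBy_iff, smul_add, smul_comm a b t, ht, hz]
      · refine (Submodule.Quotient.eq _).mpr (mem_pairTrivial.mpr ⟨t, ?_, ?_⟩)
        · simp
        · simp [ht]
    · rintro ⟨m, hm⟩
      obtain ⟨t, h1, h2⟩ := mem_pairTrivial.mp ((Submodule.Quotient.eq _).mp hm)
      refine (Submodule.mem_smul_pointwise_iff_exists _ _ _).mpr ⟨t, trivial, ?_⟩
      simpa using h2
  · ext m
    rw [LinearMap.mem_ker, hi, Submodule.mem_smul_pointwise_iff_exists]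
    constructor
    · rintro ⟨t, h1, h2⟩
      exact ⟨⟨t, (Submodule.mem_torsionBy_iff _ _).mpr h2⟩, trivial, Subtype.ext h1⟩
    · rintro ⟨t, -, rfl⟩
      exact ⟨t.1, rfl, (Submodule.mem_torsionBy_iff _ _).mp t.2⟩
  · ext q
    obtain ⟨n, rfl⟩ := Submodule.Quotient.mk_surjective _ q
    rw [Submodule.mem_torsionBy_iff, ← Submodule.Quotient.mk_smul, Submodule.Quotient.mk_eq_zero,
      Submodule.mem_smul_pointwise_iff_exists]
    constructor
    · rintro ⟨q, hq⟩
      obtain ⟨z, rfl⟩ := Submodule.Quotient.mk_surjective _ q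
      have hz := mem_pairSyzygies.mp z.2
      rw [hp, Submodule.Quotient.eq] at hq
      obtain ⟨t, -, ht⟩ := (Submodule.mem_smul_pointwise_iff_exists _ _ _).mp hq
      refine ⟨-(z.1.1 + b • t), trivial, ?_⟩
      rw [smul_neg, smul_add, smul_comm a b t, ht, smul_sub]
      rw [add_sub, hz]
      simp
    · rintro ⟨t, -, ht⟩
      exact ⟨Submodule.Quotient.mk ⟨(-t, n), by rw [mem_pairSyzygies]; simp [ht]⟩, rfl⟩

/-- The homology of a pair is symmetric. -/
noncomputable def pairSwap : (PairSyzygies a b M ⧸ pairTrivial a b M) ≃ₗ[R]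
    (PairSyzygies b a M ⧸ pairTrivial b a M) :=
  Submodule.Quotient.equiv _ _ ((LinearEquiv.prodComm R M M).ofSubmodules _ _ (by
    ext z
    rw [Submodule.mem_map_equiv, mem_pairSyzygies, mem_pairSyzygies, add_comm]; rfl)) (by
    ext z
    rw [Submodule.mem_map_equiv, mem_pairTrivial, mem_pairTrivial]
    constructor
    · rintro ⟨t, h1, h2⟩
      refine ⟨-t, ?_, ?_⟩
      · rw [smul_neg, h2]; rfl
      · rw [smul_neg, neg_neg, h1]; rfl
    · rintro ⟨t, h1, h2⟩
      refine ⟨-t, ?_, ?_⟩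
      · rw [smul_neg, h2]; rfl
      · rw [smul_neg, neg_neg, h1]; rfl)

/-- `(M/aM)/b(M/aM) ≃ M/(aM + bM)`. -/
noncomputable def quotSMulTopQuotEquiv : QuotSMulTop b (QuotSMulTop a M) ≃ₗ[R]
    M ⧸ ((a • (⊤ : Submodule R M)) ⊔ b • ⊤) :=
  (Submodule.quotEquivOfEq _ _ (by
    rw [Submodule.map_pointwise_smul, Submodule.map_top, Submodule.range_mkQ])).trans
    (Submodule.quotientQuotientEquivQuotientSup (a • ⊤) (b • ⊤))

/-- `0 :_{0 :_M a} b ≃ 0 :_{0 :_M b} a`. -/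
def torsionByTorsionByComm : Submodule.torsionBy R (Submodule.torsionBy R M a) b ≃ₗ[R]
    Submodule.torsionBy R (Submodule.torsionBy R M b) a where
  toFun m := ⟨⟨m.1.1, congrArg Subtype.val m.2⟩, Subtype.ext m.1.2⟩
  invFun m := ⟨⟨m.1.1, congrArg Subtype.val m.2⟩, Subtype.ext m.1.2⟩
  map_add' _ _ := rfl
  map_smul' _ _ := rfl
  left_inv _ := rfl
  right_inv _ := rfl

variable {a b M} in
/-- Both sides are `e(l; M/(a, b)M) - e(l; H₁(a, b; M)) + e(l; 0 :_M (a, b))`. -/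
theorem symb_swap (l : List R) [Module.Finite R M] (h : IsParam (a :: b :: l) M) :
    symb (a :: b :: l) M = symb (b :: a :: l) M := by
  have h1 := symb_pair l h
  have h2 := symb_pair l (h.perm (List.Perm.swap b a l))
  have h3 := symb_congr l (pairSwap a b M)
  have h4 := symb_congr l ((quotSMulTopQuotEquiv a b M).trans
    ((Submodule.quotEquivOfEq _ _ (sup_comm _ _)).trans (quotSMulTopQuotEquiv b a M).symm))
  have h5 := symb_congr l (torsionByTorsionByComm a b M)
  simp only [symb_cons]
  linarith

end Swap

/-- The symbol does not depend on the order of the elements. -/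
theorem symb_perm {l l' : List R} (hl : l.Perm l') : ∀ {M : Type u} [AddCommGroup M] [Module R M]
    [Module.Finite R M] (_ : IsParam l M), symb l M = symb l' M := by
  induction hl with
  | nil => intros; rfl
  | cons x hl ih =>
    intro M _ _ _ h
    rw [symb_cons, symb_cons, ih h.quotSMulTop, ih h.torsionBy]
  | swap x y l => intro M _ _ _ h; exact symb_swap l h
  | trans h₁ h₂ ih₁ ih₂ => intro M _ _ _ h; rw [ih₁ h, ih₂ (h.perm h₁)]

omit [IsLocalRing R] [IsNoetherianRing R] in
theorem ofList_mul_cons_le_left (a b : R) (l : List R) :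
    Ideal.ofList (a * b :: l) ≤ Ideal.ofList (a :: l) := by
  rw [Ideal.ofList_cons, Ideal.ofList_cons]
  exact sup_le_sup_right (Ideal.span_singleton_le_span_singleton.mpr (dvd_mul_right a b)) _

omit [IsLocalRing R] [IsNoetherianRing R] in
theorem ofList_mul_cons_le_right (a b : R) (l : List R) :
    Ideal.ofList (a * b :: l) ≤ Ideal.ofList (b :: l) := by
  rw [Ideal.ofList_cons, Ideal.ofList_cons]
  exact sup_le_sup_right (Ideal.span_singleton_le_span_singleton.mpr (dvd_mul_left b a)) _

/-- The symbol is additive in each variable: use the exact sequence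
`0 → 0:a → 0:ab → 0:b → M/aM → M/abM → M/bM → 0`. -/
theorem symb_mul_cons (a b : R) (l : List R) {M : Type u} [AddCommGroup M] [Module R M]
    [Module.Finite R M] (h : IsParam (a * b :: l) M) :
    symb (a * b :: l) M = symb (a :: l) M + symb (b :: l) M := by
  have ha := h.of_le (ofList_mul_cons_le_left a b l)
  have hb := h.of_le (ofList_mul_cons_le_right a b l)
  let f1 : Submodule.torsionBy R M a →ₗ[R] Submodule.torsionBy R M (a * b) :=
    Submodule.inclusion (fun m hm => by
      rw [Submodule.mem_torsionBy_iff] at hm ⊢; rw [mul_comm, mul_smul, hm, smul_zero])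
  let f2 : Submodule.torsionBy R M (a * b) →ₗ[R] Submodule.torsionBy R M b :=
    (DistribSMul.toLinearMap R M a).restrict (fun m hm => by
      rw [Submodule.mem_torsionBy_iff] at hm ⊢
      rw [DistribSMul.toLinearMap_apply, smul_smul, mul_comm, hm])
  let f3 : Submodule.torsionBy R M b →ₗ[R] QuotSMulTop a M :=
    (Submodule.mkQ _).comp (Submodule.subtype _)
  let f4 : QuotSMulTop a M →ₗ[R] QuotSMulTop (a * b) M :=
    Submodule.mapQ _ _ (DistribSMul.toLinearMap R M b) (by
      intro m hm
      obtain ⟨t, -, rfl⟩ := (Submodule.mem_smul_pointwise_iff_exists _ _ _).mp hm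
      refine (Submodule.mem_smul_pointwise_iff_exists _ _ _).mpr ⟨t, trivial, ?_⟩
      rw [DistribSMul.toLinearMap_apply, smul_smul, mul_comm])
  let f5 : QuotSMulTop (a * b) M →ₗ[R] QuotSMulTop b M :=
    Submodule.factor (by
      intro m hm
      obtain ⟨t, -, rfl⟩ := (Submodule.mem_smul_pointwise_iff_exists _ _ _).mp hm
      refine (Submodule.mem_smul_pointwise_iff_exists _ _ _).mpr ⟨a • t, trivial, ?_⟩
      rw [smul_smul, mul_comm])
  have h1 : Injective f1 := Submodule.inclusion_injective _
  have e2 : LinearMap.ker f2 = LinearMap.range f1 := by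
    ext m
    constructor
    · intro hm
      exact ⟨⟨m.1, congrArg Subtype.val (LinearMap.mem_ker.mp hm)⟩, rfl⟩
    · rintro ⟨m, rfl⟩
      exact LinearMap.mem_ker.mpr (Subtype.ext m.2)
  have e3 : LinearMap.ker f3 = LinearMap.range f2 := by
    ext m
    rw [LinearMap.mem_ker]
    simp only [f3, LinearMap.comp_apply, Submodule.mkQ_apply, Submodule.Quotient.mk_eq_zero,
      Submodule.subtype_apply]
    rw [Submodule.mem_smul_pointwise_iff_exists]
    constructor
    · rintro ⟨t, -, ht⟩
      refine ⟨⟨t, ?_⟩, Subtype.ext ht⟩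
      rw [Submodule.mem_torsionBy_iff, mul_comm, mul_smul, ht]
      exact (Submodule.mem_torsionBy_iff _ _).mp m.2
    · rintro ⟨t, rfl⟩
      exact ⟨t.1, trivial, rfl⟩
  have e4 : LinearMap.ker f4 = LinearMap.range f3 := by
    ext q
    obtain ⟨m, rfl⟩ := Submodule.Quotient.mk_surjective _ q
    rw [LinearMap.mem_ker]
    have : f4 (Submodule.Quotient.mk m) = Submodule.Quotient.mk (b • m) := rfl
    rw [this, Submodule.Quotient.mk_eq_zero, Submodule.mem_smul_pointwise_iff_exists]
    constructor
    · rintro ⟨t, -, ht⟩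
      refine ⟨⟨m - a • t, ?_⟩, ?_⟩
      · rw [Submodule.mem_torsionBy_iff, smul_sub, smul_smul, mul_comm b a, ht, sub_self]
      · refine (Submodule.Quotient.eq _).mpr ?_
        simpa using Submodule.smul_mem_pointwise_smul t a ⊤ trivial
    · rintro ⟨t, ht⟩
      have ht' := (Submodule.Quotient.eq _).mp ht
      obtain ⟨s, -, hs⟩ := (Submodule.mem_smul_pointwise_iff_exists _ _ _).mp ht'
      refine ⟨-s, trivial, ?_⟩
      have : m = t.1 - a • s := by rw [hs]; simp
      rw [this, smul_sub, (Submodule.mem_torsionBy_iff _ _).mp t.2, smul_smul, mul_comm b a]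
      simp
  have e5 : LinearMap.ker f5 = LinearMap.range f4 := by
    ext q
    obtain ⟨m, rfl⟩ := Submodule.Quotient.mk_surjective _ q
    rw [LinearMap.mem_ker]
    have : f5 (Submodule.Quotient.mk m) = Submodule.Quotient.mk m := rfl
    rw [this, Submodule.Quotient.mk_eq_zero, Submodule.mem_smul_pointwise_iff_exists]
    constructor
    · rintro ⟨t, -, rfl⟩
      exact ⟨Submodule.Quotient.mk t, rfl⟩
    · rintro ⟨q, hq⟩
      obtain ⟨t, rfl⟩ := Submodule.Quotient.mk_surjective _ q
      have hq' := (Submodule.Quotient.eq _).mp hq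
      obtain ⟨s, -, hs⟩ := (Submodule.mem_smul_pointwise_iff_exists _ _ _).mp hq'
      refine ⟨t - a • s, trivial, ?_⟩
      rw [smul_sub, smul_smul, mul_comm b a, hs]
      simp
  have e6 : LinearMap.range f5 = ⊤ := LinearMap.range_eq_top.mpr (Submodule.factor_surjective _)
  have k2 := symb_eq_ker_add_range l f2 h.torsionBy
  have k3 := symb_eq_ker_add_range l f3 hb.torsionBy
  have k4 := symb_eq_ker_add_range l f4 ha.quotSMulTop
  have k5 := symb_eq_ker_add_range l f5 h.quotSMulTop
  rw [e2, ← symb_congr l (LinearEquiv.ofInjective f1 h1)] at k2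
  rw [e3] at k3
  rw [e4] at k4
  rw [e5, e6, symb_congr l Submodule.topEquiv] at k5
  rw [symb_cons, symb_cons, symb_cons]
  linarith

theorem symb_append_mul (a b : R) (l : List R) {M : Type u} [AddCommGroup M] [Module R M]
    [Module.Finite R M] (h : IsParam (l ++ [a * b]) M) :
    symb (l ++ [a * b]) M = symb (l ++ [a]) M + symb (l ++ [b]) M := by
  have p : ∀ c : R, (l ++ [c]).Perm (c :: l) := fun c => List.perm_append_singleton c l
  have h' := h.perm (p _)
  rw [symb_perm (p _) h, symb_mul_cons a b l h',
    ← symb_perm (p a) ((h'.of_le (ofList_mul_cons_le_left a b l)).perm (p a).symm),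
    ← symb_perm (p b) ((h'.of_le (ofList_mul_cons_le_right a b l)).perm (p b).symm)]

omit [IsNoetherianRing R] in
theorem IsParam.append_pow {a : R} {l : List R} {M : Type*} [AddCommGroup M] [Module R M]
    (h : IsParam (l ++ [a]) M) (c : ℕ) : IsParam (l ++ [a ^ c]) M := by
  refine le_trans h ?_
  rw [Ideal.radical_le_radical_iff, Ideal.ofList_append, Ideal.ofList_append]
  refine sup_le (sup_le ((le_sup_left.trans le_sup_left).trans Ideal.le_radical) ?_)
    (le_sup_right.trans Ideal.le_radical)
  rw [Ideal.ofList_singleton, Ideal.ofList_singleton, Ideal.span_singleton_le_iff_mem]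
  exact ⟨c, Ideal.mem_sup_left (Ideal.mem_sup_right (Ideal.mem_span_singleton_self _))⟩

theorem symb_append_pow (a : R) (c : ℕ) (l : List R) {M : Type u} [AddCommGroup M] [Module R M]
    [Module.Finite R M] (h : IsParam (l ++ [a]) M) :
    symb (l ++ [a ^ (c + 1)]) M = (c + 1) * symb (l ++ [a]) M := by
  induction c with
  | zero => simp
  | succ c ih =>
    rw [pow_succ, symb_append_mul _ _ _ (by rw [← pow_succ]; exact h.append_pow _), ih]
    push_cast; ring

end Symbol

/-! ### The defect of a system of parameters -/

section Defect

variable {R : Type*} [CommRing R]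

/-- The defect `length(M/(l)M) - e(l; M)`, which vanishes when `M` is Cohen–Macaulay and in general
is the first higher Euler characteristic. -/
noncomputable def defect (l : List R) (M : Type u) [AddCommGroup M] [Module R M] : ℤ :=
  len R (M ⧸ (Ideal.ofList l • ⊤ : Submodule R M)) - symb l M

theorem defect_nil (M : Type u) [AddCommGroup M] [Module R M] : defect ([] : List R) M = 0 := by
  rw [defect, symb_nil, sub_eq_zero, Nat.cast_inj]
  exact len_congr (Submodule.quotEquivOfEqBot _ (by rw [Ideal.ofList_nil, Submodule.bot_smul]))

theorem defect_cons (x : R) (l : List R) (M : Type u) [AddCommGroup M] [Module R M] :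
    defect (x :: l) M = defect l (QuotSMulTop x M) + symb l (Submodule.torsionBy R M x) := by
  rw [defect, defect, symb_cons,
    len_congr (Submodule.quotOfListConsSMulTopEquivQuotSMulTopInner M x l)]
  ring

theorem defect_singleton (x : R) (M : Type u) [AddCommGroup M] [Module R M] :
    defect [x] M = len R (Submodule.torsionBy R M x) := by
  rw [defect_cons, defect_nil, symb_nil, zero_add]

theorem annihilator_quotSMulTop_ge (x : R) (M : Type u) [AddCommGroup M] [Module R M] :
    Ideal.span {x} ⊔ Module.annihilator R M ≤ Module.annihilator R (QuotSMulTop x M) :=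
  sup_le (by rw [Ideal.span_singleton_le_iff_mem]; exact QuotSMulTop.mem_annihilator M x)
    ((Submodule.mkQ _).annihilator_le_of_surjective (Submodule.mkQ_surjective _))

theorem annihilator_torsionBy_ge (x : R) (M : Type u) [AddCommGroup M] [Module R M] :
    Ideal.span {x} ⊔ Module.annihilator R M ≤
      Module.annihilator R (Submodule.torsionBy R M x) :=
  sup_le (by rw [Ideal.span_singleton_le_iff_mem]; exact mem_annihilator_torsionBy x M)
    ((Submodule.subtype _).annihilator_le_of_injective (Submodule.subtype_injective _))

theorem ofList_cons_sup_le {x : R} {l : List R} {I J : Ideal R} (h : Ideal.span {x} ⊔ I ≤ J) :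
    Ideal.ofList (x :: l) ⊔ I ≤ Ideal.ofList l ⊔ J := by
  rw [Ideal.ofList_cons]
  exact sup_le (sup_le ((le_sup_left.trans h).trans le_sup_right) le_sup_left)
    ((le_sup_right.trans h).trans le_sup_right)

theorem smul_eq_of_sub_mem_annihilator {a b : R} {M : Type u} [AddCommGroup M] [Module R M]
    (h : a - b ∈ Module.annihilator R M) (m : M) : a • m = b • m := by
  have := Module.mem_annihilator.mp h m
  rwa [sub_smul, sub_eq_zero] at this

/-- The last element matters only modulo the others and the annihilator. -/
theorem symb_append_congr {a b : R} (l : List R) : ∀ {M : Type u} [AddCommGroup M] [Module R M]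
    (_ : a - b ∈ Ideal.ofList l ⊔ Module.annihilator R M),
    symb (l ++ [a]) M = symb (l ++ [b]) M := by
  induction l with
  | nil =>
    intro M _ _ h
    rw [Ideal.ofList_nil, bot_sup_eq] at h
    have h' := smul_eq_of_sub_mem_annihilator h
    have e1 : (a • ⊤ : Submodule R M) = b • ⊤ := by
      ext m
      rw [Submodule.mem_smul_pointwise_iff_exists, Submodule.mem_smul_pointwise_iff_exists]
      simp only [h']
    have e2 : Submodule.torsionBy R M a = Submodule.torsionBy R M b := by
      ext m
      rw [Submodule.mem_torsionBy_iff, Submodule.mem_torsionBy_iff, h']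
    rw [List.nil_append, List.nil_append, symb_cons, symb_cons,
      symb_congr _ (Submodule.quotEquivOfEq _ _ e1), e2]
  | cons x l ih =>
    intro M _ _ h
    rw [List.cons_append, List.cons_append, symb_cons, symb_cons,
      ih (ofList_cons_sup_le (annihilator_quotSMulTop_ge x M) h),
      ih (ofList_cons_sup_le (annihilator_torsionBy_ge x M) h)]

theorem defect_append_congr {a b : R} (l : List R) : ∀ {M : Type u} [AddCommGroup M] [Module R M]
    (_ : a - b ∈ Ideal.ofList l ⊔ Module.annihilator R M),
    defect (l ++ [a]) M = defect (l ++ [b]) M := by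
  induction l with
  | nil =>
    intro M _ _ h
    rw [Ideal.ofList_nil, bot_sup_eq] at h
    have h' := smul_eq_of_sub_mem_annihilator h
    have e2 : Submodule.torsionBy R M a = Submodule.torsionBy R M b := by
      ext m
      rw [Submodule.mem_torsionBy_iff, Submodule.mem_torsionBy_iff, h']
    rw [List.nil_append, List.nil_append, defect_singleton, defect_singleton, e2]
  | cons x l ih =>
    intro M _ _ h
    rw [List.cons_append, List.cons_append, defect_cons, defect_cons,
      ih (ofList_cons_sup_le (annihilator_quotSMulTop_ge x M) h),
      symb_append_congr l (ofList_cons_sup_le (annihilator_torsionBy_ge x M) h)]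

variable [IsLocalRing R] [IsNoetherianRing R]

theorem defect_perm {l l' : List R} (hl : l.Perm l') {M : Type u} [AddCommGroup M] [Module R M]
    [Module.Finite R M] (h : IsParam l M) : defect l M = defect l' M := by
  have : Ideal.ofList l = Ideal.ofList l' :=
    le_antisymm (Ideal.span_mono fun _ hx => hl.subset hx)
      (Ideal.span_mono fun _ hx => hl.symm.subset hx)
  rw [defect, defect, symb_perm hl h, this]

/-- In the inductive step the symbol of the torsion module changes by a further symbol, which is
nonnegative. -/
theorem defect_append_le_mul (s b : R) (l : List R) : ∀ {M : Type u} [AddCommGroup M] [Module R M]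
    [Module.Finite R M] (_ : IsParam (l ++ [s * b]) M),
    defect (l ++ [b]) M ≤ defect (l ++ [s * b]) M := by
  induction l with
  | nil =>
    intro M _ _ _ h
    rw [List.nil_append, List.nil_append, defect_singleton, defect_singleton, Nat.cast_le]
    have hle : Submodule.torsionBy R M b ≤ Submodule.torsionBy R M (s * b) := fun m hm => by
      rw [Submodule.mem_torsionBy_iff] at hm ⊢; rw [mul_smul, hm, smul_zero]
    exact len_le_of_injective (Submodule.inclusion hle) (Submodule.inclusion_injective _)
      (IsParam.torsionBy h).length_ne_top
  | cons x l ih =>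
    intro M _ _ _ h
    rw [List.cons_append, List.cons_append, defect_cons, defect_cons]
    have h1 := ih (IsParam.quotSMulTop h)
    have h2 := symb_append_mul s b l (IsParam.torsionBy h)
    have h3 : 0 ≤ symb (l ++ [s]) (Submodule.torsionBy R M x) := by
      have hT : IsParam (l ++ [s * b]) (Submodule.torsionBy R M x) := IsParam.torsionBy h
      refine symb_nonneg _ (hT.of_le ?_)
      rw [Ideal.ofList_append, Ideal.ofList_append, Ideal.ofList_singleton, Ideal.ofList_singleton]
      exact sup_le_sup_left (Ideal.span_singleton_le_span_singleton.mpr (dvd_mul_right s b)) _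
    linarith

theorem defect_append_pow_le (a : R) (c : ℕ) (l : List R) : ∀ {M : Type u} [AddCommGroup M]
    [Module R M] [Module.Finite R M] (_ : IsParam (l ++ [a]) M),
    defect (l ++ [a ^ (c + 1)]) M ≤ (c + 1) * defect (l ++ [a]) M := by
  induction l with
  | nil =>
    intro M _ _ _ h
    rw [List.nil_append, List.nil_append, defect_singleton, defect_singleton]
    induction c with
    | zero => rw [zero_add, pow_one]; simp
    | succ c ih =>
      let f : Submodule.torsionBy R M (a ^ (c + 1 + 1)) →ₗ[R]
          Submodule.torsionBy R M (a ^ (c + 1)) :=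
        (DistribSMul.toLinearMap R M a).restrict (fun m hm => by
          rw [Submodule.mem_torsionBy_iff] at hm ⊢
          rw [DistribSMul.toLinearMap_apply, smul_smul, ← pow_succ, hm])
      have h1 := symb_eq_ker_add_range [] f (IsParam.torsionBy (IsParam.append_pow (l := []) h _))
      simp only [symb_nil] at h1
      let g : LinearMap.ker f →ₗ[R] Submodule.torsionBy R M a :=
        LinearMap.codRestrict _ ((Submodule.subtype _).comp (Submodule.subtype _)) (fun m => by
          rw [Submodule.mem_torsionBy_iff]
          exact congrArg Subtype.val (LinearMap.mem_ker.mp m.2))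
      have h2 : len R (LinearMap.ker f) ≤ len R (Submodule.torsionBy R M a) :=
        len_le_of_injective g
          (fun m n hmn => Subtype.ext (Subtype.ext (by
            have := congrArg Subtype.val hmn; exact this)))
          (IsParam.torsionBy h).length_ne_top
      have h3 : len R (LinearMap.range f) ≤ len R (Submodule.torsionBy R M (a ^ (c + 1))) :=
        len_le_of_injective _ (Submodule.subtype_injective _)
          (IsParam.torsionBy (IsParam.append_pow (l := []) h _)).length_ne_top
      zify at h2 h3
      push_cast
      linarith
  | cons x l ih =>
    intro M _ _ _ h
    rw [List.cons_append, List.cons_append, defect_cons, defect_cons]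
    have h1 := ih (IsParam.quotSMulTop h)
    have h2 := symb_append_pow a c l (IsParam.torsionBy h)
    linarith

/-- Up to a constant that is independent of the module, the defect does not grow when one element
of a system of parameters is exchanged: some power of `a` is a multiple of `b` modulo `l`. -/
theorem exists_defect_append_le {a b : R} {l : List R} (ha : a ∈ maximalIdeal R)
    (hla : maximalIdeal R ≤ (Ideal.ofList (l ++ [a])).radical)
    (hlb : maximalIdeal R ≤ (Ideal.ofList (l ++ [b])).radical) :
    ∃ c : ℕ, ∀ (M : Type u) [AddCommGroup M] [Module R M] [Module.Finite R M],
      defect (l ++ [b]) M ≤ c * defect (l ++ [a]) M := by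
  obtain ⟨c, hc⟩ := hlb ha
  have hc' : a ^ (c + 1) ∈ Ideal.ofList (l ++ [b]) := by
    rw [pow_succ]; exact Ideal.mul_mem_right _ _ hc
  rw [Ideal.ofList_append, Ideal.ofList_singleton] at hc'
  obtain ⟨p, hp, q, hq, hpq⟩ := Submodule.mem_sup.mp hc'
  obtain ⟨s, rfl⟩ := Ideal.mem_span_singleton'.mp hq
  refine ⟨c + 1, fun M _ _ _ => ?_⟩
  have hmem : s * b - a ^ (c + 1) ∈ Ideal.ofList l := by
    rw [← hpq, sub_add_cancel_right]; exact neg_mem hp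
  have hP : IsParam (l ++ [s * b]) M := by
    refine ((isParam_of_le_radical hla M).append_pow (c + 1)).of_le ?_
    rw [Ideal.ofList_append, Ideal.ofList_append, Ideal.ofList_singleton, Ideal.ofList_singleton]
    refine sup_le le_sup_left ?_
    rw [Ideal.span_singleton_le_iff_mem, ← hpq]
    exact add_mem (Ideal.mem_sup_left hp) (Ideal.mem_sup_right (Ideal.mem_span_singleton_self _))
  calc defect (l ++ [b]) M ≤ defect (l ++ [s * b]) M := defect_append_le_mul s b l hP
    _ = defect (l ++ [a ^ (c + 1)]) M := defect_append_congr l (Ideal.mem_sup_left hmem)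
    _ ≤ _ := by
      have := defect_append_pow_le a c l (isParam_of_le_radical hla M)
      push_cast; exact this

end Defect

/-! ### Koszul homology and the symbol -/

section Koszul

variable {R : Type*} [CommRing R] {d : ℕ}

/-- A set of indices, moved away from the new index `0`. -/
def shiftIndex {i : ℕ} (t : {s : Finset (Fin d) // s.card = i}) :
    {s : Finset (Fin (d + 1)) // s.card = i} :=
  ⟨t.1.map (Fin.succEmb d), by rw [Finset.card_map, t.2]⟩

theorem zero_notMem_shiftIndex {i : ℕ} (t : {s : Finset (Fin d) // s.card = i}) :
    (0 : Fin (d + 1)) ∉ (shiftIndex t).1 := by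
  simp [shiftIndex]

/-- A set of indices, moved away from the new index `0` and enlarged by it. -/
def shiftIndexZero {i : ℕ} (t : {s : Finset (Fin d) // s.card = i}) :
    {s : Finset (Fin (d + 1)) // s.card = i + 1} :=
  insertIndex (shiftIndex t) ⟨0, zero_notMem_shiftIndex t⟩

theorem succ_mem_shiftIndex {i : ℕ} {t : {s : Finset (Fin d) // s.card = i}} {j : Fin d} :
    j.succ ∈ (shiftIndex t).1 ↔ j ∈ t.1 := by
  simp [shiftIndex]

theorem succ_mem_shiftIndexZero {i : ℕ} {t : {s : Finset (Fin d) // s.card = i}} {j : Fin d} :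
    j.succ ∈ (shiftIndexZero t).1 ↔ j ∈ t.1 := by
  simp [shiftIndexZero, insertIndex, shiftIndex]

theorem zero_mem_shiftIndexZero {i : ℕ} (t : {s : Finset (Fin d) // s.card = i}) :
    (0 : Fin (d + 1)) ∈ (shiftIndexZero t).1 := by
  simp [shiftIndexZero, insertIndex]

theorem shiftIndex_injective {i : ℕ} : Injective (shiftIndex (d := d) (i := i)) := fun _ _ h =>
  Subtype.ext (Finset.map_injective _ (congrArg Subtype.val h))

theorem exists_shiftIndex {i : ℕ} (s : {s : Finset (Fin (d + 1)) // s.card = i})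
    (h : (0 : Fin (d + 1)) ∉ s.1) : ∃ t, shiftIndex t = s := by
  have hs : (s.1.preimage Fin.succ (Fin.succ_injective d).injOn).map (Fin.succEmb d) = s.1 := by
    ext j
    refine Fin.cases ?_ (fun j => ?_) j
    · simp [h]
    · simp
  exact ⟨⟨s.1.preimage Fin.succ (Fin.succ_injective d).injOn, by
    rw [← Finset.card_map (Fin.succEmb d), hs, s.2]⟩, Subtype.ext hs⟩

/-- A set of `i + 1` indices either avoids or contains the index `0`. -/
noncomputable def indexSumEquiv (d i : ℕ) :
    {s : Finset (Fin d) // s.card = i + 1} ⊕ {s : Finset (Fin d) // s.card = i} ≃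
      {s : Finset (Fin (d + 1)) // s.card = i + 1} :=
  Equiv.ofBijective (Sum.elim shiftIndex shiftIndexZero) (by
    constructor
    · refine Injective.sumElim shiftIndex_injective ?_ ?_
      · intro s t h
        apply Subtype.ext
        ext j
        rw [← succ_mem_shiftIndexZero, h, succ_mem_shiftIndexZero]
      · intro s t h
        exact zero_notMem_shiftIndex s (h ▸ zero_mem_shiftIndexZero t)
    · intro s
      by_cases h : (0 : Fin (d + 1)) ∈ s.1
      · obtain ⟨t, ht⟩ := exists_shiftIndex
          (⟨s.1.erase 0, by rw [Finset.card_erase_of_mem h, s.2]; rfl⟩ :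
            {s : Finset (Fin (d + 1)) // s.card = i}) (Finset.notMem_erase _ _)
        refine ⟨Sum.inr t, Subtype.ext ?_⟩
        change insert 0 (shiftIndex t).1 = s.1
        rw [ht, Finset.insert_erase h]
      · obtain ⟨t, ht⟩ := exists_shiftIndex s h
        exact ⟨Sum.inl t, ht⟩)

variable (M : Type u) [AddCommGroup M] [Module R M]

/-- The part of a Koszul chain without the new index. -/
def lowPart (i : ℕ) : KoszulChain (d + 1) M i →ₗ[R] KoszulChain d M i :=
  LinearMap.funLeft R M shiftIndex

/-- The part of a Koszul chain that involves the new index. -/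
def highPart (i : ℕ) : KoszulChain (d + 1) M (i + 1) →ₗ[R] KoszulChain d M i :=
  LinearMap.funLeft R M shiftIndexZero

theorem exists_chain (i : ℕ) (g : KoszulChain d M (i + 1)) (h : KoszulChain d M i) :
    ∃ f : KoszulChain (d + 1) M (i + 1),
      lowPart (R := R) M (i + 1) f = g ∧ highPart (R := R) M i f = h := by
  refine ⟨fun s => Sum.elim g h ((indexSumEquiv d i).symm s), ?_, ?_⟩
  · funext t
    have : (indexSumEquiv d i).symm (shiftIndex t) = Sum.inl t := by
      rw [Equiv.symm_apply_eq]; rfl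
    exact congrArg (Sum.elim g h) this
  · funext t
    have : (indexSumEquiv d i).symm (shiftIndexZero t) = Sum.inr t := by
      rw [Equiv.symm_apply_eq]; rfl
    exact congrArg (Sum.elim g h) this

variable {M}

theorem chain_ext {i : ℕ} {f f' : KoszulChain (d + 1) M (i + 1)}
    (h1 : lowPart (R := R) M (i + 1) f = lowPart (R := R) M (i + 1) f')
    (h2 : highPart (R := R) M i f = highPart (R := R) M i f') : f = f' := by
  funext s
  obtain ⟨t, rfl⟩ := (indexSumEquiv d i).surjective s
  cases t with
  | inl t => exact congrFun h1 t
  | inr t => exact congrFun h2 t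

theorem lowPart_zero_bijective :
    Bijective (lowPart (R := R) M 0 : KoszulChain (d + 1) M 0 →ₗ[R] KoszulChain d M 0) := by
  have hb : Bijective (shiftIndex (d := d) (i := 0)) := by
    refine ⟨shiftIndex_injective, fun s => exists_shiftIndex s ?_⟩
    rw [Finset.card_eq_zero.mp s.2]
    exact Finset.notMem_empty _
  constructor
  · exact LinearMap.funLeft_injective_of_surjective R M _ hb.2
  · exact LinearMap.funLeft_surjective_of_injective R M _ hb.1

theorem sum_dite_eq_sum_subtype {ι N : Type*} [Fintype ι] [AddCommMonoid N] (p : ι → Prop)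
    [DecidablePred p] (F : {j // p j} → N) :
    (∑ j, if h : p j then F ⟨j, h⟩ else 0) = ∑ j : {j // p j}, F j := by
  rw [← Finset.sum_filter_of_ne (p := p) (fun j _ hj => by
      by_contra h; exact hj (dif_neg h)),
    Finset.sum_subtype (Finset.univ.filter p) (p := p) (by simp)]
  exact Finset.sum_congr rfl fun j _ => dif_pos j.2

theorem koszulD_apply {x : Fin d → R} {i : ℕ} (f : KoszulChain d M (i + 1))
    (t : {s : Finset (Fin d) // s.card = i}) :
    koszulD x M i f t = ∑ j : Fin d, if h : j ∉ t.1 then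
      ((-1 : R) ^ (t.1.filter (· < j)).card * x j) • f (insertIndex t ⟨j, h⟩) else 0 := by
  exact (sum_dite_eq_sum_subtype (fun j => j ∉ t.1) (fun j =>
    ((-1 : R) ^ (t.1.filter (· < j.1)).card * x j.1) • f (insertIndex t j))).symm

theorem lowPart_koszulD (a : R) (x : Fin d → R) (i : ℕ) (f : KoszulChain (d + 1) M (i + 1)) :
    lowPart (R := R) M i (koszulD (Fin.cons a x) M i f) =
      koszulD x M i (lowPart (R := R) M (i + 1) f) + a • highPart (R := R) M i f := by
  funext t
  change koszulD (Fin.cons a x) M i f (shiftIndex t) =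
    koszulD x M i (lowPart (R := R) M (i + 1) f) t + a • f (shiftIndexZero t)
  rw [koszulD_apply, koszulD_apply, Fin.sum_univ_succ, dif_pos (zero_notMem_shiftIndex t), add_comm]
  congr 1
  · refine Finset.sum_congr rfl fun j _ => ?_
    by_cases hj : j ∈ t.1
    · rw [dif_neg (not_not.mpr (succ_mem_shiftIndex.mpr hj)), dif_neg (not_not.mpr hj)]
    · rw [dif_pos (mt succ_mem_shiftIndex.mp hj), dif_pos hj, Fin.cons_succ]
      have h1 : ((shiftIndex t).1.filter (· < j.succ)).card = (t.1.filter (· < j)).card := by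
        rw [shiftIndex, Finset.filter_map, Finset.card_map]
        congr 1
        exact Finset.filter_congr fun k _ => Fin.succ_lt_succ_iff
      have h2 : insertIndex (shiftIndex t) ⟨j.succ, mt succ_mem_shiftIndex.mp hj⟩ =
          shiftIndex (insertIndex t ⟨j, hj⟩) :=
        Subtype.ext (by simp [shiftIndex, insertIndex, Finset.map_insert])
      rw [h1, h2]; rfl
  · have h1 : ((shiftIndex t).1.filter (· < (0 : Fin (d + 1)))) = ∅ := by
      ext k; simp
    rw [h1, Finset.card_empty, pow_zero, one_mul]; rfl

theorem highPart_koszulD (a : R) (x : Fin d → R) (i : ℕ) (f : KoszulChain (d + 1) M (i + 2)) :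
    highPart (R := R) M i (koszulD (Fin.cons a x) M (i + 1) f) =
      -koszulD x M i (highPart (R := R) M (i + 1) f) := by
  funext t
  change koszulD (Fin.cons a x) M (i + 1) f (shiftIndexZero t) =
    -koszulD x M i (highPart (R := R) M (i + 1) f) t
  rw [koszulD_apply, koszulD_apply, Fin.sum_univ_succ,
    dif_neg (not_not.mpr (zero_mem_shiftIndexZero t)), zero_add, ← Finset.sum_neg_distrib]
  refine Finset.sum_congr rfl fun j _ => ?_
  by_cases hj : j ∈ t.1
  · rw [dif_neg (not_not.mpr (succ_mem_shiftIndexZero.mpr hj)), dif_neg (not_not.mpr hj), neg_zero]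
  · rw [dif_pos (mt succ_mem_shiftIndexZero.mp hj), dif_pos hj, Fin.cons_succ]
    have h1 : ((shiftIndexZero t).1.filter (· < j.succ)).card = (t.1.filter (· < j)).card + 1 := by
      change ((insert 0 (t.1.map (Fin.succEmb d))).filter (· < j.succ)).card = _
      rw [Finset.filter_insert, if_pos (Fin.succ_pos j), Finset.card_insert_of_notMem (by simp),
        Finset.filter_map, Finset.card_map]
      congr 2
      exact Finset.filter_congr fun k _ => Fin.succ_lt_succ_iff
    have h2 : insertIndex (shiftIndexZero t) ⟨j.succ, mt succ_mem_shiftIndexZero.mp hj⟩ =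
        shiftIndexZero (insertIndex t ⟨j, hj⟩) :=
      Subtype.ext (by
        simp only [shiftIndexZero, shiftIndex, insertIndex, Finset.map_insert]
        exact Finset.insert_comm _ _ _)
    rw [h1, h2, pow_succ, mul_neg_one, neg_mul, neg_smul]; rfl

theorem mem_koszulCycles_cons {a : R} {x : Fin d → R} {i : ℕ}
    {f : KoszulChain (d + 1) M (i + 1)} :
    f ∈ koszulCycles (Fin.cons a x : Fin (d + 1) → R) M (i + 1) ↔
      koszulD x M i (lowPart (R := R) M (i + 1) f) + a • highPart (R := R) M i f = 0 ∧
        highPart (R := R) M i f ∈ koszulCycles x M i := by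
  change koszulD (Fin.cons a x) M i f = 0 ↔ _
  rw [← lowPart_koszulD]
  cases i with
  | zero =>
    rw [koszulCycles, map_eq_zero_iff _ lowPart_zero_bijective.1]
    simp
  | succ i =>
    have h := highPart_koszulD a x i f
    constructor
    · intro hf
      rw [hf, map_zero] at h ⊢
      exact ⟨rfl, neg_eq_zero.mp h.symm⟩
    · rintro ⟨h1, h2⟩
      refine chain_ext (R := R) (by rw [h1, map_zero]) ?_
      rw [h, map_zero, neg_eq_zero]
      exact h2

theorem mem_range_koszulD_cons {a : R} {x : Fin d → R} {i : ℕ}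
    {f : KoszulChain (d + 1) M (i + 1)} :
    f ∈ LinearMap.range (koszulD (Fin.cons a x : Fin (d + 1) → R) M (i + 1)) ↔
      ∃ (g : KoszulChain d M (i + 2)) (h : KoszulChain d M (i + 1)),
        lowPart (R := R) M (i + 1) f = koszulD x M (i + 1) g + a • h ∧
          highPart (R := R) M i f = -koszulD x M i h := by
  constructor
  · rintro ⟨f, rfl⟩
    exact ⟨_, _, lowPart_koszulD a x (i + 1) f, highPart_koszulD a x i f⟩
  · rintro ⟨g, h, h1, h2⟩
    obtain ⟨f', hg, hh⟩ := exists_chain (R := R) M (i + 1) g h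
    refine ⟨f', chain_ext (R := R) ?_ ?_⟩
    · rw [lowPart_koszulD, hg, hh, h1]
    · rw [highPart_koszulD, hh, h2]

/-- The Koszul complex on `a, x` is the cone of multiplication by `a` on the one on `x`; hence the
exact sequence `0 → H_{i+1}(x; M)/a → H_{i+1}(a, x; M) → 0 :_{H_i(x; M)} a → 0`. -/
theorem exists_koszul_extension (a : R) (x : Fin d → R) (i : ℕ) :
    ∃ (ι : KoszulHomology x M (i + 1) →ₗ[R]
        KoszulHomology (Fin.cons a x : Fin (d + 1) → R) M (i + 1))
      (p : KoszulHomology (Fin.cons a x : Fin (d + 1) → R) M (i + 1) →ₗ[R] KoszulHomology x M i),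
      LinearMap.ker p = LinearMap.range ι ∧ LinearMap.ker ι = a • ⊤ ∧
        LinearMap.range p = Submodule.torsionBy R (KoszulHomology x M i) a := by
  have hbij : Bijective ((lowPart (R := R) (d := d) M (i + 1)).prod (highPart M i)) :=
    ⟨fun f f' h => chain_ext (R := R) (congrArg Prod.fst h) (congrArg Prod.snd h), fun z => by
      obtain ⟨f, h1, h2⟩ := exists_chain (R := R) M i z.1 z.2
      exact ⟨f, Prod.ext h1 h2⟩⟩
  let E : KoszulChain d M (i + 1) →ₗ[R] KoszulChain (d + 1) M (i + 1) :=
    (LinearEquiv.ofBijective _ hbij).symm.toLinearMap.comp (LinearMap.inl R _ _)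
  have hE : ∀ g, ((lowPart (R := R) (d := d) M (i + 1)).prod (highPart M i)) (E g) = (g, 0) :=
    fun g => LinearEquiv.apply_symm_apply (LinearEquiv.ofBijective _ hbij) (g, 0)
  have hEl : ∀ g, lowPart (R := R) M (i + 1) (E g) = g := fun g => congrArg Prod.fst (hE g)
  have hEh : ∀ g, highPart (R := R) M i (E g) = 0 := fun g => congrArg Prod.snd (hE g)
  have hEz : ∀ g ∈ koszulCycles x M (i + 1),
      E g ∈ koszulCycles (Fin.cons a x : Fin (d + 1) → R) M (i + 1) := by
    intro g hg
    rw [mem_koszulCycles_cons, hEl, hEh, smul_zero, add_zero]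
    exact ⟨hg, zero_mem _⟩
  have hhz : ∀ f ∈ koszulCycles (Fin.cons a x : Fin (d + 1) → R) M (i + 1),
      highPart (R := R) M i f ∈ koszulCycles x M i := fun f hf => (mem_koszulCycles_cons.mp hf).2
  let ι : KoszulHomology x M (i + 1) →ₗ[R]
      KoszulHomology (Fin.cons a x : Fin (d + 1) → R) M (i + 1) :=
    Submodule.mapQ _ _ (E.restrict hEz) (by
      intro g hg
      have hg' : g.1 ∈ LinearMap.range (koszulD x M (i + 1)) := hg
      obtain ⟨g', hg'⟩ := hg'
      change E g.1 ∈ LinearMap.range (koszulD (Fin.cons a x : Fin (d + 1) → R) M (i + 1))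
      rw [mem_range_koszulD_cons]
      refine ⟨g', 0, ?_, ?_⟩
      · rw [hEl, hg', smul_zero, add_zero]
      · rw [hEh, map_zero, neg_zero])
  let p : KoszulHomology (Fin.cons a x : Fin (d + 1) → R) M (i + 1) →ₗ[R] KoszulHomology x M i :=
    Submodule.mapQ _ _ ((highPart M i).restrict hhz) (by
      intro f hf
      have hf' : f.1 ∈ LinearMap.range (koszulD (Fin.cons a x : Fin (d + 1) → R) M (i + 1)) := hf
      obtain ⟨g, h, -, h2⟩ := mem_range_koszulD_cons.mp hf'
      exact ⟨-h, by rw [map_neg, ← h2]; rfl⟩)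
  have hι : ∀ z, ι (Submodule.Quotient.mk z) = Submodule.Quotient.mk (E.restrict hEz z) :=
    fun _ => rfl
  have hp : ∀ z, p (Submodule.Quotient.mk z) =
    Submodule.Quotient.mk ((highPart M i).restrict hhz z) := fun _ => rfl
  have mkz : ∀ {d : ℕ} {x : Fin d → R} {i : ℕ} (z : koszulCycles x M i),
      (Submodule.Quotient.mk z : KoszulHomology x M i) = 0 ↔
        z.1 ∈ LinearMap.range (koszulD x M i) := by
    intro d x i z
    rw [Submodule.Quotient.mk_eq_zero]; rfl
  refine ⟨ι, p, ?_, ?_, ?_⟩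
  · ext q
    obtain ⟨f, rfl⟩ := Submodule.Quotient.mk_surjective _ q
    rw [LinearMap.mem_ker, hp, mkz]
    have hf := mem_koszulCycles_cons.mp f.2
    constructor
    · rintro ⟨h, hh⟩
      replace hh : koszulD x M i h = highPart (R := R) M i f.1 := hh
      refine ⟨Submodule.Quotient.mk ⟨lowPart (R := R) M (i + 1) f.1 + a • h, ?_⟩, ?_⟩
      · change koszulD x M i _ = 0
        rw [map_add, map_smul, hh, hf.1]
      · rw [hι, ← sub_eq_zero, ← Submodule.Quotient.mk_sub, mkz, mem_range_koszulD_cons]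
        refine ⟨0, h, ?_, ?_⟩
        · change lowPart (R := R) M (i + 1) (E _ - f.1) = _
          rw [map_sub, hEl, map_zero, zero_add]
          exact add_sub_cancel_left _ _
        · change highPart (R := R) M i (E _ - f.1) = _
          rw [map_sub, hEh, hh, zero_sub]
    · rintro ⟨q, hq⟩
      obtain ⟨g, rfl⟩ := Submodule.Quotient.mk_surjective _ q
      rw [hι, ← sub_eq_zero, ← Submodule.Quotient.mk_sub, mkz, mem_range_koszulD_cons] at hq
      obtain ⟨-, h, -, h2⟩ := hq
      replace h2 : highPart (R := R) M i (E g.1 - f.1) = - koszulD x M i h := h2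
      rw [map_sub, hEh, zero_sub, neg_inj] at h2
      exact ⟨h, h2.symm⟩
  · ext q
    obtain ⟨g, rfl⟩ := Submodule.Quotient.mk_surjective _ q
    rw [LinearMap.mem_ker, hι, mkz, Submodule.mem_smul_pointwise_iff_exists]
    constructor
    · intro h
      obtain ⟨g', h, h1, h2⟩ := mem_range_koszulD_cons.mp h
      replace h1 : lowPart (R := R) M (i + 1) (E g.1) = koszulD x M (i + 1) g' + a • h := h1
      replace h2 : highPart (R := R) M i (E g.1) = - koszulD x M i h := h2
      rw [hEl] at h1
      rw [hEh, eq_comm, neg_eq_zero] at h2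
      refine ⟨Submodule.Quotient.mk ⟨h, h2⟩, trivial, ?_⟩
      rw [← Submodule.Quotient.mk_smul, ← sub_eq_zero, ← Submodule.Quotient.mk_sub, mkz]
      refine ⟨-g', ?_⟩
      change _ = a • h - g.1
      rw [h1, map_neg]; simp
    · rintro ⟨q, -, hq⟩
      obtain ⟨h, rfl⟩ := Submodule.Quotient.mk_surjective _ q
      rw [← Submodule.Quotient.mk_smul, ← sub_eq_zero, ← Submodule.Quotient.mk_sub, mkz] at hq
      obtain ⟨g', hg'⟩ := hq
      replace hg' : koszulD x M (i + 1) g' = a • h.1 - g.1 := hg'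
      rw [mem_range_koszulD_cons]
      refine ⟨-g', h.1, ?_, ?_⟩
      · change lowPart (R := R) M (i + 1) (E g.1) = _
        rw [hEl, map_neg, hg']; simp
      · change highPart (R := R) M i (E g.1) = _
        have : koszulD x M i h.1 = 0 := h.2
        rw [hEh, this, neg_zero]
  · ext q
    obtain ⟨h, rfl⟩ := Submodule.Quotient.mk_surjective _ q
    rw [Submodule.mem_torsionBy_iff, ← Submodule.Quotient.mk_smul, mkz]
    constructor
    · rintro ⟨q, hq⟩
      obtain ⟨f, rfl⟩ := Submodule.Quotient.mk_surjective _ q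
      rw [hp, ← sub_eq_zero, ← Submodule.Quotient.mk_sub, mkz] at hq
      obtain ⟨k, hk⟩ := hq
      replace hk : koszulD x M i k = highPart (R := R) M i f.1 - h.1 := hk
      have hf := mem_koszulCycles_cons.mp f.2
      refine ⟨-lowPart (R := R) M (i + 1) f.1 - a • k, ?_⟩
      change _ = a • h.1
      rw [map_sub, map_neg, map_smul, hk, eq_neg_of_add_eq_zero_left hf.1, smul_sub]
      simp
    · rintro ⟨g, hg⟩
      replace hg : koszulD x M i g = a • h.1 := hg
      obtain ⟨f, h1, h2⟩ := exists_chain (R := R) M i (-g) h.1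
      refine ⟨Submodule.Quotient.mk ⟨f, ?_⟩, ?_⟩
      · rw [mem_koszulCycles_cons, h1, h2, map_neg, hg, neg_add_cancel]
        exact ⟨rfl, h.2⟩
      · rw [hp]
        congr 1
        exact Subtype.ext h2

end Koszul

section KoszulSymbol

variable {R : Type*} [CommRing R]

theorem subsingleton_koszulHomology {d : ℕ} (x : Fin d → R) (M : Type u) [AddCommGroup M]
    [Module R M] {i : ℕ} (hi : d < i) : Subsingleton (KoszulHomology x M i) := by
  have : IsEmpty {s : Finset (Fin d) // s.card = i} := ⟨fun s => by
    have := s.1.card_le_univ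
    rw [s.2, Fintype.card_fin] at this
    omega⟩
  have : Subsingleton (koszulCycles x M i) := inferInstance
  exact (Submodule.mkQ_surjective _).subsingleton

theorem nonempty_koszulHomology_zero_cons {d : ℕ} (a : R) (x : Fin d → R) (M : Type u)
    [AddCommGroup M] [Module R M] :
    Nonempty (KoszulHomology (Fin.cons a x : Fin (d + 1) → R) M 0 ≃ₗ[R]
      QuotSMulTop a (KoszulHomology x M 0)) := by
  let φ : KoszulHomology (Fin.cons a x : Fin (d + 1) → R) M 0 →ₗ[R]
      QuotSMulTop a (KoszulHomology x M 0) :=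
    Submodule.liftQ _ ((Submodule.mkQ _).comp ((Submodule.mkQ _).comp
      ((lowPart (R := R) (d := d) M 0).restrict (p := koszulCycles (Fin.cons a x) M 0)
        (q := koszulCycles x M 0) (fun _ _ => trivial)))) (by
      rintro f ⟨k, hk⟩
      rw [LinearMap.mem_ker]
      simp only [LinearMap.comp_apply, Submodule.mkQ_apply]
      rw [Submodule.Quotient.mk_eq_zero, Submodule.mem_smul_pointwise_iff_exists]
      refine ⟨Submodule.Quotient.mk ⟨highPart (R := R) M 0 k, trivial⟩, trivial, ?_⟩
      rw [← Submodule.Quotient.mk_smul]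
      refine (Submodule.Quotient.eq _).mpr ?_
      refine ⟨-lowPart (R := R) M 1 k, ?_⟩
      have h1 := lowPart_koszulD a x 0 k
      replace hk : koszulD (Fin.cons a x : Fin (d + 1) → R) M 0 k = f.1 := hk
      rw [hk] at h1
      change _ = a • highPart (R := R) M 0 k - lowPart (R := R) M 0 f.1
      rw [h1, map_neg]; simp)
  refine ⟨LinearEquiv.ofBijective φ ⟨?_, ?_⟩⟩
  · rw [← LinearMap.ker_eq_bot, LinearMap.ker_eq_bot']
    intro q hq
    obtain ⟨f, rfl⟩ := Submodule.Quotient.mk_surjective _ q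
    replace hq : (Submodule.Quotient.mk (Submodule.Quotient.mk
      (⟨lowPart (R := R) M 0 f.1, trivial⟩ : koszulCycles x M 0)) :
        QuotSMulTop a (KoszulHomology x M 0)) = 0 := hq
    rw [Submodule.Quotient.mk_eq_zero, Submodule.mem_smul_pointwise_iff_exists] at hq
    obtain ⟨q, -, hq⟩ := hq
    obtain ⟨h, rfl⟩ := Submodule.Quotient.mk_surjective _ q
    rw [← Submodule.Quotient.mk_smul] at hq
    obtain ⟨g, hg⟩ := (Submodule.Quotient.eq _).mp hq
    replace hg : koszulD x M 0 g = a • h.1 - lowPart (R := R) M 0 f.1 := hg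
    obtain ⟨k, hk1, hk2⟩ := exists_chain (R := R) M 0 (-g) h.1
    rw [Submodule.Quotient.mk_eq_zero]
    refine ⟨k, (lowPart_zero_bijective (R := R)).1 ?_⟩
    rw [lowPart_koszulD, hk1, hk2, map_neg, hg]
    simp
  · intro q
    obtain ⟨q, rfl⟩ := Submodule.Quotient.mk_surjective _ q
    obtain ⟨g, rfl⟩ := Submodule.Quotient.mk_surjective _ q
    obtain ⟨f, hf⟩ := (lowPart_zero_bijective (R := R)).2 g.1
    refine ⟨Submodule.Quotient.mk ⟨f, trivial⟩, ?_⟩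
    have : (lowPart (R := R) (d := d) M 0).restrict (p := koszulCycles (Fin.cons a x) M 0)
        (q := koszulCycles x M 0) (fun _ _ => trivial) ⟨f, trivial⟩ = g := Subtype.ext hf
    exact congrArg (fun g => (Submodule.Quotient.mk (Submodule.Quotient.mk g) :
      QuotSMulTop a (KoszulHomology x M 0))) this

theorem nonempty_koszulHomology_zero_of_empty (x : Fin 0 → R) (M : Type u) [AddCommGroup M]
    [Module R M] : Nonempty (KoszulHomology x M 0 ≃ₗ[R] M) := by
  have h1 : (LinearMap.range (koszulD x M 0)).submoduleOf (koszulCycles x M 0) = ⊥ := by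
    rw [eq_bot_iff]
    rintro f ⟨k, hk⟩
    apply Subtype.ext
    replace hk : koszulD x M 0 k = f.1 := hk
    rw [← hk]
    funext t
    rw [koszulD_apply]
    simp
  have : Unique {s : Finset (Fin 0) // s.card = 0} :=
    ⟨⟨⟨∅, rfl⟩⟩, fun s => Subtype.ext (Subsingleton.elim _ _)⟩
  exact ⟨(Submodule.quotEquivOfEqBot _ h1).trans
    (Submodule.topEquiv.trans (LinearEquiv.funUnique _ R M))⟩

omit [CommRing R] in
theorem ofFn_cons {d : ℕ} (a : R) (x : Fin d → R) :
    List.ofFn (Fin.cons a x : Fin (d + 1) → R) = a :: List.ofFn x := by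
  rw [List.ofFn_succ]; simp

/-- `H₀(x; M) ≃ M/(x)M`. -/
theorem nonempty_koszulHomology_zero : ∀ {d : ℕ} (x : Fin d → R) (M : Type u) [AddCommGroup M]
    [Module R M], Nonempty (KoszulHomology x M 0 ≃ₗ[R]
      M ⧸ (Ideal.ofList (List.ofFn x) • ⊤ : Submodule R M)) := by
  intro d
  induction d with
  | zero =>
    intro x M _ _
    obtain ⟨e⟩ := nonempty_koszulHomology_zero_of_empty x M
    exact ⟨e.trans (Submodule.quotEquivOfEqBot _
      (by rw [List.ofFn_zero, Ideal.ofList_nil, Submodule.bot_smul])).symm⟩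
  | succ d ih =>
    intro x M _ _
    obtain ⟨a, x, rfl⟩ : ∃ a y, x = Fin.cons a y := ⟨_, _, (Fin.cons_self_tail x).symm⟩
    obtain ⟨e⟩ := nonempty_koszulHomology_zero_cons a x M
    obtain ⟨e'⟩ := ih x M
    rw [ofFn_cons]
    exact ⟨(e.trans (QuotSMulTop.congr a e')).trans
      (Submodule.quotOfListConsSMulTopEquivQuotSMulTopOuter M a (List.ofFn x)).symm⟩

variable [IsLocalRing R]

/-- Being a system of parameters passes to the middle term of an exact sequence, since the product
of the annihilators of the outer terms kills it. -/
theorem IsParam.of_exact {l : List R} {A : Type u} {B : Type v} {C : Type w} [AddCommGroup A]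
    [Module R A] [AddCommGroup B] [Module R B] [AddCommGroup C] [Module R C] {f : A →ₗ[R] B}
    {g : B →ₗ[R] C} (H : LinearMap.ker g ≤ LinearMap.range f) (hA : IsParam l A)
    (hC : IsParam l C) : IsParam l B := by
  have h1 : Module.annihilator R A * Module.annihilator R C ≤ Module.annihilator R B := by
    rw [Ideal.mul_le]
    intro r hr s hs
    rw [Module.mem_annihilator] at hr hs ⊢
    intro b
    obtain ⟨a, ha⟩ := H (show s • b ∈ LinearMap.ker g by rw [LinearMap.mem_ker, map_smul, hs])
    rw [mul_smul, ← ha, ← map_smul, hr, map_zero]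
  have h2 : (Ideal.ofList l ⊔ Module.annihilator R A) * (Ideal.ofList l ⊔ Module.annihilator R C) ≤
      Ideal.ofList l ⊔ Module.annihilator R B := by
    refine Ideal.mul_le.mpr fun r hr s hs => ?_
    obtain ⟨p, hp, q, hq, rfl⟩ := Submodule.mem_sup.mp hr
    obtain ⟨p', hp', q', hq', rfl⟩ := Submodule.mem_sup.mp hs
    have : (p + q) * (p' + q') = (p * (p' + q') + q * p') + q * q' := by ring
    rw [this]
    exact Submodule.add_mem_sup (add_mem (Ideal.mul_mem_right _ _ hp) (Ideal.mul_mem_left _ _ hp'))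
      (h1 (Ideal.mul_mem_mul hq hq'))
  have h3 := Ideal.radical_mono h2
  rw [Ideal.radical_mul] at h3
  unfold IsParam at hA hC ⊢
  exact le_trans (le_inf hA hC) h3

variable [IsNoetherianRing R]

/-- Moving the elements one by one from the symbol into the Koszul complex shows that the Euler
characteristic of Koszul homology is the symbol. -/
theorem symb_eq_sum_koszulHomology : ∀ {d : ℕ} (x : Fin d → R) (l : List R) (M : Type u)
    [AddCommGroup M] [Module R M] [Module.Finite R M] (_ : IsParam (List.ofFn x ++ l) M),
    (∀ i, IsParam l (KoszulHomology x M i)) ∧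
      ∑ i ∈ Finset.range (d + 1), (-1) ^ i * symb l (KoszulHomology x M i) =
        symb (List.ofFn x ++ l) M := by
  intro d
  induction d with
  | zero =>
    intro x l M _ _ _ h
    obtain ⟨e⟩ := nonempty_koszulHomology_zero_of_empty x M
    rw [List.ofFn_zero, List.nil_append] at h ⊢
    refine ⟨fun i => ?_, ?_⟩
    · rcases Nat.eq_zero_or_pos i with rfl | hi
      · exact h.of_surjective e.symm.toLinearMap e.symm.surjective
      · have := subsingleton_koszulHomology x M hi
        exact h.of_surjective 0 (fun b => ⟨0, Subsingleton.elim _ _⟩)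
    · rw [zero_add, Finset.sum_range_one, pow_zero, one_mul, symb_congr l e]
  | succ d ih =>
    intro x l M _ _ _ h
    obtain ⟨a, x, rfl⟩ : ∃ a y, x = Fin.cons a y := ⟨_, _, (Fin.cons_self_tail x).symm⟩
    rw [ofFn_cons] at h ⊢
    have hperm : (a :: List.ofFn x ++ l).Perm (List.ofFn x ++ a :: l) :=
      List.perm_middle.symm
    obtain ⟨hP, hsum⟩ := ih x (a :: l) M (h.perm hperm)
    obtain ⟨e0⟩ := nonempty_koszulHomology_zero_cons a x M
    have hP' : ∀ i, IsParam l (KoszulHomology (Fin.cons a x : Fin (d + 1) → R) M i) := by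
      intro i
      cases i with
      | zero =>
        exact (hP 0).quotSMulTop.of_surjective e0.symm.toLinearMap e0.symm.surjective
      | succ i =>
        obtain ⟨ι, p, h1, h2, h3⟩ := exists_koszul_extension (M := M) a x i
        refine IsParam.of_exact (f := (Submodule.liftQ _ ι h2.ge))
          (g := p.codRestrict (Submodule.torsionBy R _ a) (fun q => h3.le ⟨q, rfl⟩)) ?_
          (hP (i + 1)).quotSMulTop (hP i).torsionBy
        rw [LinearMap.ker_codRestrict, Submodule.range_liftQ, h1]
    refine ⟨hP', ?_⟩
    have hext : ∀ i, symb l (KoszulHomology (Fin.cons a x : Fin (d + 1) → R) M (i + 1)) =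
        symb l (QuotSMulTop a (KoszulHomology x M (i + 1))) +
          symb l (Submodule.torsionBy R (KoszulHomology x M i) a) := by
      intro i
      obtain ⟨ι, p, h1, h2, h3⟩ := exists_koszul_extension (M := M) a x i
      exact symb_eq_of_extension l a (hP' _) ι p h1 h2 h3
    rw [symb_perm hperm h, ← hsum, Finset.sum_range_succ', pow_zero, one_mul, symb_congr l e0]
    simp only [hext, symb_cons]
    have hs : Subsingleton (QuotSMulTop a (KoszulHomology x M (d + 1))) :=
      have := subsingleton_koszulHomology x M (Nat.lt_succ_self d)
      (Submodule.mkQ_surjective _).subsingleton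
    have h0 := symb_of_subsingleton l (QuotSMulTop a (KoszulHomology x M (d + 1)))
    have hq := Finset.sum_range_succ' (fun i => (-1 : ℤ) ^ i *
      symb l (QuotSMulTop a (KoszulHomology x M i))) (d + 1)
    rw [Finset.sum_range_succ, h0, mul_zero, add_zero, pow_zero, one_mul] at hq
    simp only [mul_sub, Finset.sum_sub_distrib, mul_add, Finset.sum_add_distrib]
    rw [hq]
    have hm : ∀ i, (-1 : ℤ) ^ (i + 1) * symb l (Submodule.torsionBy R (KoszulHomology x M i) a) =
      -((-1 : ℤ) ^ i * symb l (Submodule.torsionBy R (KoszulHomology x M i) a)) := fun i => by ring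
    simp only [hm, Finset.sum_neg_distrib]
    ring

/-- The first higher Euler characteristic is the defect. -/
theorem chiOne_eq_defect {d : ℕ} (x : Fin d → R) (M : Type u) [AddCommGroup M] [Module R M]
    [Module.Finite R M] (h : IsParam (List.ofFn x) M) : chiOne x M = defect (List.ofFn x) M := by
  have h1 := (symb_eq_sum_koszulHomology x [] M (by rwa [List.append_nil])).2
  obtain ⟨e⟩ := nonempty_koszulHomology_zero x M
  rw [List.append_nil, Finset.sum_range_succ', pow_zero, one_mul, symb_congr [] e] at h1
  rw [defect, ← h1, chiOne]
  simp only [symb_nil]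
  have h2 : ∑ i ∈ Finset.Icc 1 d, (-1 : ℤ) ^ (i - 1) * (len R (KoszulHomology x M i) : ℤ) =
      ∑ i ∈ Finset.range d, (-1 : ℤ) ^ i * (len R (KoszulHomology x M (i + 1)) : ℤ) := by
    rw [← Finset.Ico_add_one_right_eq_Icc, Finset.sum_Ico_eq_sum_range]
    refine Finset.sum_congr rfl fun i _ => ?_
    rw [add_comm 1 i]; rfl
  rw [h2]
  simp only [pow_succ, mul_neg_one, neg_mul, Finset.sum_neg_distrib]
  ring

end KoszulSymbol

/-! ### Superficial elements -/

section Superficial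

open Polynomial

variable {S : Type u} [CommRing S]

/-- Avoidance over an infinite residue field: finitely many ideals that do not contain the maximal
ideal do not cover it. -/
theorem exists_mem_maximalIdeal_forall_notMem [IsLocalRing S] [Infinite (ResidueField S)]
    (V : Finset (Ideal S)) (hV : ∀ I ∈ V, ¬ maximalIdeal S ≤ I) :
    ∃ y ∈ maximalIdeal S, ∀ I ∈ V, y ∉ I := by
  by_contra! hcon
  have hcover : ⋃ I ∈ V, ((Submodule.comap (maximalIdeal S).subtype I :
      Submodule S (maximalIdeal S)) : Set (maximalIdeal S)) = Set.univ := by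
    rw [Set.eq_univ_iff_forall]
    intro y
    obtain ⟨I, hI, hy⟩ := hcon y.1 y.2
    exact Set.mem_iUnion₂.mpr ⟨I, hI, hy⟩
  obtain ⟨I, hI, hfin⟩ := Submodule.exists_finiteIndex_of_cover hcover
  set p := Submodule.comap (maximalIdeal S).subtype I with hp
  have : Finite (maximalIdeal S ⧸ p) := AddSubgroup.finite_quotient_of_finiteIndex
  obtain ⟨y, hy, hyI⟩ := Set.not_subset.mp (hV I hI)
  have hq : (Submodule.Quotient.mk ⟨y, hy⟩ : maximalIdeal S ⧸ p) ≠ 0 := by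
    rw [Ne, Submodule.Quotient.mk_eq_zero]
    exact hyI
  set q : maximalIdeal S ⧸ p := Submodule.Quotient.mk ⟨y, hy⟩
  have hinj : Injective fun c : ResidueField S => (surjInv residue_surjective c : S) • q := by
    intro c c' h
    by_contra hne
    have hu : IsUnit (surjInv residue_surjective c - surjInv residue_surjective c' : S) := by
      rw [← notMem_maximalIdeal, ← residue_eq_zero_iff, map_sub, surjInv_eq residue_surjective,
        surjInv_eq residue_surjective, sub_eq_zero]
      exact hne
    apply hq
    rw [← hu.smul_eq_zero, sub_smul, sub_eq_zero]
    exact h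
  exact (Finite.of_injective _ hinj).false

variable (I : Ideal S)

/-- The element `z t` of the Rees algebra. -/
noncomputable def reesLinear (z : I) : reesAlgebra I :=
  ⟨monomial 1 z.1, reesAlgebra.monomial_mem.mpr (by rw [pow_one]; exact z.2)⟩

/-- The elements `z` such that `z t` lies in a given ideal of the Rees algebra. -/
def linearPart (P : Ideal (reesAlgebra I)) : Ideal S where
  carrier := {z | ∃ a ∈ P, (a : S[X]) = monomial 1 z}
  add_mem' := by
    rintro z z' ⟨a, ha, h⟩ ⟨a', ha', h'⟩
    exact ⟨a + a', add_mem ha ha', by rw [map_add, ← h, ← h']; rfl⟩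
  zero_mem' := ⟨0, zero_mem _, by rw [map_zero]; rfl⟩
  smul_mem' := by
    rintro r z ⟨a, ha, h⟩
    refine ⟨algebraMap S (reesAlgebra I) r * a, Ideal.mul_mem_left _ _ ha, ?_⟩
    change algebraMap S S[X] r * (a : S[X]) = _
    rw [h, Polynomial.algebraMap_eq, C_mul_monomial, smul_eq_mul]

variable {I}

theorem mem_linearPart {P : Ideal (reesAlgebra I)} {z : I} :
    z.1 ∈ linearPart I P ↔ reesLinear I z ∈ P := by
  constructor
  · rintro ⟨a, ha, h⟩
    rwa [show reesLinear I z = a from Subtype.ext h.symm]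
  · exact fun h => ⟨_, h, rfl⟩

/-- The elements `r tᵐ` with `r ∈ Iᵐ` lie in the `m`-th power of the irrelevant ideal. -/
theorem exists_mem_pow_span_reesLinear (m : ℕ) : ∀ r ∈ I ^ m,
    ∃ a ∈ Ideal.span (Set.range (reesLinear I)) ^ m, (a : S[X]) = monomial m r := by
  induction m with
  | zero =>
    intro r _
    refine ⟨algebraMap S (reesAlgebra I) r, by simp, ?_⟩
    change algebraMap S S[X] r = _
    rw [Polynomial.algebraMap_eq, monomial_zero_left]
  | succ m ih =>
    intro r hr
    rw [pow_succ] at hr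
    induction hr using Submodule.mul_induction_on' with
    | mem_mul_mem p hp q hq =>
      obtain ⟨a, ha, h⟩ := ih p hp
      refine ⟨a * reesLinear I ⟨q, hq⟩, ?_, ?_⟩
      · rw [pow_succ]
        exact Ideal.mul_mem_mul ha (Ideal.subset_span ⟨_, rfl⟩)
      · change (a : S[X]) * monomial 1 q = _
        rw [h, monomial_mul_monomial]
    | add p _ q _ hp hq =>
      obtain ⟨a, ha, h⟩ := hp
      obtain ⟨b, hb, h'⟩ := hq
      exact ⟨a + b, add_mem ha hb, by rw [map_add, ← h, ← h']; rfl⟩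

/-- The `I`-adic filtration shifted by one. -/
def shiftedFiltration (I : Ideal S) (N : Type v) [AddCommGroup N] [Module S N] :
    I.Filtration N where
  N i := I ^ (i + 1) • ⊤
  mono i := Submodule.smul_mono_left (Ideal.pow_le_pow_right (Nat.le_succ _))
  smul_le i := by rw [← mul_smul, ← pow_succ']

/-- The quotient `P / (P ∩ P')` of a submodule `P`. -/
abbrev RelQuotient {A : Type*} [CommRing A] {Q : Type*} [AddCommGroup Q] [Module A Q]
    (P P' : Submodule A Q) : Type _ :=
  P ⧸ P'.submoduleOf P

/-- The associated graded module of `N` with respect to `I`, over the Rees algebra. -/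
abbrev AssocGraded (I : Ideal S) (N : Type v) [AddCommGroup N] [Module S N] : Type _ :=
  RelQuotient (A := reesAlgebra I) (I.stableFiltration (⊤ : Submodule S N)).submodule
    (shiftedFiltration I N).submodule

/-- The filtration by the elements of `IᵏN` whose initial forms are killed by that of `y`. -/
def killedFiltration (I : Ideal S) (N : Type v) [AddCommGroup N] [Module S N] (y : S) :
    I.Filtration N where
  N i := (I ^ i • ⊤) ⊓ Submodule.comap (DistribSMul.toLinearMap S N y) (I ^ (i + 2) • ⊤)
  mono i := inf_le_inf (Submodule.smul_mono_left (Ideal.pow_le_pow_right (Nat.le_succ _)))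
    (Submodule.comap_mono (Submodule.smul_mono_left (Ideal.pow_le_pow_right (Nat.le_succ _))))
  smul_le i := by
    rw [Submodule.smul_le]
    rintro r hr n ⟨h1, h2⟩
    refine ⟨?_, ?_⟩
    · rw [pow_succ', mul_smul]
      exact Submodule.smul_mem_smul hr h1
    · change y • (r • n) ∈ I ^ (i + 1 + 2) • (⊤ : Submodule S N)
      rw [smul_comm, show i + 1 + 2 = (i + 2) + 1 from rfl, pow_succ', mul_smul]
      exact Submodule.smul_mem_smul hr h2

variable [IsNoetherianRing S] {N : Type v} [AddCommGroup N] [Module S N] [Module.Finite S N]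

theorem finite_assocGraded :
    Module.Finite (reesAlgebra I) (AssocGraded I N) := by
  have : (I.stableFiltration (⊤ : Submodule S N)).submodule.FG :=
    (Ideal.Filtration.submodule_fg_iff_stable _ fun i => IsNoetherian.noetherian _).mpr
      (I.stableFiltration_stable _)
  have : Module.Finite (reesAlgebra I) (I.stableFiltration (⊤ : Submodule S N)).submodule :=
    Module.Finite.iff_fg.mpr this
  infer_instance

/-- If `y t` avoids the associated primes of the graded module that are not irrelevant, then some
power of the irrelevant ideal kills everything that `y t` kills. -/
theorem exists_pow_le_annihilator (y : I)
    (hy : ∀ P ∈ associatedPrimes (reesAlgebra I) (AssocGraded I N),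
      reesLinear I y ∈ P → I ≤ linearPart I P) :
    ∃ m, Ideal.span (Set.range (reesLinear I)) ^ m ≤ Module.annihilator (reesAlgebra I)
      (Submodule.torsionBy (reesAlgebra I) (AssocGraded I N) (reesLinear I y)) := by
  have := finite_assocGraded (I := I) (N := N)
  refine Ideal.exists_pow_le_of_le_radical_of_fg ?_ (IsNoetherian.noetherian _)
  rw [Ideal.span_le]
  rintro _ ⟨z, rfl⟩
  rw [← Ideal.sInf_minimalPrimes, SetLike.mem_coe, Ideal.mem_sInf]
  intro P hP
  have hP' : P ∈ associatedPrimes (reesAlgebra I) (Submodule.torsionBy (reesAlgebra I)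
      (AssocGraded I N) (reesLinear I y)) :=
    Module.associatedPrimes.minimalPrimes_annihilator_subset_associatedPrimes _ _ hP
  have hP'' := associatedPrimes.subset_of_injective (Submodule.subtype_injective _) hP'
  exact mem_linearPart.mp (hy P hP'' (hP.1.2 (mem_annihilator_torsionBy _ _)) z.2)

/-- The elements of `IᵏN` whose initial forms are killed by that of `y` form a stable filtration, so
a power of `I` that kills their initial forms in one large degree does so in all larger degrees. -/
theorem exists_forall_mem_pow_smul (y : I)
    (hy : ∀ P ∈ associatedPrimes (reesAlgebra I) (AssocGraded I N),
      reesLinear I y ∈ P → I ≤ linearPart I P) :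
    ∃ c, ∀ k ≥ c, ∀ g ∈ (I ^ k • ⊤ : Submodule S N), y.1 • g ∈ (I ^ (k + 2) • ⊤ : Submodule S N) →
      g ∈ (I ^ (k + 1) • ⊤ : Submodule S N) := by
  obtain ⟨m, hm⟩ := exists_pow_le_annihilator y hy
  set L := killedFiltration I N y.1 with hL
  have hLs : L.Stable := (I.stableFiltration_stable (⊤ : Submodule S N)).of_le
    (fun i => inf_le_left)
  obtain ⟨n₀, hn₀⟩ := hLs.exists_pow_smul_eq_of_ge
  have key : I ^ m • L.N n₀ ≤ I ^ (n₀ + m + 1) • ⊤ := by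
    rw [Submodule.smul_le]
    rintro r hr g ⟨hg1, hg2⟩
    obtain ⟨a, ha, har⟩ := exists_mem_pow_span_reesLinear m r hr
    let F := I.stableFiltration (⊤ : Submodule S N)
    have hgF : PolynomialModule.single S n₀ g ∈ F.submodule := by
      intro i
      rw [PolynomialModule.coeff_single, Finsupp.single_apply]
      split_ifs with h
      · rw [← h]; exact hg1
      · exact zero_mem _
    let G : AssocGraded I N := Submodule.Quotient.mk ⟨_, hgF⟩
    have hG : G ∈ Submodule.torsionBy (reesAlgebra I) (AssocGraded I N) (reesLinear I y) := by
      rw [Submodule.mem_torsionBy_iff]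
      refine (Submodule.Quotient.mk_eq_zero _).mpr ?_
      change (monomial 1 y.1 : S[X]) • PolynomialModule.single S n₀ g ∈
        (shiftedFiltration I N).submodule
      rw [PolynomialModule.monomial_smul_single]
      intro i
      rw [PolynomialModule.coeff_single, Finsupp.single_apply]
      split_ifs with h
      · rw [← h, add_comm 1]; exact hg2
      · exact zero_mem _
    have h0 := congrArg Subtype.val (Module.mem_annihilator.mp (hm ha) ⟨G, hG⟩)
    have h1 := (Submodule.Quotient.mk_eq_zero _).mp h0
    replace h1 : (a : S[X]) • PolynomialModule.single S n₀ g ∈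
        (shiftedFiltration I N).submodule := h1
    rw [har, PolynomialModule.monomial_smul_single] at h1
    have h2 := h1 (m + n₀)
    rw [PolynomialModule.coeff_single, Finsupp.single_apply, if_pos rfl] at h2
    rw [add_comm n₀ m]
    exact h2
  refine ⟨n₀ + m, fun k hk g hg hyg => ?_⟩
  have hgL : g ∈ L.N k := ⟨hg, hyg⟩
  rw [hn₀ k (by omega), show k - n₀ = (k - n₀ - m) + m by omega, pow_add, mul_smul] at hgL
  have := smul_mono_right (I ^ (k - n₀ - m)) key hgL
  rwa [← mul_smul, ← pow_add, show k - n₀ - m + (n₀ + m + 1) = k + 1 by omega] at this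

/-- An element `y` of the maximal ideal is superficial for `N` if multiplication by its initial form
is injective on the associated graded module in large degrees. -/
def IsSuperficial [IsLocalRing S] (y : S) (N : Type v) [AddCommGroup N] [Module S N] : Prop :=
  y ∈ maximalIdeal S ∧ ∃ c, ∀ k ≥ c, ∀ g ∈ (maximalIdeal S ^ k • ⊤ : Submodule S N),
    y • g ∈ (maximalIdeal S ^ (k + 2) • ⊤ : Submodule S N) →
      g ∈ (maximalIdeal S ^ (k + 1) • ⊤ : Submodule S N)

variable [IsLocalRing S] [Infinite (ResidueField S)]

variable (N) in
/-- Over an infinite residue field there are superficial elements outside any finite set of ideals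
that do not contain the maximal ideal. -/
theorem exists_isSuperficial (V : Finset (Ideal S)) (hV : ∀ J ∈ V, ¬ maximalIdeal S ≤ J) :
    ∃ y, IsSuperficial y N ∧ ∀ J ∈ V, y ∉ J := by
  classical
  set I := maximalIdeal S
  have := finite_assocGraded (I := I) (N := N)
  have hfin := associatedPrimes.finite (reesAlgebra I) (AssocGraded I N)
  obtain ⟨y, hyI, hy⟩ := exists_mem_maximalIdeal_forall_notMem
    (V ∪ ((hfin.toFinset.image (linearPart I)).filter fun J => ¬ I ≤ J)) (by
      intro J hJ
      rcases Finset.mem_union.mp hJ with hJ | hJ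
      · exact hV J hJ
      · exact (Finset.mem_filter.mp hJ).2)
  refine ⟨y, ⟨hyI, exists_forall_mem_pow_smul ⟨y, hyI⟩ fun P hP hyP => ?_⟩, fun J hJ =>
    hy J (Finset.mem_union_left _ hJ)⟩
  by_contra hcon
  exact hy (linearPart I P) (Finset.mem_union_right _ (Finset.mem_filter.mpr
    ⟨Finset.mem_image_of_mem _ (hfin.mem_toFinset.mpr hP), hcon⟩))
    (mem_linearPart (z := ⟨y, hyI⟩).mpr hyP)

end Superficial

/-! ### Hilbert–Samuel functions -/

section Growth

open Filter Asymptotics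

/-- Summation of differences raises the order of growth by one. -/
theorem isLittleO_of_sub_isLittleO {f : ℕ → ℝ} {d : ℕ}
    (h : (fun k => f (k + 1) - f k) =o[atTop] fun k : ℕ => ((k + 1 : ℕ) : ℝ) ^ d) :
    f =o[atTop] fun k : ℕ => (k : ℝ) ^ (d + 1) := by
  have hpos : ∀ k : ℕ, (1 : ℝ) ≤ ((k + 1 : ℕ) : ℝ) ^ d := fun k =>
    one_le_pow₀ (by push_cast; linarith [k.cast_nonneg (α := ℝ)])
  have hge : ∀ k : ℕ, (k : ℝ) ≤ ∑ j ∈ Finset.range k, ((j + 1 : ℕ) : ℝ) ^ d := fun k => by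
    simpa using Finset.card_nsmul_le_sum (Finset.range k) _ 1 fun j _ => hpos j
  have hsum := h.sum_range (fun k => zero_le_one.trans (hpos k))
    (tendsto_atTop_mono hge tendsto_natCast_atTop_atTop)
  have hle : (fun k : ℕ => ∑ j ∈ Finset.range k, ((j + 1 : ℕ) : ℝ) ^ d) =O[atTop]
      fun k : ℕ => (k : ℝ) ^ (d + 1) := by
    refine IsBigO.of_bound' (Eventually.of_forall fun k => ?_)
    rw [Real.norm_of_nonneg (Finset.sum_nonneg fun j _ => by positivity),
      Real.norm_of_nonneg (by positivity)]
    calc ∑ j ∈ Finset.range k, ((j + 1 : ℕ) : ℝ) ^ d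
        ≤ ∑ _j ∈ Finset.range k, (k : ℝ) ^ d := Finset.sum_le_sum fun j hj => by
          gcongr
          exact Finset.mem_range.mp hj
      _ = (k : ℝ) ^ (d + 1) := by
          rw [Finset.sum_const, Finset.card_range, nsmul_eq_mul, pow_succ, mul_comm]
  have h1 := hsum.trans_isBigO hle
  simp_rw [Finset.sum_range_sub] at h1
  have h2 : (fun _ : ℕ => f 0) =o[atTop] fun k : ℕ => (k : ℝ) ^ (d + 1) :=
    isLittleO_const_left.mpr (Or.inr (tendsto_norm_atTop_atTop.comp
      ((tendsto_pow_atTop (Nat.succ_ne_zero d)).comp tendsto_natCast_atTop_atTop)))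
  simpa using h1.add h2

theorem tendsto_factorial_mul_multichoose_div (d : ℕ) :
    Tendsto (fun k : ℕ => (d.factorial : ℝ) * (k.multichoose d : ℝ) / (k : ℝ) ^ d) atTop
      (nhds 1) := by
  have h : ∀ k : ℕ, (d.factorial : ℝ) * (k.multichoose d : ℝ) = (k.ascFactorial d : ℝ) := by
    intro k
    rw [Nat.multichoose_eq, ← Nat.cast_mul, ← Nat.ascFactorial_eq_factorial_mul_choose']
  simp_rw [h]
  clear h
  induction d with
  | zero => simp
  | succ d ih =>
    have h1 : Tendsto (fun k : ℕ => ((k : ℝ) + d) / k) atTop (nhds 1) := by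
      have h2 : Tendsto (fun k : ℕ => 1 + (d : ℝ) / k) atTop (nhds (1 + 0)) :=
        tendsto_const_nhds.add (tendsto_const_div_atTop_nhds_zero_nat _)
      rw [add_zero] at h2
      refine h2.congr' ?_
      filter_upwards [eventually_gt_atTop 0] with k hk
      have : (k : ℝ) ≠ 0 := by positivity
      field_simp
    have h3 := h1.mul ih
    rw [one_mul] at h3
    refine h3.congr fun k => ?_
    rw [Nat.ascFactorial_succ, pow_succ', div_mul_div_comm]
    push_cast
    rfl

/-- A function that agrees with `e * multichoose k d` up to `o(k ^ d)` has leading coefficient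
`e / d!`. -/
theorem tendsto_factorial_mul_div {f : ℕ → ℝ} {e : ℝ} {d : ℕ}
    (h : (fun k => f k - e * (k.multichoose d : ℝ)) =o[atTop] fun k : ℕ => (k : ℝ) ^ d) :
    Tendsto (fun k : ℕ => (d.factorial : ℝ) * f k / (k : ℝ) ^ d) atTop (nhds e) := by
  have h1 := (h.tendsto_div_nhds_zero.const_mul (d.factorial : ℝ)).add
    ((tendsto_factorial_mul_multichoose_div d).const_mul e)
  rw [mul_zero, zero_add, mul_one] at h1
  refine h1.congr fun k => ?_
  ring

end Growth

section HilbertSamuel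

variable {S : Type u} [CommRing S] [IsLocalRing S]

/-- The Hilbert–Samuel function `k ↦ length (N / 𝔫ᵏN)`. -/
noncomputable def hsFunction (S : Type u) [CommRing S] [IsLocalRing S] (N : Type v)
    [AddCommGroup N] [Module S N] (k : ℕ) : ℕ :=
  len S (N ⧸ (maximalIdeal S ^ k • ⊤ : Submodule S N))

/-- The elements of `N` that `y` sends into `𝔫ᵏN`. -/
abbrev colonPow (y : S) (N : Type v) [AddCommGroup N] [Module S N] (k : ℕ) : Submodule S N :=
  (maximalIdeal S ^ k • ⊤ : Submodule S N).comap (DistribSMul.toLinearMap S N y)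

theorem pow_smul_le_colonPow {N : Type v} [AddCommGroup N] [Module S N] {y : S}
    (hy : y ∈ maximalIdeal S) (k : ℕ) :
    (maximalIdeal S ^ k • ⊤ : Submodule S N) ≤ colonPow y N (k + 1) := by
  intro g hg
  change y • g ∈ (maximalIdeal S ^ (k + 1) • ⊤ : Submodule S N)
  rw [pow_succ', mul_smul]
  exact Submodule.smul_mem_smul hy hg

variable [IsNoetherianRing S] {N : Type v} [AddCommGroup N] [Module S N] [Module.Finite S N]

theorem length_quotient_ne_top {k : ℕ} {P : Submodule S N} (hP : maximalIdeal S ^ k • ⊤ ≤ P) :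
    Module.length S (N ⧸ P) ≠ ⊤ := by
  refine length_ne_top_of_maximalIdeal_le_radical _ fun z hz => ⟨k, ?_⟩
  rw [Module.mem_annihilator]
  intro m
  obtain ⟨m, rfl⟩ := P.mkQ_surjective m
  rw [← map_smul, Submodule.mkQ_apply, Submodule.Quotient.mk_eq_zero]
  exact hP (Submodule.smul_mem_smul (Ideal.pow_mem_pow hz k) Submodule.mem_top)

/-- The exact sequence `0 → N/(𝔫ᵏN : y) → N/𝔫ᵏN → N/(y, 𝔫ᵏ)N → 0`. -/
theorem hsFunction_eq_add_quotSMulTop (y : S) (k : ℕ) :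
    hsFunction S N k = len S (N ⧸ colonPow y N k) + hsFunction S (QuotSMulTop y N) k := by
  set P : Submodule S N := maximalIdeal S ^ k • ⊤ with hP
  have hle : P ≤ (maximalIdeal S ^ k • ⊤ : Submodule S (QuotSMulTop y N)).comap
      (Submodule.mkQ (y • (⊤ : Submodule S N))) := by
    rw [← Submodule.map_le_iff_le_comap, hP, Submodule.map_smul'']
    exact smul_mono_right _ le_top
  refine len_eq_add_of_exact (Submodule.mapQ (colonPow y N k) P (DistribSMul.toLinearMap S N y)
    le_rfl) (Submodule.mapQ P _ (Submodule.mkQ (y • (⊤ : Submodule S N))) hle) ?_ ?_ ?_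
    (length_quotient_ne_top le_rfl)
  · rw [← LinearMap.ker_eq_bot, Submodule.ker_mapQ, Submodule.mkQ_map_self]
  · rw [← LinearMap.range_eq_top, Submodule.range_mapQ, Submodule.range_mkQ, Submodule.map_top,
      Submodule.range_mkQ]
  · rw [LinearMap.exact_iff, Submodule.ker_mapQ, Submodule.range_mapQ]
    have h1 : (maximalIdeal S ^ k • ⊤ : Submodule S (QuotSMulTop y N)).comap
        (Submodule.mkQ (y • (⊤ : Submodule S N))) = y • ⊤ ⊔ P := by
      have : (maximalIdeal S ^ k • ⊤ : Submodule S (QuotSMulTop y N)) =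
          P.map (Submodule.mkQ (y • (⊤ : Submodule S N))) := by
        rw [hP, Submodule.map_smul'', Submodule.map_top, Submodule.range_mkQ]
      rw [this, Submodule.comap_map_mkQ]
    rw [h1, Submodule.map_sup, Submodule.mkQ_map_self, sup_bot_eq]
    congr 1
    ext g
    simp [Submodule.mem_smul_pointwise_iff_exists]

theorem len_colonPow_le {y : S} (hy : y ∈ maximalIdeal S) (k : ℕ) :
    len S (N ⧸ colonPow y N (k + 1)) ≤ hsFunction S N k :=
  len_le_of_surjective (Submodule.factor (pow_smul_le_colonPow hy k))
    (Submodule.factor_surjective _) (length_quotient_ne_top le_rfl)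

theorem hsFunction_le_len_add {k c : ℕ} {P : Submodule S N} (hP : maximalIdeal S ^ (k + 1) • ⊤ ≤ P)
    (h : P ⊓ maximalIdeal S ^ c • ⊤ ≤ maximalIdeal S ^ k • ⊤) :
    hsFunction S N k ≤ len S (N ⧸ P) + hsFunction S N c := by
  set Q : Submodule S N := maximalIdeal S ^ c • ⊤
  have h1 : Module.length S (N ⧸ P) ≠ ⊤ := length_quotient_ne_top hP
  have h2 : Module.length S (N ⧸ Q) ≠ ⊤ := length_quotient_ne_top le_rfl
  have h3 : Module.length S ((N ⧸ P) × (N ⧸ Q)) ≠ ⊤ := by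
    rw [Module.length_prod]
    exact WithTop.add_ne_top.mpr ⟨h1, h2⟩
  have h4 : len S ((N ⧸ P) × (N ⧸ Q)) = len S (N ⧸ P) + hsFunction S N c := by
    rw [len, Module.length_prod, ENat.toNat_add h1 h2]
    rfl
  have h5 : Module.length S (N ⧸ (P ⊓ Q)) ≠ ⊤ := by
    refine ne_top_of_le_ne_top h3 (Module.length_le_of_injective
      ((P ⊓ Q).liftQ (P.mkQ.prod Q.mkQ) ?_) ?_)
    · rw [LinearMap.ker_prod, Submodule.ker_mkQ, Submodule.ker_mkQ]
    · rw [← LinearMap.ker_eq_bot]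
      refine Submodule.ker_liftQ_eq_bot _ _ _ ?_
      rw [LinearMap.ker_prod, Submodule.ker_mkQ, Submodule.ker_mkQ]
  rw [← h4]
  refine (len_le_of_surjective (Submodule.factor h) (Submodule.factor_surjective _) h5).trans
    (len_le_of_injective ((P ⊓ Q).liftQ (P.mkQ.prod Q.mkQ) ?_) ?_ h3)
  · rw [LinearMap.ker_prod, Submodule.ker_mkQ, Submodule.ker_mkQ]
  · rw [← LinearMap.ker_eq_bot]
    refine Submodule.ker_liftQ_eq_bot _ _ _ ?_
    rw [LinearMap.ker_prod, Submodule.ker_mkQ, Submodule.ker_mkQ]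

end HilbertSamuel

section Samuel

open Filter Asymptotics

variable {S : Type u} [CommRing S] [IsLocalRing S]

/-- `l` is a superficial sequence for `N`: each entry is superficial for the quotient of `N` by the
entries before it. -/
def IsSuperficialSeq : List S → (N : Type v) → [AddCommGroup N] → [Module S N] → Prop
  | [], _, _, _ => True
  | y :: l, N, _, _ => IsSuperficial y N ∧ IsSuperficialSeq l (QuotSMulTop y N)

theorem IsSuperficialSeq.mem_maximalIdeal {l : List S} : ∀ {N : Type v} [AddCommGroup N]
    [Module S N] (_ : IsSuperficialSeq l N), ∀ z ∈ l, z ∈ maximalIdeal S := by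
  induction l with
  | nil => intro N _ _ _ z hz; simp at hz
  | cons y l ih =>
    rintro N _ _ ⟨h1, h2⟩ z hz
    rcases List.mem_cons.mp hz with rfl | hz
    · exact h1.1
    · exact ih h2 z hz

/-- The classical form of superficiality: `(𝔫ᵏ⁺¹N : y) ∩ 𝔫ᶜN ⊆ 𝔫ᵏN` for large `k`. -/
theorem IsSuperficial.exists_colonPow_inf_le {y : S} {N : Type v} [AddCommGroup N] [Module S N]
    (h : IsSuperficial y N) : ∃ c, ∀ k ≥ c,
      colonPow y N (k + 1) ⊓ maximalIdeal S ^ c • ⊤ ≤ maximalIdeal S ^ k • ⊤ := by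
  obtain ⟨c, hc⟩ := h.2
  refine ⟨c, fun k hk => ?_⟩
  induction k, hk using Nat.le_induction with
  | base => exact inf_le_right
  | succ k hk ih =>
    rintro g ⟨hg1, hg2⟩
    exact hc k hk g (ih ⟨Submodule.smul_mono_left (Ideal.pow_le_pow_right (Nat.le_succ _)) hg1,
      hg2⟩) hg1

variable [IsNoetherianRing S] {N : Type v} [AddCommGroup N] [Module S N] [Module.Finite S N]

/-- By Krull's intersection theorem, a superficial element is a nonzerodivisor on `𝔫ᶜN` for
large `c`. -/
theorem torsionBy_inf_eq_bot {y : S} {c : ℕ} (hc : ∀ k ≥ c,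
      colonPow y N (k + 1) ⊓ maximalIdeal S ^ c • ⊤ ≤ maximalIdeal S ^ k • ⊤) :
    Submodule.torsionBy S N y ⊓ maximalIdeal S ^ c • ⊤ = ⊥ := by
  rw [eq_bot_iff, ← Ideal.iInf_pow_smul_eq_bot_of_isLocalRing (maximalIdeal S)
    (maximalIdeal.isMaximal S).ne_top, le_iInf_iff]
  intro k
  refine le_trans ?_ ((hc (c + k) (Nat.le_add_right _ _)).trans
    (Submodule.smul_mono_left (Ideal.pow_le_pow_right (Nat.le_add_left _ _))))
  refine inf_le_inf_right _ fun g hg => ?_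
  change y • g ∈ (maximalIdeal S ^ (c + k + 1) • ⊤ : Submodule S N)
  rw [(Submodule.mem_torsionBy_iff _ _).mp hg]
  exact zero_mem _

/-- A power of `𝔫` kills `0 :_N y`, so this module does not contribute to the symbol once a further
element is involved. -/
theorem symb_torsionBy_eq_zero {y : S} {l : List S} (hl : l ≠ [])
    (hlm : ∀ z ∈ l, z ∈ maximalIdeal S) {c : ℕ}
    (hc : Submodule.torsionBy S N y ⊓ maximalIdeal S ^ c • ⊤ = ⊥) (h : IsParam (y :: l) N) :
    symb l (Submodule.torsionBy S N y) = 0 := by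
  match l, hl with
  | z :: l, _ =>
    refine symb_cons_eq_zero h.torsionBy ⟨c, ?_⟩
    rw [Module.mem_annihilator]
    rintro ⟨g, hg⟩
    have : z ^ c • g ∈ Submodule.torsionBy S N y ⊓ maximalIdeal S ^ c • ⊤ :=
      ⟨Submodule.smul_mem _ _ hg, Submodule.smul_mem_smul
        (Ideal.pow_mem_pow (hlm z List.mem_cons_self) c) Submodule.mem_top⟩
    rw [hc, Submodule.mem_bot] at this
    exact Subtype.ext this

/-- A superficial parameter `y` on a module of dimension one satisfies `𝔫ᵏ⁺¹N = y𝔫ᵏN` for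
large `k`. -/
theorem eventually_pow_smul_le_smul {y : S} (h : IsSuperficial y N) (hp : IsParam [y] N) :
    ∀ᶠ k in atTop, (maximalIdeal S ^ (k + 1) • ⊤ : Submodule S N) ≤
      y • (maximalIdeal S ^ k • ⊤ : Submodule S N) := by
  obtain ⟨c, hc⟩ := h.exists_colonPow_inf_le
  obtain ⟨j, hj⟩ := Ideal.exists_pow_le_of_le_radical_of_fg hp
    (maximalIdeal S).fg_of_isNoetherianRing
  have hj' : (maximalIdeal S ^ j • ⊤ : Submodule S N) ≤ y • ⊤ := by
    rw [Submodule.smul_le]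
    intro r hr g _
    obtain ⟨a, ha, b, hb, rfl⟩ := Submodule.mem_sup.mp (hj hr)
    rw [Ideal.ofList_singleton, Ideal.mem_span_singleton'] at ha
    obtain ⟨a, rfl⟩ := ha
    rw [add_smul, Module.mem_annihilator.mp hb, add_zero, mul_comm, mul_smul]
    exact Submodule.smul_mem_pointwise_smul _ _ _ Submodule.mem_top
  obtain ⟨a, ha⟩ := Ideal.exists_pow_inf_eq_pow_smul (maximalIdeal S) (y • (⊤ : Submodule S N))
  filter_upwards [eventually_ge_atTop (a + c + j)] with k hk g hg
  have h1 : g ∈ (maximalIdeal S ^ (k + 1) • ⊤ : Submodule S N) ⊓ y • ⊤ :=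
    ⟨hg, hj' (Submodule.smul_mono_left (Ideal.pow_le_pow_right (by omega)) hg)⟩
  rw [ha (k + 1) (by omega)] at h1
  have h2 : g ∈ y • (maximalIdeal S ^ (k + 1 - a) • ⊤ : Submodule S N) := by
    have hle : maximalIdeal S ^ (k + 1 - a) • (maximalIdeal S ^ a • ⊤ ⊓ y • (⊤ : Submodule S N)) ≤
        maximalIdeal S ^ (k + 1 - a) • y • (⊤ : Submodule S N) := smul_mono_right _ inf_le_right
    have := hle h1
    rwa [show y • (⊤ : Submodule S N) = Submodule.map (DistribSMul.toLinearMap S N y) ⊤ from rfl,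
      ← Submodule.map_smul''] at this
  obtain ⟨g', hg', rfl⟩ := Submodule.mem_smul_pointwise_iff_exists _ _ _ |>.mp h2
  exact Submodule.smul_mem_pointwise_smul _ _ _ (hc k (by omega)
    ⟨hg, Submodule.smul_mono_left (Ideal.pow_le_pow_right (by omega)) hg'⟩)

theorem len_add_eq_hsFunction (k : ℕ) :
    len S ((maximalIdeal S ^ k • ⊤ : Submodule S N) ⧸ (maximalIdeal S ^ (k + 1) • ⊤ :
      Submodule S N).submoduleOf (maximalIdeal S ^ k • ⊤)) + hsFunction S N k =
      hsFunction S N (k + 1) := by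
  have hle : (maximalIdeal S ^ (k + 1) • ⊤ : Submodule S N) ≤ maximalIdeal S ^ k • ⊤ :=
    Submodule.smul_mono_left (Ideal.pow_le_pow_right (Nat.le_succ _))
  refine (len_eq_add_of_exact (Submodule.mapQ _ _ (Submodule.subtype _) le_rfl)
    (Submodule.factor hle) ?_ (Submodule.factor_surjective _) ?_
    (length_quotient_ne_top le_rfl)).symm
  · rw [← LinearMap.ker_eq_bot, Submodule.ker_mapQ]
    exact Submodule.mkQ_map_self _
  · rw [LinearMap.exact_iff, Submodule.range_mapQ, Submodule.range_subtype]
    exact Submodule.ker_mapQ _ _ _ _ |>.trans (by rw [Submodule.comap_id])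

/-- Samuel's theorem in dimension one: `𝔫ᵏN/𝔫ᵏ⁺¹N = 𝔫ᵏN/y𝔫ᵏN`, and `y` is a nonzerodivisor on `𝔫ᵏN`,
which has the same symbol as `N`. -/
theorem eventually_hsFunction_succ {y : S} (h : IsSuperficial y N) (hp : IsParam [y] N) :
    ∀ᶠ k in atTop, (hsFunction S N (k + 1) : ℤ) - hsFunction S N k = symb [y] N := by
  obtain ⟨c, hc⟩ := h.exists_colonPow_inf_le
  have hbot := torsionBy_inf_eq_bot hc
  filter_upwards [eventually_pow_smul_le_smul h hp, eventually_ge_atTop c] with k hk hkc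
  set P : Submodule S N := maximalIdeal S ^ k • ⊤ with hP
  have h1 : symb [y] N = symb [y] P := by
    rw [symb_eq_add_quotient [y] hp P, add_eq_left]
    refine symb_cons_eq_zero (hp.quotient P) ⟨k, ?_⟩
    rw [Module.mem_annihilator]
    intro m
    obtain ⟨m, rfl⟩ := P.mkQ_surjective m
    rw [← map_smul, Submodule.mkQ_apply, Submodule.Quotient.mk_eq_zero]
    exact Submodule.smul_mem_smul (Ideal.pow_mem_pow h.1 k) Submodule.mem_top
  have h2 : Subsingleton (Submodule.torsionBy S P y) := by
    refine subsingleton_of_forall_eq 0 fun g => ?_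
    have h3 : g.1.1 ∈ Submodule.torsionBy S N y ⊓ maximalIdeal S ^ c • ⊤ :=
      ⟨congrArg Subtype.val ((Submodule.mem_torsionBy_iff _ _).mp g.2),
        Submodule.smul_mono_left (Ideal.pow_le_pow_right hkc) g.1.2⟩
    rw [hbot, Submodule.mem_bot] at h3
    exact Subtype.ext (Subtype.ext h3)
  have h4 : y • (⊤ : Submodule S P) =
      (maximalIdeal S ^ (k + 1) • ⊤ : Submodule S N).submoduleOf P := by
    ext g
    rw [Submodule.mem_smul_pointwise_iff_exists]
    constructor
    · rintro ⟨g', -, rfl⟩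
      exact pow_smul_le_colonPow h.1 k g'.2
    · intro hg
      obtain ⟨g', hg', hgg⟩ := (Submodule.mem_smul_pointwise_iff_exists _ _ _).mp (hk hg)
      exact ⟨⟨g', hg'⟩, Submodule.mem_top, Subtype.ext hgg⟩
  have h5 := len_add_eq_hsFunction (S := S) (N := N) k
  rw [h1, symb_cons, symb_nil, symb_of_subsingleton [] (Submodule.torsionBy S P y), sub_zero,
    ← h5, len_congr (Submodule.quotEquivOfEq _ _ h4)]
  push_cast
  ring

theorem multichoose_succ_sub (k d : ℕ) :
    ((k + 1).multichoose (d + 1) : ℝ) - (k.multichoose (d + 1) : ℝ) =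
      ((k + 1).multichoose d : ℝ) := by
  rw [Nat.multichoose_succ_succ]
  push_cast
  ring

/-- Samuel's theorem for a superficial sequence of parameters: the multiplicity symbol is the
leading coefficient of the Hilbert–Samuel function. The step from `N/yN` to `N` sums the function of
`N/yN` up to a bounded error, and `0 :_N y` contributes to the symbol only in dimension one. The
basis `multichoose` of the polynomials is the one for which this summation is exact. -/
theorem hsFunction_sub_isLittleO (l : List S) : ∀ (N : Type v) [AddCommGroup N] [Module S N]
    [Module.Finite S N] (_ : IsSuperficialSeq l N) (_ : IsParam l N),
    (fun k => (hsFunction S N k : ℝ) - (symb l N : ℝ) * (k.multichoose l.length : ℝ)) =o[atTop]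
      fun k : ℕ => (k : ℝ) ^ l.length := by
  induction l with
  | nil =>
    intro N _ _ _ _ hp
    obtain ⟨K, hK⟩ := Ideal.exists_pow_le_of_le_radical_of_fg hp
      (maximalIdeal S).fg_of_isNoetherianRing
    rw [Ideal.ofList_nil, bot_sup_eq] at hK
    refine (isLittleO_zero _ _).congr' ?_ EventuallyEq.rfl
    filter_upwards [eventually_ge_atTop K] with k hk
    have : (maximalIdeal S ^ k • ⊤ : Submodule S N) = ⊥ := by
      rw [eq_bot_iff, Submodule.smul_le]
      intro r hr g _
      exact Module.mem_annihilator.mp (hK (Ideal.pow_le_pow_right hk hr)) g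
    rw [hsFunction, len_congr (Submodule.quotEquivOfEqBot _ this), symb_nil]
    simp
  | cons y l ih =>
    rintro N _ _ _ ⟨hy, hl⟩ hp
    refine isLittleO_of_sub_isLittleO ?_
    by_cases hl0 : l = []
    · subst hl0
      refine (isLittleO_zero _ _).congr' ?_ EventuallyEq.rfl
      filter_upwards [eventually_hsFunction_succ hy hp] with k hk
      have h1 := multichoose_succ_sub k 0
      have h2 : (hsFunction S N (k + 1) : ℝ) - hsFunction S N k = (symb [y] N : ℝ) := by
        exact_mod_cast hk
      rw [Nat.multichoose_zero_right, Nat.cast_one] at h1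
      simp only [List.length_cons, List.length_nil]
      linear_combination (symb [y] N : ℝ) * h1 - h2
    -- With `l` nonempty, the bounded error `length((𝔫ᵏ⁺¹N : y)/𝔫ᵏN)` is negligible.
    · obtain ⟨c, hc⟩ := hy.exists_colonPow_inf_le
      have hzero := symb_torsionBy_eq_zero hl0 hl.mem_maximalIdeal (torsionBy_inf_eq_bot hc) hp
      have h1 := (ih _ hl hp.quotSMulTop).comp_tendsto (tendsto_add_atTop_nat 1)
      have h2 : (fun k : ℕ => (hsFunction S N k : ℝ) - len S (N ⧸ colonPow y N (k + 1))) =o[atTop]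
          fun k : ℕ => ((k + 1 : ℕ) : ℝ) ^ l.length := by
        have hb : (fun k : ℕ => (hsFunction S N k : ℝ) - len S (N ⧸ colonPow y N (k + 1)))
            =O[atTop] fun _ : ℕ => (1 : ℝ) := by
          refine IsBigO.of_bound (hsFunction S N c) ?_
          filter_upwards [eventually_ge_atTop c] with k hk
          have h3 : (len S (N ⧸ colonPow y N (k + 1)) : ℝ) ≤ hsFunction S N k := by
            exact_mod_cast len_colonPow_le hy.1 k
          have h4 : (hsFunction S N k : ℝ) ≤
              len S (N ⧸ colonPow y N (k + 1)) + hsFunction S N c := by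
            exact_mod_cast hsFunction_le_len_add
              (pow_smul_le_colonPow hy.1 k |>.trans' <| Submodule.smul_mono_left
                (Ideal.pow_le_pow_right (Nat.le_succ _))) (hc k hk)
          rw [Real.norm_of_nonneg (by linarith), norm_one, mul_one]
          linarith
        refine hb.trans_isLittleO ?_
        refine isLittleO_const_left.mpr (Or.inr (tendsto_norm_atTop_atTop.comp
          ((tendsto_pow_atTop (by simpa using hl0)).comp
            (tendsto_natCast_atTop_atTop.comp (tendsto_add_atTop_nat 1)))))
      refine (h1.sub h2).congr (fun k => ?_) (fun k => rfl)
      have h5 : (hsFunction S N (k + 1) : ℝ) = len S (N ⧸ colonPow y N (k + 1)) +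
          hsFunction S (QuotSMulTop y N) (k + 1) := by
        exact_mod_cast hsFunction_eq_add_quotSMulTop y (k + 1)
      have h6 := multichoose_succ_sub k l.length
      simp only [comp_apply, List.length_cons]
      rw [symb_cons, hzero, sub_zero]
      linear_combination -h5 + (symb l (QuotSMulTop y N) : ℝ) * h6

end Samuel

/-! ### Linking a system of parameters to a superficial one -/

section Linking

variable {S : Type u} [CommRing S] [IsLocalRing S] [IsNoetherianRing S]

/-- If `J + (a)` is primary to the maximal ideal, then so is `J + (y)` for every `y` outside those
minimal primes of `J` that are not maximal: by Krull's principal ideal theorem, modulo such a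
minimal prime `P` the maximal ideal has height at most one, so no prime lies strictly between. -/
theorem maximalIdeal_le_radical_sup_span {J : Ideal S} {a y : S} (ha : a ∈ maximalIdeal S)
    (hJ : maximalIdeal S ≤ (J ⊔ Ideal.span {a}).radical)
    (hy : ∀ P ∈ J.minimalPrimes, ¬ maximalIdeal S ≤ P → y ∉ P) :
    maximalIdeal S ≤ (J ⊔ Ideal.span {y}).radical := by
  rw [Ideal.radical_eq_sInf]
  refine le_sInf ?_
  rintro q ⟨hq, hqp⟩
  obtain ⟨P, hP, hPq⟩ := Ideal.exists_minimalPrimes_le (le_sup_left.trans hq)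
  by_cases hmP : maximalIdeal S ≤ P
  · exact hmP.trans hPq
  have hyP := hy P hP hmP
  have hyq : y ∈ q := hq (Ideal.mem_sup_right (Ideal.mem_span_singleton_self y))
  have hPp : P.IsPrime := hP.1.1
  by_contra hmq
  have hPm : P ≤ maximalIdeal S := le_maximalIdeal hPp.ne_top
  have hqm : q ≤ maximalIdeal S := le_maximalIdeal hqp.ne_top
  have hmin : maximalIdeal S ∈ (P ⊔ Ideal.span {a}).minimalPrimes := by
    refine ⟨⟨inferInstance, sup_le hPm ((Ideal.span_singleton_le_iff_mem _).mpr ha)⟩, ?_⟩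
    rintro Q ⟨hQ, hQP⟩ -
    exact hJ.trans (hQ.radical_le_iff.mpr ((sup_le_sup_right hP.1.2 _).trans hQP))
  have hht := Ideal.map_height_le_one_of_mem_minimalPrimes hmin
  have hker : RingHom.ker (Ideal.Quotient.mk P) ≤ q := by rwa [Ideal.mk_ker]
  have hker' : RingHom.ker (Ideal.Quotient.mk P) ≤ maximalIdeal S := by rwa [Ideal.mk_ker]
  have hq' : (q.map (Ideal.Quotient.mk P)).IsPrime :=
    Ideal.map_isPrime_of_surjective Ideal.Quotient.mk_surjective hker
  have hm' : ((maximalIdeal S).map (Ideal.Quotient.mk P)).IsPrime :=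
    Ideal.map_isPrime_of_surjective Ideal.Quotient.mk_surjective hker'
  have h1 : (⊥ : Ideal (S ⧸ P)) < q.map (Ideal.Quotient.mk P) := by
    rw [bot_lt_iff_ne_bot, Ne, Ideal.map_eq_bot_iff_le_ker, Ideal.mk_ker]
    exact fun h => hyP (h hyq)
  have h2 : q.map (Ideal.Quotient.mk P) < (maximalIdeal S).map (Ideal.Quotient.mk P) := by
    refine lt_of_le_not_ge (Ideal.map_mono hqm) fun h => hmq ?_
    have := Ideal.comap_mono (f := Ideal.Quotient.mk P) h
    rwa [Ideal.comap_map_of_surjective' _ Ideal.Quotient.mk_surjective,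
      Ideal.comap_map_of_surjective' _ Ideal.Quotient.mk_surjective, sup_eq_left.mpr hker,
      sup_eq_left.mpr hker'] at this
  have h3 := Ideal.height_add_one_le_of_lt_of_isPrime h1
  have h4 := Ideal.height_add_one_le_of_lt_of_isPrime h2
  have h5 : (1 : ℕ∞) + 1 ≤ 1 :=
    calc (1 : ℕ∞) + 1 ≤ (Ideal.height (⊥ : Ideal (S ⧸ P)) + 1) + 1 := by gcongr; exact le_add_self
      _ ≤ _ := (add_le_add_left h3 1).trans h4
      _ ≤ 1 := hht
  exact absurd h5 (by decide)

/-- A system of parameters `x` can be replaced, one entry at a time, by a superficial one whose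
defect is bounded by a multiple of that of `x`, uniformly in the module. -/
theorem exists_isSuperficialSeq_defect_le [Infinite (ResidueField S)] (x : List S) :
    ∀ (p : List S) (N : Type v) [AddCommGroup N] [Module S N] [Module.Finite S N]
      (_ : ∀ z ∈ x, z ∈ maximalIdeal S) (_ : maximalIdeal S ≤ (Ideal.ofList (p ++ x)).radical),
      ∃ y : List S, y.length = x.length ∧ IsSuperficialSeq y N ∧
        maximalIdeal S ≤ (Ideal.ofList (p ++ y)).radical ∧
        ∃ c : ℕ, ∀ (M : Type w) [AddCommGroup M] [Module S M] [Module.Finite S M],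
          defect (p ++ y) M ≤ c * defect (p ++ x) M := by
  classical
  induction x using List.reverseRecOn with
  | nil => exact fun p N _ _ _ _ hp => ⟨[], rfl, trivial, hp, 1, fun M _ _ _ => by simp⟩
  | append_singleton x a ih =>
    intro p N _ _ _ hx hp
    have ha : a ∈ maximalIdeal S := hx a (by simp)
    rw [← List.append_assoc] at hp
    have hfin : (Ideal.ofList (p ++ x)).minimalPrimes.Finite :=
      Ideal.finite_minimalPrimes_of_isNoetherianRing S _
    obtain ⟨y₁, hy₁, hV⟩ := exists_isSuperficial N
      (hfin.toFinset.filter fun J => ¬ maximalIdeal S ≤ J) (fun J hJ => (Finset.mem_filter.mp hJ).2)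
    have hp1 : maximalIdeal S ≤ (Ideal.ofList ((p ++ x) ++ [y₁])).radical := by
      rw [Ideal.ofList_append, Ideal.ofList_singleton] at hp ⊢
      exact maximalIdeal_le_radical_sup_span ha hp fun P hP hPm =>
        hV P (Finset.mem_filter.mpr ⟨hfin.mem_toFinset.mpr hP, hPm⟩)
    have hperm : ((p ++ x) ++ [y₁]).Perm ((p ++ [y₁]) ++ x) := by
      rw [List.append_assoc, List.append_assoc]
      exact List.perm_append_comm.append_left p
    have hp2 : maximalIdeal S ≤ (Ideal.ofList ((p ++ [y₁]) ++ x)).radical :=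
      hp1.trans (Ideal.radical_mono (Ideal.span_mono fun _ h => hperm.subset h))
    obtain ⟨y, hlen, hsup, hrad, c, hc⟩ := ih (p ++ [y₁]) (QuotSMulTop y₁ N)
      (fun z hz => hx z (List.mem_append_left _ hz)) hp2
    obtain ⟨c', hc'⟩ := exists_defect_append_le ha hp hp1
    rw [List.append_assoc, List.singleton_append] at hrad
    refine ⟨y₁ :: y, by simp [hlen], ⟨hy₁, hsup⟩, hrad, c * c', fun M _ _ _ => ?_⟩
    have h1 := hc M
    rw [← defect_perm hperm (isParam_of_le_radical hp1 M), List.append_assoc,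
      List.singleton_append] at h1
    rw [← List.append_assoc]
    calc defect (p ++ y₁ :: y) M ≤ c * defect ((p ++ x) ++ [y₁]) M := h1
      _ ≤ c * (c' * defect ((p ++ x) ++ [a]) M) := by gcongr; exact hc' M
      _ = _ := by push_cast; ring

end Linking

/-! ### Flat base change -/

section BaseChange

open scoped TensorProduct

variable {R : Type*} [CommRing R] (S : Type*) [CommRing S] [Algebra R S] [Module.Flat R S]

/-- The elements killed by `r` commute with flat base change. -/
noncomputable def tensorTorsionByEquiv (r : R) (M : Type*) [AddCommGroup M] [Module R M] :
    S ⊗[R] Submodule.torsionBy R M r ≃ₗ[S] Submodule.torsionBy S (S ⊗[R] M) (algebraMap R S r) :=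
  (LinearMap.tensorKerEquiv S S (DistribSMul.toLinearMap R M r)).trans <|
    LinearEquiv.ofEq _ _ <| by
      ext z
      rw [LinearMap.mem_ker, Submodule.mem_torsionBy_iff]
      suffices h : TensorProduct.AlgebraTensorModule.lTensor S S (DistribSMul.toLinearMap R M r) z =
          algebraMap R S r • z by rw [h]
      rw [algebraMap_smul]
      induction z with
      | zero => simp
      | tmul s m => simp
      | add a b ha hb => rw [map_add, ha, hb, smul_add]

variable [IsLocalRing R] [IsLocalRing S] [IsLocalHom (algebraMap R S)]

theorem len_baseChange (M : Type*) [AddCommGroup M] [Module R M] :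
    len S (S ⊗[R] M) = len R M * len S (S ⧸ (maximalIdeal R).map (algebraMap R S)) := by
  rw [len, IsLocalRing.length_baseChange, ENat.toNat_mul, len, len]

theorem symb_baseChange (l : List R) : ∀ (M : Type u) [AddCommGroup M] [Module R M],
    symb (l.map (algebraMap R S)) (S ⊗[R] M) =
      symb l M * len S (S ⧸ (maximalIdeal R).map (algebraMap R S)) := by
  induction l with
  | nil => intro M _ _; rw [List.map_nil, symb_nil, symb_nil, len_baseChange]; push_cast; rfl
  | cons x l ih =>
    intro M _ _
    have h1 := symb_congr (l.map (algebraMap R S))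
      (QuotSMulTop.algebraMapTensorEquivTensorQuotSMulTop x M S)
    have h2 : symb (l.map (algebraMap R S)) (S ⊗[R] Submodule.torsionBy R M x) =
        symb (l.map (algebraMap R S)) (Submodule.torsionBy S (S ⊗[R] M) (algebraMap R S x)) :=
      symb_congr _ (tensorTorsionByEquiv S x M)
    rw [List.map_cons, symb_cons, symb_cons, sub_mul, ← ih (QuotSMulTop x M),
      ← ih (Submodule.torsionBy R M x), h1, h2]

theorem defect_baseChange (l : List R) (M : Type u) [AddCommGroup M] [Module R M] :
    defect (l.map (algebraMap R S)) (S ⊗[R] M) =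
      defect l M * len S (S ⧸ (maximalIdeal R).map (algebraMap R S)) := by
  have h : len S ((S ⊗[R] M) ⧸ (Ideal.ofList (l.map (algebraMap R S)) • ⊤ :
      Submodule S (S ⊗[R] M))) = len R (M ⧸ (Ideal.ofList l • ⊤ : Submodule R M)) *
        len S (S ⧸ (maximalIdeal R).map (algebraMap R S)) := by
    rw [← len_baseChange, ← Ideal.map_ofList]
    exact len_congr (TensorProduct.tensorQuotMapSMulEquivTensorQuot M S (Ideal.ofList l))
  rw [defect, defect, h, symb_baseChange, sub_mul]
  push_cast
  rfl

/-- A flat local extension with `𝔪S = 𝔫` preserves Hilbert–Samuel functions. -/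
theorem hsFunction_eq_of_map_maximalIdeal
    (h : (maximalIdeal R).map (algebraMap R S) = maximalIdeal S) (k : ℕ) :
    hsFunction S S k = hsFunction R R k := by
  have h1 : len S (S ⧸ maximalIdeal S) = 1 := by
    have : IsSimpleModule S (S ⧸ maximalIdeal S) :=
      isSimpleModule_iff_isCoatom.mpr (maximalIdeal.isMaximal S).out
    rw [len, Module.length_eq_one]
    rfl
  have h2 := len_baseChange (R := R) S (R ⧸ maximalIdeal R ^ k)
  rw [h, h1, mul_one] at h2
  rw [hsFunction, hsFunction, len_congr (Submodule.quotEquivOfEq _ (maximalIdeal S ^ k)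
      (by rw [smul_eq_mul, Ideal.mul_top])), len_congr (Submodule.quotEquivOfEq _
      (maximalIdeal R ^ k) (by rw [smul_eq_mul, Ideal.mul_top])), ← h2, ← h, ← Ideal.map_pow]
  exact len_congr (Algebra.TensorProduct.quotIdealMapEquivTensorQuot S _).toLinearEquiv

end BaseChange

/-! ### Enlarging the residue field -/

section ResidueExtension

open Polynomial

variable (S : Type u) [CommRing S] [IsLocalRing S]

/-- The ideal `𝔫S[X]`. -/
noncomputable abbrev polyMaximal : Ideal S[X] := (maximalIdeal S).map C

instance isPrime_polyMaximal : (polyMaximal S).IsPrime :=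
  Ideal.isPrime_map_C_of_isPrime

/-- The local ring `S(X)`, the localization of `S[X]` at `𝔫S[X]`. -/
noncomputable abbrev RatExtension : Type u := Localization.AtPrime (polyMaximal S)

theorem map_maximalIdeal_ratExtension :
    (maximalIdeal S).map (algebraMap S (RatExtension S)) = maximalIdeal (RatExtension S) := by
  rw [IsScalarTower.algebraMap_eq S S[X] (RatExtension S), ← Ideal.map_map]
  exact Localization.AtPrime.map_eq_maximalIdeal

instance isLocalHom_ratExtension : IsLocalHom (algebraMap S (RatExtension S)) :=
  ((local_hom_TFAE _).out 2 0).mp (map_maximalIdeal_ratExtension S).le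

instance flat_ratExtension : Module.Flat S (RatExtension S) :=
  have : Module.Flat S[X] (RatExtension S) := IsLocalization.flat _ (polyMaximal S).primeCompl
  Module.Flat.trans S S[X] (RatExtension S)

instance infinite_residueField_ratExtension : Infinite (ResidueField (RatExtension S)) := by
  refine Infinite.of_injective
    (fun i : ℕ => residue (RatExtension S) (algebraMap S[X] (RatExtension S) (X ^ i))) ?_
  intro i j hij
  by_contra hne
  have h1 : algebraMap S[X] (RatExtension S) (X ^ i - X ^ j) ∈ maximalIdeal (RatExtension S) := by
    rw [← residue_eq_zero_iff, map_sub, map_sub, sub_eq_zero]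
    exact hij
  have h2 : (X ^ i - X ^ j : S[X]) ∈ polyMaximal S :=
    (IsLocalization.AtPrime.to_map_mem_maximal_iff (RatExtension S) (polyMaximal S) _).mp h1
  have h3 := Ideal.mem_map_C_iff.mp h2 i
  rw [coeff_sub, coeff_X_pow_self, coeff_X_pow, if_neg hne, sub_zero] at h3
  exact (Ideal.ne_top_iff_one _).mp (maximalIdeal.isMaximal S).ne_top h3

end ResidueExtension

/-! ### Modules over a domain up to torsion -/

section Rank

variable {R : Type*} [CommRing R]

/-- A finitely generated module over a domain contains a free module with torsion cokernel. -/
theorem exists_injective_smul_mem_range [IsDomain R] (U : Type*) [AddCommGroup U] [Module R U]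
    [Module.Finite R U] :
    ∃ (r : ℕ) (i : (Fin r → R) →ₗ[R] U) (f : R), Injective i ∧ f ≠ 0 ∧
      ∀ u : U, f • u ∈ LinearMap.range i := by
  obtain ⟨v, hv⟩ := exists_linearIndependent_of_le_finrank (R := R) (M := U) le_rfl
  refine ⟨Module.finrank R U, Fintype.linearCombination R v, ?_⟩
  have htors : Module.IsTorsion R (U ⧸ Submodule.span R (Set.range v)) := by
    intro q
    obtain ⟨u, rfl⟩ := Submodule.mkQ_surjective _ q
    suffices h : ∃ a : R, a ≠ 0 ∧ a • u ∈ Submodule.span R (Set.range v) by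
      obtain ⟨a, ha, h⟩ := h
      refine ⟨⟨a, mem_nonZeroDivisors_of_ne_zero ha⟩, ?_⟩
      exact (Submodule.Quotient.mk_eq_zero _).mpr h
    by_contra! hcon
    have := (hv.finCons' u v (fun c y hy hcy => by
      by_contra hc
      refine hcon c hc ?_
      rw [eq_neg_of_add_eq_zero_left hcy]
      exact neg_mem hy)).fintype_card_le_finrank
    rw [Fintype.card_fin] at this
    omega
  obtain ⟨f, hf, hf0⟩ := Submodule.annihilator_top_inter_nonZeroDivisors htors
  refine ⟨f, ?_, nonZeroDivisors.ne_zero hf0, fun u => ?_⟩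
  · exact hv.fintypeLinearCombination_injective
  · rw [Fintype.range_linearCombination]
    have := Submodule.mem_annihilator.mp hf (Submodule.mkQ _ u) Submodule.mem_top
    rw [← map_smul] at this
    exact (Submodule.Quotient.mk_eq_zero _).mp this

/-- A finitely generated module killed by `f` is a quotient of some `(R/f)ˢ`. -/
theorem exists_surjective_quotSMulTop (f : R) {T : Type*} [AddCommGroup T] [Module R T]
    [Module.Finite R T] (hf : ∀ t : T, f • t = 0) :
    ∃ (s : ℕ) (p : (Fin s → QuotSMulTop f R) →ₗ[R] T), Surjective p := by
  obtain ⟨s, g, hg⟩ := Module.Finite.exists_fin' R T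
  have hle : f • (⊤ : Submodule R R) ≤ ⨅ j : Fin s, LinearMap.ker
      (g.comp (LinearMap.single R (fun _ : Fin s => R) j)) := by
    refine le_iInf fun j => ?_
    intro a ha
    obtain ⟨a, -, rfl⟩ := (Submodule.mem_smul_pointwise_iff_exists _ _ _).mp ha
    rw [LinearMap.mem_ker, map_smul, hf]
  let p : (Fin s → QuotSMulTop f R) →ₗ[R] T := ∑ j : Fin s,
    ((f • (⊤ : Submodule R R)).liftQ (g.comp (LinearMap.single R (fun _ : Fin s => R) j))
      (hle.trans (iInf_le _ j))).comp (LinearMap.proj j)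
  refine ⟨s, p, fun t => ?_⟩
  obtain ⟨a, rfl⟩ := hg t
  refine ⟨fun j => Submodule.Quotient.mk (a j), ?_⟩
  rw [LinearMap.sum_apply]
  conv_rhs => rw [← LinearMap.sum_single_apply (fun _ : Fin s => R) a, map_sum]
  rfl

theorem exact_single_funLeft (s : ℕ) (M : Type*) [AddCommGroup M] [Module R M] :
    Exact (LinearMap.single R (fun _ : Fin (s + 1) => M) 0) (LinearMap.funLeft R M Fin.succ) := by
  intro m
  constructor
  · intro hm
    refine ⟨m 0, funext fun j => ?_⟩
    refine Fin.cases ?_ (fun j => ?_) j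
    · simp
    · simpa using (congrFun hm j).symm
  · rintro ⟨m, rfl⟩
    funext j
    simp [LinearMap.funLeft]

end Rank

section RankSymbol

variable {R : Type*} [CommRing R] [IsLocalRing R] [IsNoetherianRing R]

theorem symb_pi (l : List R) (s : ℕ) (M : Type u) [AddCommGroup M] [Module R M] [Module.Finite R M]
    (h : IsParam l M) : symb l (Fin s → M) = s * symb l M := by
  induction s with
  | zero => rw [symb_of_subsingleton]; simp
  | succ s ih =>
    have hp : IsParam l (Fin (s + 1) → M) := by
      refine h.of_annihilator_le fun a ha => Module.mem_annihilator.mpr fun m => funext fun j => ?_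
      exact Module.mem_annihilator.mp ha _
    have hinj : Injective (LinearMap.single R (fun _ : Fin (s + 1) => M) 0) :=
      Pi.single_injective (M := fun _ : Fin (s + 1) => M) 0
    have := symb_eq_add_of_exact l _ _ hinj
      (LinearMap.funLeft_surjective_of_injective R M _ (Fin.succ_injective s))
      (exact_single_funLeft s M) hp
    rw [this, ih]
    push_cast
    ring

/-- The symbol of a module killed by a nonzerodivisor of the ring is zero. -/
theorem symb_eq_zero_of_smul_eq_zero {l : List R} (hl : maximalIdeal R ≤ (Ideal.ofList l).radical)
    {f : R} (hf : IsSMulRegular R f) {T : Type v} [AddCommGroup T] [Module R T] [Module.Finite R T]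
    (hT : ∀ t : T, f • t = 0) : symb l T = 0 := by
  have h1 : symb l (QuotSMulTop f R) = 0 := by
    have := symb_eq_add_of_exact l (DistribSMul.toLinearMap R R f)
      (Submodule.mkQ (f • (⊤ : Submodule R R))) hf (Submodule.mkQ_surjective _) (by
        rw [LinearMap.exact_iff, Submodule.ker_mkQ]
        ext a
        simp [Submodule.mem_smul_pointwise_iff_exists]) (isParam_of_le_radical hl R)
    linarith
  obtain ⟨s, p, hp⟩ := exists_surjective_quotSMulTop f hT
  have h2 := symb_eq_add_of_exact l (LinearMap.ker p).subtype p (Submodule.subtype_injective _) hp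
    (LinearMap.exact_subtype_ker_map p) (isParam_of_le_radical hl _)
  rw [symb_pi l s _ (isParam_of_le_radical hl _), h1, mul_zero] at h2
  have h3 := symb_nonneg l (isParam_of_le_radical hl (LinearMap.ker p))
  have h4 := symb_nonneg l (isParam_of_le_radical hl T)
  linarith

end RankSymbol

section RankHilbert

open Filter

theorem pow_smul_top_le_comap {R : Type*} [CommRing R] {M N : Type*} [AddCommGroup M] [Module R M]
    [AddCommGroup N] [Module R N] (I : Ideal R) (g : M →ₗ[R] N) :
    (I • ⊤ : Submodule R M) ≤ (I • ⊤ : Submodule R N).comap g := by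
  rw [← Submodule.map_le_iff_le_comap, Submodule.map_smul'']
  exact smul_mono_right _ le_top

variable {R : Type*} [CommRing R] [IsLocalRing R] [IsNoetherianRing R]

theorem hsFunction_le_of_surjective {M N : Type*} [AddCommGroup M] [Module R M] [Module.Finite R M]
    [AddCommGroup N] [Module R N] (g : M →ₗ[R] N) (hg : Surjective g) (k : ℕ) :
    hsFunction R N k ≤ hsFunction R M k := by
  refine len_le_of_surjective (Submodule.mapQ _ _ g (pow_smul_top_le_comap _ g)) ?_
    (length_quotient_ne_top le_rfl)
  rw [← LinearMap.range_eq_top, Submodule.range_mapQ, LinearMap.range_eq_top.mpr hg,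
    Submodule.map_top, Submodule.range_mkQ]

theorem hsFunction_le_add {A B C : Type*} [AddCommGroup A] [Module R A] [Module.Finite R A]
    [AddCommGroup B] [Module R B] [Module.Finite R B] [AddCommGroup C] [Module R C]
    (f : A →ₗ[R] B) (g : B →ₗ[R] C) (H : Exact f g) (hg : Surjective g) (k : ℕ) :
    hsFunction R B k ≤ hsFunction R A k + hsFunction R C k := by
  set I := maximalIdeal R ^ k
  set f' := Submodule.mapQ _ _ f (pow_smul_top_le_comap I f) with hf'
  set g' := Submodule.mapQ _ _ g (pow_smul_top_le_comap I g) with hg'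
  have hg'' : Surjective g' := by
    rw [← LinearMap.range_eq_top, Submodule.range_mapQ, LinearMap.range_eq_top.mpr hg,
      Submodule.map_top, Submodule.range_mkQ]
  have hex : Exact (LinearMap.range f').subtype g' := by
    rw [LinearMap.exact_iff, Submodule.range_subtype, Submodule.ker_mapQ, Submodule.range_mapQ]
    have h1 : (I • ⊤ : Submodule R C) = (I • ⊤ : Submodule R B).map g := by
      rw [Submodule.map_smul'', Submodule.map_top, LinearMap.range_eq_top.mpr hg]
    rw [h1, Submodule.comap_map_eq, Submodule.map_sup, Submodule.mkQ_map_self, bot_sup_eq,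
      LinearMap.exact_iff.mp H]
  have h2 := len_eq_add_of_exact (LinearMap.range f').subtype g' (Submodule.subtype_injective _)
    hg'' hex (length_quotient_ne_top le_rfl)
  have h3 := len_le_of_surjective f'.rangeRestrict f'.surjective_rangeRestrict
    (length_quotient_ne_top (N := A) (k := k) le_rfl)
  rw [hsFunction, h2]
  exact Nat.add_le_add_right h3 _

theorem hsFunction_pi_le (s : ℕ) (M : Type*) [AddCommGroup M] [Module R M] [Module.Finite R M]
    (k : ℕ) : hsFunction R (Fin s → M) k ≤ s * hsFunction R M k := by
  induction s with
  | zero =>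
    have h : len R ((Fin 0 → M) ⧸ (maximalIdeal R ^ k • ⊤ : Submodule R (Fin 0 → M))) = 0 := by
      rw [len, Module.length_eq_zero]
      rfl
    exact h.le.trans (Nat.zero_le _)
  | succ s ih =>
    refine (hsFunction_le_add _ _ (exact_single_funLeft s M)
      (LinearMap.funLeft_surjective_of_injective R M _ (Fin.succ_injective s)) k).trans ?_
    rw [add_mul, one_mul, add_comm]
    exact Nat.add_le_add_right ih _

theorem mul_hsFunction_le_pi (s : ℕ) (M : Type*) [AddCommGroup M] [Module R M] [Module.Finite R M]
    (k : ℕ) : s * hsFunction R M k ≤ hsFunction R (Fin s → M) k := by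
  set P : Submodule R M := maximalIdeal R ^ k • ⊤
  let g : (Fin s → M) →ₗ[R] Fin s → M ⧸ P := LinearMap.pi fun j => P.mkQ.comp (LinearMap.proj j)
  have hg : Surjective g := fun q =>
    ⟨fun j => (P.mkQ_surjective (q j)).choose, funext fun j => (P.mkQ_surjective (q j)).choose_spec⟩
  have hle : (maximalIdeal R ^ k • ⊤ : Submodule R (Fin s → M)) ≤ LinearMap.ker g := by
    intro m hm
    rw [LinearMap.mem_ker]
    funext j
    exact (Submodule.Quotient.mk_eq_zero _).mpr
      (pow_smul_top_le_comap (maximalIdeal R ^ k)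
        (LinearMap.proj (R := R) (φ := fun _ : Fin s => M) j) hm)
  have h1 := len_le_of_surjective (Submodule.liftQ _ g hle)
    (LinearMap.range_eq_top.mp (by rw [Submodule.range_liftQ, LinearMap.range_eq_top.mpr hg]))
    (length_quotient_ne_top (N := Fin s → M) (k := k) le_rfl)
  refine le_trans (le_of_eq ?_) h1
  rw [len, Module.length_pi_of_fintype, Finset.sum_const, Finset.card_univ, Fintype.card_fin,
    nsmul_eq_mul, ENat.toNat_mul, ENat.toNat_natCast]
  rfl

/-- If `f` is a nonzerodivisor, then `R/f` has a Hilbert–Samuel function of smaller growth: by the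
Artin–Rees lemma it is at most `h(k) - h(k - c)`, where `h` is that of `R`. -/
theorem exists_hsFunction_quotSMulTop_le {f : R} (hf : IsSMulRegular R f) :
    ∃ c, ∀ k ≥ c, hsFunction R (QuotSMulTop f R) k + hsFunction R R (k - c) ≤ hsFunction R R k := by
  obtain ⟨c, hc⟩ := Ideal.exists_pow_inf_eq_pow_smul (maximalIdeal R) (f • (⊤ : Submodule R R))
  refine ⟨c, fun k hk => ?_⟩
  have hle : colonPow f R k ≤ maximalIdeal R ^ (k - c) • ⊤ := by
    intro a ha
    have h1 : f • a ∈ (maximalIdeal R ^ k • ⊤ : Submodule R R) ⊓ f • ⊤ :=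
      ⟨ha, Submodule.smul_mem_pointwise_smul _ _ _ Submodule.mem_top⟩
    rw [hc k hk] at h1
    have hle : maximalIdeal R ^ (k - c) • (maximalIdeal R ^ c • ⊤ ⊓ f • (⊤ : Submodule R R)) ≤
        maximalIdeal R ^ (k - c) • f • (⊤ : Submodule R R) := smul_mono_right _ inf_le_right
    have h2 := hle h1
    rw [show f • (⊤ : Submodule R R) = Submodule.map (DistribSMul.toLinearMap R R f) ⊤ from rfl,
      ← Submodule.map_smul''] at h2
    obtain ⟨b, hb, hab⟩ := h2
    rwa [← hf hab]
  have h1 := len_le_of_surjective (Submodule.factor hle) (Submodule.factor_surjective _)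
    (length_quotient_ne_top (N := R) (k := k) fun a ha => Submodule.smul_mem _ f ha)
  have h2 := hsFunction_eq_add_quotSMulTop (N := R) f k
  rw [h2, add_comm]
  exact Nat.add_le_add_right h1 _

theorem tendsto_hsFunction_quotSMulTop {f : R} (hf : IsSMulRegular R f) {d : ℕ} {e : ℝ}
    (h : Tendsto (fun k : ℕ => (d.factorial : ℝ) * (hsFunction R R k : ℝ) / (k : ℝ) ^ d) atTop
      (nhds e)) :
    Tendsto (fun k : ℕ => (d.factorial : ℝ) * (hsFunction R (QuotSMulTop f R) k : ℝ) / (k : ℝ) ^ d)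
      atTop (nhds 0) := by
  obtain ⟨c, hc⟩ := exists_hsFunction_quotSMulTop_le hf
  have h1 : Tendsto (fun k : ℕ => ((k - c : ℕ) : ℝ) / k) atTop (nhds 1) := by
    have h2 : Tendsto (fun k : ℕ => 1 - (c : ℝ) / k) atTop (nhds (1 - 0)) :=
      tendsto_const_nhds.sub (tendsto_const_div_atTop_nhds_zero_nat _)
    rw [sub_zero] at h2
    refine h2.congr' ?_
    filter_upwards [eventually_gt_atTop c] with k hk
    have : (k : ℝ) ≠ 0 := by
      have : 0 < k := by omega
      positivity
    rw [Nat.cast_sub hk.le]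
    field_simp
  have h3 := (h.comp (tendsto_sub_atTop_nat c)).mul (h1.pow d)
  have h4 := h.sub h3
  rw [one_pow, mul_one, sub_self] at h4
  refine tendsto_of_tendsto_of_tendsto_of_le_of_le' tendsto_const_nhds h4
    (Eventually.of_forall fun k => by positivity) ?_
  filter_upwards [eventually_gt_atTop c] with k hk
  have hk0 : ((k - c : ℕ) : ℝ) ≠ 0 := by
    have : 0 < k - c := by omega
    positivity
  have h5 : (hsFunction R (QuotSMulTop f R) k : ℝ) + hsFunction R R (k - c) ≤ hsFunction R R k := by
    exact_mod_cast hc k hk.le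
  simp only [comp_apply]
  rw [div_pow, div_mul_div_cancel₀ (pow_ne_zero d hk0), ← sub_div, ← mul_sub]
  gcongr
  linarith

/-- Over a domain, the leading coefficient of the Hilbert–Samuel function of a module that contains
`Rʳ` with torsion cokernel is `r` times that of `R`. -/
theorem tendsto_hsFunction_of_smul_mem_range {d : ℕ} {e : ℝ}
    (h : Tendsto (fun k : ℕ => (d.factorial : ℝ) * (hsFunction R R k : ℝ) / (k : ℝ) ^ d) atTop
      (nhds e)) {U : Type*} [AddCommGroup U] [Module R U] [Module.Finite R U] {r : ℕ}
    {i : (Fin r → R) →ₗ[R] U} {f : R} (hi : Injective i) (hf : IsSMulRegular R f)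
    (hU : ∀ u : U, f • u ∈ LinearMap.range i) :
    Tendsto (fun k : ℕ => (d.factorial : ℝ) * (hsFunction R U k : ℝ) / (k : ℝ) ^ d) atTop
      (nhds (r * e)) := by
  have hf0 := tendsto_hsFunction_quotSMulTop hf h
  have hT : ∀ t : U ⧸ LinearMap.range i, f • t = 0 := by
    intro t
    obtain ⟨u, rfl⟩ := Submodule.mkQ_surjective _ t
    exact (Submodule.Quotient.mk_eq_zero _).mpr (hU u)
  obtain ⟨s, p, hp⟩ := exists_surjective_quotSMulTop f hT
  have hupper : ∀ k, hsFunction R U k ≤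
      r * hsFunction R R k + s * hsFunction R (QuotSMulTop f R) k := fun k =>
    (hsFunction_le_add i (LinearMap.range i).mkQ (LinearMap.exact_map_mkQ_range i)
      (Submodule.mkQ_surjective _) k).trans (Nat.add_le_add (hsFunction_pi_le r R k)
        ((hsFunction_le_of_surjective p hp k).trans (hsFunction_pi_le s _ k)))
  -- Multiplication by `f` embeds `U` in `Rʳ` with cokernel killed by `f`.
  let j : U →ₗ[R] Fin r → R := (LinearEquiv.ofInjective i hi).symm.toLinearMap.comp
    ((DistribSMul.toLinearMap R U f).codRestrict (LinearMap.range i) hU)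
  have hj : ∀ a, j (i a) = f • a := by
    intro a
    exact (LinearEquiv.symm_apply_eq _).mpr (Subtype.ext (map_smul i f a).symm)
  have hT' : ∀ t : (Fin r → R) ⧸ LinearMap.range j, f • t = 0 := by
    intro t
    obtain ⟨a, rfl⟩ := Submodule.mkQ_surjective _ t
    exact (Submodule.Quotient.mk_eq_zero _).mpr ⟨i a, hj a⟩
  obtain ⟨s', p', hp'⟩ := exists_surjective_quotSMulTop f hT'
  have hlower : ∀ k, r * hsFunction R R k ≤
      hsFunction R U k + s' * hsFunction R (QuotSMulTop f R) k := fun k =>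
    (mul_hsFunction_le_pi r R k).trans <|
      (hsFunction_le_add j (LinearMap.range j).mkQ (LinearMap.exact_map_mkQ_range j)
        (Submodule.mkQ_surjective _) k).trans (Nat.add_le_add_left
          ((hsFunction_le_of_surjective p' hp' k).trans (hsFunction_pi_le s' _ k)) _)
  have h1 := (h.const_mul (r : ℝ)).add (hf0.const_mul (s : ℝ))
  have h2 := (h.const_mul (r : ℝ)).sub (hf0.const_mul (s' : ℝ))
  rw [mul_zero, add_zero] at h1
  rw [mul_zero, sub_zero] at h2
  refine tendsto_of_tendsto_of_tendsto_of_le_of_le h2 h1 (fun k => ?_) (fun k => ?_)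
  · have h3 : (r * hsFunction R R k : ℝ) ≤
        hsFunction R U k + s' * hsFunction R (QuotSMulTop f R) k := by exact_mod_cast hlower k
    simp only
    rw [← mul_div_assoc, ← mul_div_assoc, ← sub_div]
    gcongr
    nlinarith [Nat.cast_nonneg (α := ℝ) d.factorial]
  · have h3 : (hsFunction R U k : ℝ) ≤
        r * hsFunction R R k + s * hsFunction R (QuotSMulTop f R) k := by exact_mod_cast hupper k
    simp only
    rw [← mul_div_assoc, ← mul_div_assoc, ← add_div]
    gcongr
    nlinarith [Nat.cast_nonneg (α := ℝ) d.factorial]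

end RankHilbert

/-! ### Comparison of multiplicities -/

section Comparison

open Filter Asymptotics
open scoped TensorProduct

/-- Along a flat local homomorphism of local rings of the same dimension, the maximal ideal of `S`
is minimal over `𝔪S`. -/
theorem maximalIdeal_le_radical_map {R S : Type*} [CommRing R] [IsLocalRing R] [IsNoetherianRing R]
    [CommRing S] [IsLocalRing S] [IsNoetherianRing S] [Algebra R S] [Module.Flat R S]
    [IsLocalHom (algebraMap R S)] (hdim : ringKrullDim R = ringKrullDim S) :
    maximalIdeal S ≤ ((maximalIdeal R).map (algebraMap R S)).radical := by
  have h1 := Ideal.height_eq_height_add_of_liesOver_of_hasGoingDown (maximalIdeal R)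
    (maximalIdeal S)
  have h2 : (maximalIdeal R).height = (maximalIdeal S).height := by
    rw [← WithBot.coe_inj, maximalIdeal_height_eq_ringKrullDim,
      maximalIdeal_height_eq_ringKrullDim, hdim]
  set I := (maximalIdeal R).map (algebraMap R S) with hI
  have hIm : I ≤ maximalIdeal S := map_maximalIdeal_le _
  have hker : RingHom.ker (Ideal.Quotient.mk I) ≤ maximalIdeal S := by rwa [Ideal.mk_ker]
  have hprime : ((maximalIdeal S).map (Ideal.Quotient.mk I)).IsPrime :=
    Ideal.map_isPrime_of_surjective Ideal.Quotient.mk_surjective hker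
  have h3 : ((maximalIdeal S).map (Ideal.Quotient.mk I)).height = 0 := by
    rw [h2] at h1
    have hne : (maximalIdeal S).height ≠ ⊤ := Ideal.height_ne_top_of_isPrime
    exact ENat.add_right_injective_of_ne_top hne (h1.symm.trans (add_zero _).symm)
  rw [Ideal.height_eq_zero_iff] at h3
  rw [Ideal.radical_eq_sInf]
  refine le_sInf ?_
  rintro q ⟨hq, hqp⟩
  have hqm : q ≤ maximalIdeal S := le_maximalIdeal hqp.ne_top
  have hker' : RingHom.ker (Ideal.Quotient.mk I) ≤ q := by rwa [Ideal.mk_ker]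
  have hq' : (q.map (Ideal.Quotient.mk I)).IsPrime :=
    Ideal.map_isPrime_of_surjective Ideal.Quotient.mk_surjective hker'
  have h4 := Ideal.comap_mono (f := Ideal.Quotient.mk I)
    (h3.2 ⟨hq', bot_le⟩ (Ideal.map_mono hqm))
  rwa [Ideal.comap_map_of_surjective' _ Ideal.Quotient.mk_surjective,
    Ideal.comap_map_of_surjective' _ Ideal.Quotient.mk_surjective, sup_eq_left.mpr hker,
    sup_eq_left.mpr hker'] at h4

/-- The minimal number of generators is preserved by base change to the residue field of a local
extension, hence bounded by the length of `(S ⊗ U) / I (S ⊗ U)`. -/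
theorem nu_le_len_baseChange {R S : Type*} [CommRing R] [IsLocalRing R] [CommRing S] [IsLocalRing S]
    [Algebra R S] [IsLocalHom (algebraMap R S)] (U : Type*) [AddCommGroup U] [Module R U]
    [Module.Finite R U] {I : Ideal S} (hI : I ≤ maximalIdeal S)
    (hfin : Module.length S ((S ⊗[R] U) ⧸ (I • ⊤ : Submodule S (S ⊗[R] U))) ≠ ⊤) :
    nu R U ≤ len S ((S ⊗[R] U) ⧸ (I • ⊤ : Submodule S (S ⊗[R] U))) := by
  have h1 : nu R U = Module.finrank (ResidueField R) (ResidueField R ⊗[R] U) := by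
    rw [nu, ← TensorProduct.spanFinrank_top_eq_of_residueField _ Module.Finite.fg_top,
      ← Module.finrank_eq_spanFinrank_of_free]
    exact (TensorProduct.AlgebraTensorModule.congr (LinearEquiv.refl _ _)
      Submodule.topEquiv).finrank_eq
  have h2 : nu R U = Module.finrank (ResidueField S) (ResidueField S ⊗[R] U) := by
    rw [h1, ← Module.finrank_baseChange (R := ResidueField S)]
    exact (TensorProduct.AlgebraTensorModule.cancelBaseChange R (ResidueField R) (ResidueField S)
      (ResidueField S) U).finrank_eq
  let p : S ⊗[R] U →ₗ[S] ResidueField S ⊗[R] U :=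
    TensorProduct.AlgebraTensorModule.rTensor R U (Algebra.linearMap S (ResidueField S))
  have hp : Surjective p := LinearMap.rTensor_surjective U
    (g := (Algebra.linearMap S (ResidueField S)).restrictScalars R) residue_surjective
  have hle : I • ⊤ ≤ LinearMap.ker p := by
    rw [Submodule.smul_le]
    intro a ha z _
    rw [LinearMap.mem_ker, map_smul, ← algebraMap_smul (ResidueField S) a (p z),
      show algebraMap S (ResidueField S) a = 0 from (residue_eq_zero_iff a).mpr (hI ha), zero_smul]
  have h3 : (nu R U : ℕ∞) ≤ Module.length S (ResidueField S ⊗[R] U) := by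
    have := Submodule.length_le_length_restrictScalars S
      (⊤ : Submodule (ResidueField S) (ResidueField S ⊗[R] U))
    rw [h2, ← Module.length_eq_finrank]
    rwa [Module.length_top, Submodule.restrictScalars_top, Module.length_top] at this
  have h4 := h3.trans (Module.length_le_of_surjective (Submodule.liftQ _ p hle)
    (LinearMap.range_eq_top.mp (by rw [Submodule.range_liftQ, LinearMap.range_eq_top.mpr hp])))
  have h5 := ENat.toNat_le_toNat h4 hfin
  rwa [ENat.toNat_natCast] at h5

/-- The bound `ν(U) ≤ r e(S) + c χ₁(x, U)` over an extension with infinite residue field, with `r`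
the rank of `U` and `χ₁` in the form of the defect; `l` is the list of the elements of `x`. -/
theorem exists_nu_le {R : Type u} {S : Type v} [CommRing R] [IsLocalRing R] [IsNoetherianRing R]
    [IsDomain R] [CommRing S] [IsLocalRing S] [IsNoetherianRing S] [Infinite (ResidueField S)]
    [Algebra R S] [Module.Flat R S] [IsLocalHom (algebraMap R S)]
    (hS : maximalIdeal S ≤ ((maximalIdeal R).map (algebraMap R S)).radical) {l : List R}
    (hlm : ∀ z ∈ l, z ∈ maximalIdeal R) (hl : maximalIdeal R ≤ (Ideal.ofList l).radical) :
    ∃ e c : ℝ, Tendsto (fun k : ℕ => (l.length.factorial : ℝ) * (hsFunction S S k : ℝ) /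
        (k : ℝ) ^ l.length) atTop (nhds e) ∧
      ∀ (U : Type w) [AddCommGroup U] [Module R U] [Module.Finite R U], ∃ r : ℕ,
        (∀ e' : ℝ, Tendsto (fun k : ℕ => (l.length.factorial : ℝ) * (hsFunction R R k : ℝ) /
          (k : ℝ) ^ l.length) atTop (nhds e') →
          Tendsto (fun k : ℕ => (l.length.factorial : ℝ) * (hsFunction R U k : ℝ) /
            (k : ℝ) ^ l.length) atTop (nhds (r * e'))) ∧
        (nu R U : ℝ) ≤ r * e + c * defect l U := by
  have hlS : maximalIdeal S ≤ (Ideal.ofList ([] ++ l.map (algebraMap R S))).radical := by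
    rw [List.nil_append, ← Ideal.map_ofList]
    refine hS.trans ?_
    rw [Ideal.radical_le_radical_iff]
    exact (Ideal.map_mono hl).trans (Ideal.map_radical_le _)
  have hlSm : ∀ z ∈ l.map (algebraMap R S), z ∈ maximalIdeal S := by
    intro z hz
    obtain ⟨a, ha, rfl⟩ := List.mem_map.mp hz
    exact map_nonunit _ a (hlm a ha)
  obtain ⟨y, hlen, hsup, hrad, c, hc⟩ := exists_isSuperficialSeq_defect_le.{v, v, max v w}
    (l.map (algebraMap R S)) [] S hlSm hlS
  rw [List.length_map] at hlen
  rw [List.nil_append] at hrad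
  refine ⟨symb y S, c * len S (S ⧸ (maximalIdeal R).map (algebraMap R S)), ?_, fun U _ _ _ => ?_⟩
  · rw [← hlen]
    exact tendsto_factorial_mul_div
      (hsFunction_sub_isLittleO y S hsup (isParam_of_le_radical hrad S))
  obtain ⟨r, i, f, hi, hf, hU⟩ := exists_injective_smul_mem_range (R := R) U
  have hfreg : IsSMulRegular R f := fun a b hab => mul_left_cancel₀ hf hab
  refine ⟨r, fun e' he' => tendsto_hsFunction_of_smul_mem_range he' hi hfreg hU, ?_⟩
  have hym : Ideal.ofList y ≤ maximalIdeal S := by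
    rw [Ideal.ofList, Ideal.span_le]
    exact fun z hz => hsup.mem_maximalIdeal z hz
  have hfin : Module.length S ((S ⊗[R] U) ⧸ (Ideal.ofList y • ⊤ : Submodule S (S ⊗[R] U))) ≠ ⊤ := by
    refine length_ne_top_of_maximalIdeal_le_radical _ (hrad.trans (Ideal.radical_mono ?_))
    intro a ha
    rw [Module.mem_annihilator]
    intro z
    obtain ⟨z, rfl⟩ := Submodule.mkQ_surjective _ z
    exact (Submodule.Quotient.mk_eq_zero _).mpr (Submodule.smul_mem_smul ha Submodule.mem_top)
  have h1 := nu_le_len_baseChange U hym hfin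
  have h2 : (len S ((S ⊗[R] U) ⧸ (Ideal.ofList y • ⊤ : Submodule S (S ⊗[R] U))) : ℤ) =
      symb y (S ⊗[R] U) + defect y (S ⊗[R] U) := by rw [defect]; ring
  have h3 := hc (S ⊗[R] U)
  rw [List.nil_append, List.nil_append, defect_baseChange] at h3
  -- Only the free part of `U` contributes to the symbol.
  have h4 : symb y (S ⊗[R] U) = r * symb y S := by
    have hT : ∀ t : S ⊗[R] (U ⧸ LinearMap.range i), algebraMap R S f • t = 0 := by
      intro t
      induction t with
      | zero => rw [smul_zero]
      | tmul s t =>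
        obtain ⟨u, rfl⟩ := Submodule.mkQ_surjective _ t
        rw [algebraMap_smul, ← TensorProduct.tmul_smul, ← map_smul, Submodule.mkQ_apply,
          (Submodule.Quotient.mk_eq_zero _).mpr (hU u), TensorProduct.tmul_zero]
      | add a b ha hb => rw [smul_add, ha, hb, add_zero]
    have hfS : IsSMulRegular S (algebraMap R S f) := by
      have := Module.Flat.isSMulRegular_of_nonZeroDivisors (M := S)
        (mem_nonZeroDivisors_of_ne_zero hf)
      intro a b hab
      refine this ?_
      simpa [Algebra.smul_def] using hab
    have h5 := symb_eq_add_of_exact y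
      (TensorProduct.AlgebraTensorModule.lTensor S S i)
      (TensorProduct.AlgebraTensorModule.lTensor S S (LinearMap.range i).mkQ)
      (Module.Flat.lTensor_preserves_injective_linearMap i hi)
      (LinearMap.lTensor_surjective S (Submodule.mkQ_surjective _))
      (lTensor_exact S (LinearMap.exact_map_mkQ_range i) (Submodule.mkQ_surjective _))
      (isParam_of_le_radical hrad _)
    have h6 : symb y (S ⊗[R] (U ⧸ LinearMap.range i)) = 0 :=
      symb_eq_zero_of_smul_eq_zero hrad hfS hT
    rw [h5, h6, add_zero, symb_congr y (TensorProduct.piScalarRight R S S (Fin r)),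
      symb_pi y r S (isParam_of_le_radical hrad S)]
  have h6 : (nu R U : ℤ) ≤ r * symb y S +
      c * (defect l U * len S (S ⧸ (maximalIdeal R).map (algebraMap R S))) := by
    rw [← h4]
    linarith [(Nat.cast_le (α := ℤ)).mpr h1]
  have h7 : (nu R U : ℝ) ≤ r * symb y S +
      c * (defect l U * len S (S ⧸ (maximalIdeal R).map (algebraMap R S))) := by exact_mod_cast h6
  linarith

/-- The limit that defines the multiplicity of a Noetherian local ring exists. -/
theorem exists_tendsto_hsFunction {A : Type u} [CommRing A] [IsLocalRing A] [IsNoetherianRing A]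
    {l : List A} (hlm : ∀ z ∈ l, z ∈ maximalIdeal A)
    (hl : maximalIdeal A ≤ (Ideal.ofList l).radical) :
    ∃ e : ℝ, Tendsto (fun k : ℕ => (l.length.factorial : ℝ) * (hsFunction A A k : ℝ) /
        (k : ℝ) ^ l.length) atTop (nhds e) := by
  have hmap := map_maximalIdeal_ratExtension A
  have hl' : maximalIdeal (RatExtension A) ≤
      (Ideal.ofList ([] ++ l.map (algebraMap A (RatExtension A)))).radical := by
    rw [List.nil_append, ← Ideal.map_ofList, ← hmap]
    exact (Ideal.map_mono hl).trans (Ideal.map_radical_le _)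
  have hlm' : ∀ z ∈ l.map (algebraMap A (RatExtension A)), z ∈ maximalIdeal (RatExtension A) := by
    intro z hz
    obtain ⟨a, ha, rfl⟩ := List.mem_map.mp hz
    exact map_nonunit _ a (hlm a ha)
  obtain ⟨y, hlen, hsup, hrad, -⟩ := exists_isSuperficialSeq_defect_le.{u, u, u}
    (l.map (algebraMap A (RatExtension A))) [] (RatExtension A) hlm' hl'
  rw [List.length_map] at hlen
  rw [List.nil_append] at hrad
  have h := tendsto_factorial_mul_div (hsFunction_sub_isLittleO y (RatExtension A) hsup
    (isParam_of_le_radical hrad _))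
  rw [hlen] at h
  simp_rw [hsFunction_eq_of_map_maximalIdeal (RatExtension A) hmap] at h
  exact ⟨_, h⟩

end Comparison

end LimUlrich

open Filter LimUlrich IsLocalRing

theorem theoremB {R S : Type*} [CommRing R] [IsLocalRing R] [IsNoetherianRing R] [IsDomain R]
    [CommRing S] [IsLocalRing S] [IsNoetherianRing S]
    [Algebra R S] [Module.Flat R S] [IsLocalHom (algebraMap R S)]
    (hdim : ringKrullDim R = ringKrullDim S)
    (U : ℕ → Type*) [∀ n, AddCommGroup (U n)] [∀ n, Module R (U n)]
    (hU : LimUlrich.IsWeaklyLimUlrich R U) :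
    LimUlrich.ringMultiplicity R ≤ LimUlrich.ringMultiplicity S := by
  have hfin := hU.finite
  obtain ⟨x, hx, hchi⟩ := hU.exists_chiOne_isLittleO
  have hratio := hU.tendsto_multiplicity_div_nu
  set l := List.ofFn x with hl
  have hlen : l.length = dim R := List.length_ofFn
  have hdim' : dim S = dim R := by rw [dim, dim, hdim]
  have hspan : Ideal.ofList l = Ideal.span (Set.range x) := by
    rw [Ideal.ofList]
    congr 1
    ext z
    simp [hl, List.mem_ofFn]
  have hrad : maximalIdeal R ≤ (Ideal.ofList l).radical := by rw [hspan, hx]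
  have hlm : ∀ z ∈ l, z ∈ maximalIdeal R := by
    intro z hz
    rw [← show (Ideal.span (Set.range x)).radical = maximalIdeal R from hx, ← hspan]
    exact Ideal.le_radical (Ideal.subset_span hz)
  have hRS := maximalIdeal_le_radical_map (R := R) (S := S) hdim
  have hflat : Module.Flat R (RatExtension S) := Module.Flat.trans R S (RatExtension S)
  have hloc : IsLocalHom (algebraMap R (RatExtension S)) := by
    rw [IsScalarTower.algebraMap_eq R S (RatExtension S)]
    exact RingHom.isLocalHom_comp _ _
  have hRS' : maximalIdeal (RatExtension S) ≤
      ((maximalIdeal R).map (algebraMap R (RatExtension S))).radical := by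
    rw [← map_maximalIdeal_ratExtension S, IsScalarTower.algebraMap_eq R S (RatExtension S),
      ← Ideal.map_map]
    exact (Ideal.map_mono hRS).trans (Ideal.map_radical_le _)
  obtain ⟨eR, heR⟩ := exists_tendsto_hsFunction hlm hrad
  obtain ⟨eS, c, heS, hmain⟩ := exists_nu_le hRS' hlm hrad
  simp_rw [hsFunction_eq_of_map_maximalIdeal (RatExtension S) (map_maximalIdeal_ratExtension S),
    hlen] at heS
  rw [hlen] at heR
  have hR : ringMultiplicity R = eR := heR.limUnder_eq
  have hS : ringMultiplicity S = eS := by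
    rw [← hdim'] at heS
    exact heS.limUnder_eq
  have heR0 : 0 ≤ eR := ge_of_tendsto' heR fun k => by positivity
  rw [hR, hS]
  choose r hr hnu using fun n => hmain (U n)
  have hmult : ∀ n, hsMultiplicity (maximalIdeal R) (U n) = r n * eR := fun n => by
    have := hr n eR (by rw [hlen]; exact heR)
    rw [hlen] at this
    exact this.limUnder_eq
  simp_rw [hmult] at hratio
  have hdefect : ∀ n, (chiOne x (U n) : ℝ) = defect l (U n) := fun n => by
    rw [chiOne_eq_defect x (U n) (isParam_of_le_radical hrad (U n))]
  simp_rw [hdefect] at hchi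
  have hlim := (hratio.mul_const eS).add (hchi.tendsto_div_nhds_zero.const_mul (c * eR))
  rw [one_mul, mul_zero, add_zero] at hlim
  refine ge_of_tendsto hlim ?_
  filter_upwards [hratio.eventually (lt_mem_nhds (zero_lt_one))] with n hn
  -- The ratio is close to `1`, hence not the junk value `0` of a division by `ν = 0`.
  have hnu0 : (0 : ℝ) < nu R (U n) := by
    refine lt_of_le_of_ne (Nat.cast_nonneg _) fun h => ?_
    rw [← h, div_zero] at hn
    exact lt_irrefl _ hn
  have h1 := mul_le_mul_of_nonneg_right (hnu n) heR0
  rw [div_mul_eq_mul_div, ← mul_div_assoc, ← add_div, le_div_iff₀ hnu0]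
  linarith
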